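/- Theorem 5. Let $\bar\pi\colon(0,\infty)\to[0,\infty)$ be bounded with $\int_0^\infty\bar\pi(x)\,dx=1$ and finite entropy $$H(\bar\pi)=\int_0^\infty\bar\pi(x)\log\frac1{\bar\pi(x)}\,dx<\infty ,$$ where both integrals are understood as Riemann integrals over the half-line in the direct sense: $f=\bar\pi$ and $f=\bar\pi\log(1/\bar\pi)$ (with $0\log(1/0)=0$) are continuous almost everywhere and satisfy $\sum_{k\ge0}\sup_{k<x\le k+1}|f(x)|<\infty$. Put $$\bar\pi_i^n=\bar\pi\Bigl(\frac in\Bigr)\Big/\sum_{s=1}^\infty\bar\pi\Bigl(\frac sn\Bigr),\qquad b_n=\Bigl[2\log\frac{n}{\sqrt{\pi\log n}}\Bigr]^{1/2}.$$ Let $\xi_1,\xi_2,\dots$ be independent standard Gaussian random variables, let $e_1,e_2,\dots$ be independent standard exponential random variables, and let $$\zeta^\circ=\sum_{k=1}^\infty\Bigl[\Bigl(\sum_{s=1}^k e_s\Bigr)^{-1}-\frac1k\Bigr]+\gamma ,$$ where $\gamma$ is Euler's constant. For all large $n$ the $\bar\pi_i^n$, $i\ge1$, are well defined and sum to $1$,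 the series $\sum_i\bar\pi_i^n\exp(\xi_i^2/2)$ converges almost surely, and so does the series defining $\zeta^\circ$. As $n\to\infty$, $$\sum_{i=1}^\infty\bar\pi_i^n\exp\Bigl(\frac{\xi_i^2}2\Bigr)\stackrel{\mathbf P}{=}\sqrt{\frac2\pi}\Bigl[b_n+\frac{\zeta^\circ+H(\bar\pi)}{b_n}\Bigr]+o\Bigl(\frac1{\sqrt{\log n}}\Bigr).$$ Here $\kappa_n\stackrel{\mathbf P}{=}\kappa_n'+o(r_n)$ means that on some probability space there are versions of the random variables (each $\kappa_n$ with its own law, the sequence $(\kappa'_n)_n$ with its joint law) such that $\mathbf P\{|\kappa_n-\kappa'_n|/r_n\ge\epsilon\}\to0$ for every $\epsilon>0$. Consequently, for every $\alpha\in(0,1)$: the equation $\mathbf P\{\zeta^\circ\ge t\}=\alpha$ has a solution $t=t_\alpha^\circ$; for all large $n$ the equation $\mathbf P\{\sum_i\bar\pi_i^n\exp(\xi_i^2/2)\ge t\}=\alpha$ has a solution $t=t_\alpha^\circ(\bar\pi^n)$; and for any such solutions $$t_\alpha^\circ(\bar\pi^n)=\sqrt{\frac2\pi}\Bigl[b_n+\frac{t_\alpha^\circ+H(\bar\pi)}{b_n}\Bigr]+o\Bigl(\frac1{\sqrt{\log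 n}}\Bigr).$$ -/

import Mathlib

open MeasureTheory ProbabilityTheory Filter Topology Asymptotics

noncomputable section

/-- Direct Riemann integrability on the half-line `(0, ∞)`: `f` is continuous almost everywhere
and the suprema of `|f|` over the consecutive unit intervals are finite and have a finite sum.
(The usual criterion, equivalent to: the upper and lower Riemann sums of `f` over the uniform
partitions of the whole half-line converge absolutely and have the same finite limit as the
mesh tends to `0`.) -/
def DirectlyRiemannIntegrable (f : ℝ → ℝ) : Prop :=
  (∀ᵐ x ∂(volume.restrict (Set.Ioi (0 : ℝ))), ContinuousAt f x) ∧
  ∃ c : ℕ → ℝ, Summable c ∧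
    ∀ (k : ℕ) (x : ℝ), x ∈ Set.Ioc (k : ℝ) ((k : ℝ) + 1) → |f x| ≤ c k

/-- The entropy `H(π) = ∫₀^∞ π(x) log (1 / π(x)) dx` (with `0 log (1/0) = 0`). -/
def entropy (π : ℝ → ℝ) : ℝ :=
  ∫ x in Set.Ioi (0 : ℝ), π x * Real.log (1 / π x)

/-- The prior profiles: bounded probability densities `π` on `(0, ∞)` such that the integrals
`∫ π` and `∫ π log (1/π)` exist as (direct) Riemann integrals over the half-line. Only the values
of `π` on `(0, ∞)` are used. -/
structure IsPriorDensity (π : ℝ → ℝ) : Prop where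
  nonneg : ∀ x, 0 < x → 0 ≤ π x
  bounded : ∃ C : ℝ, ∀ x, 0 < x → π x ≤ C
  riemann : DirectlyRiemannIntegrable π
  integral_eq_one : ∫ x in Set.Ioi (0 : ℝ), π x = 1
  riemann_entropy : DirectlyRiemannIntegrable (fun x => π x * Real.log (1 / π x))

/-- The prior probability of channel `i + 1`:
`π_{i+1}^n = π((i+1)/n) / ∑_{s ≥ 1} π(s/n)`. Channels are numbered `1, 2, …` and
indexed by `i = 0, 1, …`. -/
def priorWeight (π : ℝ → ℝ) (n i : ℕ) : ℝ :=
  π (((i : ℝ) + 1) / n) / ∑' s : ℕ, π (((s : ℝ) + 1) / n)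

/-- The Bayes test statistic `∑_i π_i^n exp (ξ_i² / 2)`. -/
def bayesStat {Ω : Type*} (π : ℝ → ℝ) (ξ : ℕ → Ω → ℝ) (n : ℕ) (ω : Ω) : ℝ :=
  ∑' i : ℕ, priorWeight π n i * Real.exp (ξ i ω ^ 2 / 2)

/-- The `(k+1)`-st term `(e_1 + ⋯ + e_{k+1})⁻¹ - 1/(k+1)` of the series defining `ζ°`
(here `e s` stands for `e_{s+1}`). -/
def zetaTerm {Ω : Type*} (e : ℕ → Ω → ℝ) (k : ℕ) (ω : Ω) : ℝ :=
  (∑ s ∈ Finset.range (k + 1), e s ω)⁻¹ - 1 / ((k : ℝ) + 1)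

/-- `ζ° = ∑_{k ≥ 1} [(e_1 + ⋯ + e_k)⁻¹ - 1/k] + γ`. -/
def zetaCirc {Ω : Type*} (e : ℕ → Ω → ℝ) (ω : Ω) : ℝ :=
  (∑' k : ℕ, zetaTerm e k ω) + Real.eulerMascheroniConstant

/-- `b_n = [2 log (n / √(π log n))]^{1/2}`. -/
def bSeq (n : ℕ) : ℝ :=
  √(2 * Real.log ((n : ℝ) / √(Real.pi * Real.log n)))

/-- The expansion `√(2/π) [b_n + (z + h) / b_n]`. -/
def bayesExpansion (z h : ℝ) (n : ℕ) : ℝ :=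
  √(2 / Real.pi) * (bSeq n + (z + h) / bSeq n)

/-- `κ_n = κ'_n + o(r_n)` in probability, for sequences of random variables given through their
distributions: there are a probability space and versions `K n`, `K' n` on it
with `P {|K n - K' n| / r n ≥ ε} → 0` for every `ε > 0`. Each `K n` has the law of `κ n`, and the
sequence `(K' n)_n` has the joint law of `(κ' n)_n`; in particular, if every `κ' n` is a function of
one random variable, the same is true of the versions. -/
def EqInProbUpTo {Ω₁ Ω₂ : Type*} [MeasurableSpace Ω₁] [MeasurableSpace Ω₂]
    (P₁ : Measure Ω₁) (P₂ : Measure Ω₂)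
    (κ : ℕ → Ω₁ → ℝ) (κ' : ℕ → Ω₂ → ℝ) (r : ℕ → ℝ) : Prop :=
  ∃ (Ω : Type) (_ : MeasurableSpace Ω) (P : Measure Ω) (_ : IsProbabilityMeasure P)
    (K K' : ℕ → Ω → ℝ),
    (∀ n, IdentDistrib (K n) (κ n) P P₁) ∧
    IdentDistrib (fun ω n => K' n ω) (fun ω n => κ' n ω) P P₂ ∧
    ∀ ε : ℝ, 0 < ε →
      Tendsto (fun n => P {ω | ε ≤ |K n ω - K' n ω| / r n}) atTop (𝓝 0)

/-- `t` is an upper `α`-critical value of `X`: `P {X ≥ t} = α`. -/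
def IsCriticalValue {Ω : Type*} [MeasurableSpace Ω] (P : Measure Ω) (X : Ω → ℝ) (α t : ℝ) : Prop :=
  P {ω | t ≤ X ω} = ENNReal.ofReal α

end

/-!
The statistic is a weighted sum of independent copies of `X = exp (ξ² / 2)`, whose tail
`P (X > x) ~ 1 / (x √(π log x))` has index `1`. Scaled by `b_n √(π/2) ~ √(π log n)`, the terms
form in the limit a Poisson process with intensity `dy / y²`, and the statistic, suitably
centred, converges in law to the compensated sum of its points, which is `ζ°`.

The proof compares characteristic functions. For a single term, the mean of `s X` truncated at `1` is
exactly `2 s √(log (1/s) / π)`, and the compensated remainder is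
`s / √(π log (1/s)) (K(θ) + o(1))` as `s → 0`, with the Lévy exponent `K = levyExponent`
(`scaledCharSubOne_eq`, `tendsto_tailCoef`). With `s = β_n π(i/n)`, where `2 log (1/β_n) = b_n² + o(1)`,
expanding the square root turns the truncated mean into the contribution
`π(i/n) (b_n² - log π(i/n)) / n` and the remainder into `π(i/n) K(θ) / n`. Summation over `i` is a
Riemann sum with a varying integrand, dominated by `π + |π log π|`
(`IsPriorDensity.tendsto_riemannSum`), so the exponent is `iθ (b_n² + H) + K(θ) + o(1)`
(`IsPriorDensity.tendsto_sum_scaledCharSubOne`).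

On the other side, with `Γ_k = e_1 + ⋯ + e_k` and `V' = -(e^{iθ/x} - 1) V`, `V(0) = e^{K(θ)}`, the
process `exp (iθ ∑_{j ≤ k} 1/Γ_j) V(Γ_k)` is a bounded martingale. It converges to
`exp (iθ ζ°)`, because `V(x) ~ exp (-iθ log x)` and `Γ_k / k → 1`; hence `ζ°` has the characteristic
function `e^{K(θ)}` (`charFun_zetaCirc`). The law of `ζ°` has no atoms and charges every interval
since, for fixed `e_2, e_3, …`, `ζ°` is a continuous strictly decreasing function of `e_1` from
`(0, ∞)` onto `ℝ`.

By Lévy's continuity theorem the distribution functions converge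
(`IsPriorDensity.tendsto_cdf_bayesStat`). The coupling is the quantile coupling on `ℝ` with the law of
`ζ°`, and it converges at every point because the limit distribution function is strictly
increasing; the critical values are squeezed in the same way.
-/

/-! ### The Lévy kernel and the law of `s exp (ξ² / 2)` -/

/-- The compensated exponential `e^{iθy} - 1 - iθy 1_{y < 1}`, integrated against the Lévy measure
`dy / y²` in the characteristic exponent of the limit law. -/
noncomputable def levyKernel (θ y : ℝ) : ℂ :=
  Complex.exp (Complex.I * ((θ * y : ℝ) : ℂ)) - 1
    - (if y < 1 then Complex.I * ((θ * y : ℝ) : ℂ) else 0)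

/-- The characteristic exponent `∫₀^∞ (e^{iθ/y} - 1 - iθ/y 1_{y > 1}) dy` of the limit law. The
Lévy measure is written as the image of Lebesgue measure under `y ↦ 1/y`. -/
noncomputable def levyExponent (θ : ℝ) : ℂ := ∫ y in Set.Ioi (0 : ℝ), levyKernel θ y⁻¹

lemma measurable_levyKernel (θ : ℝ) : Measurable (levyKernel θ) := by
  unfold levyKernel
  refine Measurable.sub (by fun_prop) (Measurable.ite measurableSet_Iio (by fun_prop) (by fun_prop))

lemma norm_levyKernel_le_sq (θ y : ℝ) (hy : 0 < y) :
    ‖levyKernel θ y‖ ≤ (2 + 3 * θ ^ 2) * y ^ 2 := by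
  unfold levyKernel
  have h2 : ‖Complex.exp (Complex.I * ((θ * y : ℝ) : ℂ)) - 1‖ ≤ 2 :=
    (norm_sub_le _ _).trans (by rw [Complex.norm_exp_I_mul_ofReal]; norm_num)
  have hn : ‖Complex.I * ((θ * y : ℝ) : ℂ)‖ = |θ * y| := by
    rw [norm_mul, Complex.norm_I, one_mul, Complex.norm_real, Real.norm_eq_abs]
  split_ifs with h
  · by_cases h1 : |θ * y| ≤ 1
    · refine (Complex.norm_exp_sub_one_sub_id_le (by rw [hn]; exact h1)).trans ?_
      rw [hn, sq_abs]; nlinarith [sq_nonneg y, sq_nonneg (θ * y)]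
    · push Not at h1
      refine (norm_sub_le _ _).trans ?_
      rw [hn]
      have : |θ * y| ^ 2 = θ ^ 2 * y ^ 2 := by rw [sq_abs]; ring
      nlinarith [sq_nonneg y]
  · push Not at h
    rw [sub_zero]
    refine h2.trans ?_
    nlinarith [sq_nonneg θ, mul_nonneg (sq_nonneg θ) (sq_nonneg y)]

lemma norm_levyKernel_le_const (θ y : ℝ) (hy : 0 < y) :
    ‖levyKernel θ y‖ ≤ 2 + 3 * θ ^ 2 := by
  by_cases h : y < 1
  · refine (norm_levyKernel_le_sq θ y hy).trans ?_
    have : y ^ 2 ≤ 1 := by nlinarith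
    nlinarith [sq_nonneg θ]
  · unfold levyKernel
    rw [if_neg h, sub_zero]
    refine (norm_sub_le _ _).trans ?_
    rw [Complex.norm_exp_I_mul_ofReal]; norm_num; nlinarith [sq_nonneg θ]

lemma integrableOn_levyKernel_inv (θ : ℝ) :
    IntegrableOn (fun y : ℝ => levyKernel θ y⁻¹) (Set.Ioi 0) := by
  have hm : Measurable (fun y : ℝ => levyKernel θ y⁻¹) :=
    (measurable_levyKernel θ).comp measurable_inv
  rw [← Set.Ioc_union_Ioi_eq_Ioi zero_le_one]
  refine IntegrableOn.union ?_ ?_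
  · refine Measure.integrableOn_of_bounded (M := 2 + 3 * θ ^ 2) (by simp)
      hm.aestronglyMeasurable ?_
    filter_upwards [ae_restrict_mem measurableSet_Ioc] with y hy
    exact norm_levyKernel_le_const θ _ (inv_pos.2 hy.1)
  · have hi : IntegrableOn (fun y : ℝ => (2 + 3 * θ ^ 2) * y ^ (-2 : ℝ)) (Set.Ioi 1) :=
      (integrableOn_Ioi_rpow_of_lt (by norm_num) one_pos).const_mul _
    refine Integrable.mono' hi hm.aestronglyMeasurable ?_
    filter_upwards [ae_restrict_mem measurableSet_Ioi] with y hy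
    have hy0 : (0 : ℝ) < y := lt_trans one_pos hy
    refine (norm_levyKernel_le_sq θ _ (inv_pos.2 hy0)).trans (le_of_eq ?_)
    rw [Real.rpow_neg hy0.le, inv_pow]; norm_num

lemma integral_eq_two_smul_of_even {f : ℝ → ℂ} (he : ∀ x, f (-x) = f x) (hf : Integrable f) :
    ∫ x, f x = (2 : ℝ) • ∫ x in Set.Ioi (0 : ℝ), f x := by
  have h1 : ∫ x in Set.Iic (0 : ℝ), f x = ∫ x in Set.Ioi (0 : ℝ), f x := by
    have := integral_comp_neg_Iic (0 : ℝ) f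
    simp only [he, neg_zero] at this
    exact this
  rw [← intervalIntegral.integral_Iic_add_Ioi (b := (0 : ℝ)) hf.integrableOn hf.integrableOn, h1,
    two_smul]

lemma integral_gaussian_of_even {f : ℝ → ℂ} (he : ∀ x, f (-x) = f x)
    (hf : Integrable f (gaussianReal 0 1)) :
    ∫ x, f x ∂(gaussianReal 0 1)
      = √(2 / Real.pi) • ∫ x in Set.Ioi (0 : ℝ), Real.exp (-(x ^ 2 / 2)) • f x := by
  have hpdf : ∀ x, gaussianPDFReal 0 1 x = (√(2 * Real.pi))⁻¹ * Real.exp (-(x ^ 2 / 2)) := by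
    intro x; simp [gaussianPDFReal, neg_div]
  rw [integral_gaussianReal_eq_integral_smul one_ne_zero]
  have hint : Integrable (fun x => gaussianPDFReal 0 1 x • f x) := by
    rw [gaussianReal_of_var_ne_zero _ one_ne_zero] at hf
    have := (integrable_withDensity_iff_integrable_smul'
      (measurable_gaussianPDF 0 1) (by simp [gaussianPDF_lt_top])).1 hf
    simpa [toReal_gaussianPDF] using this
  rw [integral_eq_two_smul_of_even (fun x => by rw [he, hpdf, hpdf, neg_sq]) hint]
  simp_rw [hpdf, mul_smul]
  rw [integral_smul, smul_smul]
  congr 1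
  rw [Real.sqrt_div (by norm_num), Real.sqrt_mul (by norm_num)]
  have h2 : √2 * √2 = 2 := Real.mul_self_sqrt (by norm_num)
  have : √2 ≠ 0 := by positivity
  have : √Real.pi ≠ 0 := by positivity
  field_simp
  nlinarith

/-- The law of `1 / (s exp (ξ² / 2))` for a standard Gaussian `ξ`: it has the density
`s / √(π log (1 / (s y)))` on `(0, 1/s)`. -/
lemma integral_gaussian_comp_scaled {s : ℝ} (hs : 0 < s) (g : ℝ → ℂ)
    (hg : Integrable (fun x : ℝ => g (s * Real.exp (x ^ 2 / 2))) (gaussianReal 0 1)) :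
    ∫ x, g (s * Real.exp (x ^ 2 / 2)) ∂(gaussianReal 0 1)
      = ∫ y in Set.Ioo 0 s⁻¹, (s / √(Real.pi * Real.log (s * y)⁻¹)) • g y⁻¹ := by
  rw [integral_gaussian_of_even (fun x => by rw [neg_sq]) hg]
  set f : ℝ → ℝ := fun u => Real.exp (-(u ^ 2 / 2)) / s with hfdef
  have himg : f '' Set.Ioi 0 = Set.Ioo 0 s⁻¹ := by
    ext y
    simp only [Set.mem_image, Set.mem_Ioi, Set.mem_Ioo, hfdef]
    constructor
    · rintro ⟨u, hu, rfl⟩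
      refine ⟨by positivity, ?_⟩
      rw [inv_eq_one_div]
      gcongr
      rw [Real.exp_lt_one_iff]
      have : 0 < u ^ 2 := by positivity
      linarith
    · rintro ⟨h0, h1⟩
      have hsy : s * y < 1 := by rwa [lt_inv_comm₀ h0 hs, inv_eq_one_div, lt_div_iff₀ h0] at h1
      have hl : 0 < -Real.log (s * y) := neg_pos.2 (Real.log_neg (by positivity) hsy)
      refine ⟨√(2 * -Real.log (s * y)), by positivity, ?_⟩
      rw [Real.sq_sqrt (by positivity)]
      have : -(2 * -Real.log (s * y) / 2) = Real.log (s * y) := by ring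
      rw [this, Real.exp_log (by positivity)]
      field_simp
  have hinj : Set.InjOn f (Set.Ioi 0) := by
    intro a ha b hb hab
    simp only [hfdef] at hab
    have h1 := Real.exp_injective ((div_left_inj' hs.ne').1 hab)
    have ha' : (0 : ℝ) < a := ha
    have hb' : (0 : ℝ) < b := hb
    nlinarith
  have hder : ∀ u ∈ Set.Ioi (0 : ℝ),
      HasDerivWithinAt f (-(u * Real.exp (-(u ^ 2 / 2)) / s)) (Set.Ioi 0) u := by
    intro u _
    have h1 : HasDerivAt (fun u : ℝ => -(u ^ 2 / 2)) (-u) u := by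
      refine ((hasDerivAt_pow 2 u).div_const 2).fun_neg.congr_deriv ?_
      norm_num
    exact ((h1.exp.div_const s).congr_deriv (by ring)).hasDerivWithinAt
  rw [← himg, integral_image_eq_integral_abs_deriv_smul measurableSet_Ioi hder hinj,
    ← integral_smul]
  refine setIntegral_congr_fun measurableSet_Ioi fun u hu => ?_
  have hu : (0 : ℝ) < u := hu
  have h1 : (s * f u)⁻¹ = Real.exp (u ^ 2 / 2) := by
    simp only [hfdef]; rw [mul_div_cancel₀ _ hs.ne', Real.exp_neg, inv_inv]
  have h2 : (f u)⁻¹ = s * Real.exp (u ^ 2 / 2) := by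
    simp only [hfdef]; rw [inv_div, Real.exp_neg, div_inv_eq_mul]
  simp only [h1, h2, Real.log_exp, abs_neg]
  rw [smul_smul, smul_smul, abs_of_pos (by positivity)]
  congr 1
  have h3 : √(Real.pi * (u ^ 2 / 2)) = √Real.pi * u / √2 := by
    rw [Real.sqrt_mul Real.pi_pos.le, Real.sqrt_div (sq_nonneg u), Real.sqrt_sq hu.le, mul_div_assoc]
  rw [h3, Real.sqrt_div (by norm_num)]
  have : √Real.pi ≠ 0 := by positivity
  field_simp

lemma measurable_scaled_exp (s : ℝ) : Measurable (fun x : ℝ => s * Real.exp (x ^ 2 / 2)) := by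
  fun_prop

lemma integrable_comp_scaled_exp_of_bounded {s : ℝ} (hs : 0 < s) {g : ℝ → ℂ} (hg : Measurable g)
    {C : ℝ} (hC : ∀ y, 0 < y → ‖g y‖ ≤ C) :
    Integrable (fun x : ℝ => g (s * Real.exp (x ^ 2 / 2))) (gaussianReal 0 1) :=
  Integrable.of_bound ((hg.comp (measurable_scaled_exp s)).aestronglyMeasurable) C
    (Eventually.of_forall fun x => hC _ (by positivity))

/-- The uncentred tail part of the expansion of the characteristic function of
`s exp (ξ² / 2)` as `s → 0`. Values below `s^{3/4}` contribute `O(s^{3/2})`; on the rest the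
logarithm in the density is at least a quarter of `log (1/s)`, so dominated convergence applies. -/
lemma tendsto_integral_levyKernel (θ : ℝ) :
    Tendsto (fun s : ℝ => (√(Real.pi * Real.log s⁻¹) / s) •
        ∫ x, levyKernel θ (s * Real.exp (x ^ 2 / 2)) ∂(gaussianReal 0 1))
      (𝓝[>] 0) (𝓝 (levyExponent θ)) := by
  set C : ℝ := 2 + 3 * θ ^ 2 with hC
  have hC0 : 0 ≤ C := by positivity
  have hlt : ∀ᶠ s : ℝ in 𝓝[>] 0, s ∈ Set.Ioo (0 : ℝ) 1 := Ioo_mem_nhdsGT one_pos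
  set hi : ℝ → ℝ → ℂ := fun s z => if s ^ (3 / 4 : ℝ) ≤ z then levyKernel θ z else 0 with hhi
  set lo : ℝ → ℝ → ℂ := fun s z => if s ^ (3 / 4 : ℝ) ≤ z then 0 else levyKernel θ z with hlo
  have hmhi : ∀ s, Measurable (hi s) := fun s =>
    Measurable.ite measurableSet_Ici (measurable_levyKernel θ) measurable_const
  have hmlo : ∀ s, Measurable (lo s) := fun s =>
    Measurable.ite measurableSet_Ici measurable_const (measurable_levyKernel θ)
  have hbhi : ∀ s y, 0 < y → ‖hi s y‖ ≤ C := by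
    intro s y hy; simp only [hhi]; split_ifs
    · exact norm_levyKernel_le_const θ y hy
    · simpa using hC0
  have hblo : ∀ s y, 0 < y → ‖lo s y‖ ≤ C := by
    intro s y hy; simp only [hlo]; split_ifs
    · simpa using hC0
    · exact norm_levyKernel_le_const θ y hy
  have hsplit : ∀ᶠ s : ℝ in 𝓝[>] 0,
      (√(Real.pi * Real.log s⁻¹) / s) •
        ∫ x, lo s (s * Real.exp (x ^ 2 / 2)) ∂(gaussianReal 0 1) +
      ∫ y in Set.Ioi (0 : ℝ), ((√(Real.log s⁻¹) / √(Real.log s⁻¹ - Real.log y)) • hi s y⁻¹) =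
      (√(Real.pi * Real.log s⁻¹) / s) •
        ∫ x, levyKernel θ (s * Real.exp (x ^ 2 / 2)) ∂(gaussianReal 0 1) := by
    filter_upwards [hlt] with s hs
    have hL : 0 < Real.log s⁻¹ := Real.log_pos ((one_lt_inv₀ hs.1).2 hs.2)
    have e1 : ∀ x : ℝ, levyKernel θ (s * Real.exp (x ^ 2 / 2))
        = lo s (s * Real.exp (x ^ 2 / 2)) + hi s (s * Real.exp (x ^ 2 / 2)) := by
      intro x; simp only [hhi, hlo]; split_ifs <;> simp
    simp_rw [e1]
    rw [integral_add (integrable_comp_scaled_exp_of_bounded hs.1 (hmlo s) (hblo s))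
      (integrable_comp_scaled_exp_of_bounded hs.1 (hmhi s) (hbhi s)), smul_add]
    congr 1
    rw [integral_gaussian_comp_scaled hs.1 (hi s)
      (integrable_comp_scaled_exp_of_bounded hs.1 (hmhi s) (hbhi s)), ← integral_smul]
    have hsub : Set.Ioo 0 s⁻¹ ⊆ Set.Ioi (0 : ℝ) := fun y hy => hy.1
    have hz : ∀ y ∈ Set.Ioi (0 : ℝ) \ Set.Ioo 0 s⁻¹,
        (√(Real.log s⁻¹) / √(Real.log s⁻¹ - Real.log y)) • hi s y⁻¹ = 0 := by
      intro y hy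
      have hy0 : (0 : ℝ) < y := hy.1
      have : s⁻¹ ≤ y := by
        by_contra h; exact hy.2 ⟨hy0, not_le.1 h⟩
      have h1 : y⁻¹ ≤ s := (inv_le_comm₀ hy0 hs.1).2 this
      have h2 : s < s ^ (3 / 4 : ℝ) := by
        conv_lhs => rw [← Real.rpow_one s]
        exact Real.rpow_lt_rpow_of_exponent_gt hs.1 hs.2 (by norm_num)
      simp only [hhi]
      rw [if_neg (by linarith), smul_zero]
    rw [setIntegral_eq_of_subset_of_forall_sdiff_eq_zero measurableSet_Ioi hsub hz]
    refine setIntegral_congr_fun measurableSet_Ioo fun y hy => ?_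
    simp only [smul_smul]
    congr 1
    have e2 : Real.log (s * y)⁻¹ = Real.log s⁻¹ - Real.log y := by
      rw [Real.log_inv, Real.log_inv, Real.log_mul hs.1.ne' hy.1.ne']; ring
    rw [e2, Real.sqrt_mul Real.pi_pos.le, Real.sqrt_mul Real.pi_pos.le]
    have : √Real.pi ≠ 0 := by positivity
    have := hs.1.ne'
    field_simp
  refine Tendsto.congr' hsplit ?_
  rw [← zero_add (levyExponent θ)]
  refine Tendsto.add ?_ ?_
  · -- the part below the cut
    have hbd : ∀ᶠ s : ℝ in 𝓝[>] 0, ‖(√(Real.pi * Real.log s⁻¹) / s) •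
        ∫ x, lo s (s * Real.exp (x ^ 2 / 2)) ∂(gaussianReal 0 1)‖
          ≤ C * √(Real.pi * (Real.log s⁻¹ * s)) := by
      filter_upwards [hlt] with s hs
      have h1 : ‖∫ x, lo s (s * Real.exp (x ^ 2 / 2)) ∂(gaussianReal 0 1)‖
          ≤ C * (s * √s) := by
        refine (norm_integral_le_of_norm_le_const (C := C * (s * √s))
          (Eventually.of_forall fun x => ?_)).trans (by simp)
        have hz : 0 < s * Real.exp (x ^ 2 / 2) := mul_pos hs.1 (Real.exp_pos _)
        simp only [hlo]
        split_ifs with h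
        · simp; have := hs.1; positivity
        · push Not at h
          refine (norm_levyKernel_le_sq θ _ hz).trans ?_
          gcongr
          calc (s * Real.exp (x ^ 2 / 2)) ^ 2 ≤ (s ^ (3 / 4 : ℝ)) ^ 2 := by gcongr
            _ = s * √s := by
              rw [← Real.rpow_natCast, ← Real.rpow_mul hs.1.le, Real.sqrt_eq_rpow,
                ← Real.rpow_one_add' hs.1.le (by norm_num)]
              norm_num
      have hs0 := hs.1
      have hL : 0 < Real.log s⁻¹ := Real.log_pos ((one_lt_inv₀ hs.1).2 hs.2)
      rw [norm_smul, Real.norm_of_nonneg (by positivity)]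
      calc √(Real.pi * Real.log s⁻¹) / s * _ ≤ √(Real.pi * Real.log s⁻¹) / s * (C * (s * √s)) := by
            gcongr
        _ = C * (√(Real.pi * Real.log s⁻¹) * √s) := by field_simp
        _ = C * √(Real.pi * (Real.log s⁻¹ * s)) := by
            rw [← Real.sqrt_mul (by positivity), mul_assoc]
    refine squeeze_zero_norm' hbd ?_
    have h1 : Tendsto (fun s : ℝ => Real.log s⁻¹ * s) (𝓝[>] 0) (𝓝 0) := by
      have h2 := Real.continuous_mul_log.tendsto 0
      have h3 : Tendsto (fun s : ℝ => -(s * Real.log s)) (𝓝[>] 0) (𝓝 0) := by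
        simpa using (h2.mono_left nhdsWithin_le_nhds).neg
      refine h3.congr fun s => ?_
      rw [Real.log_inv]; ring
    have h4 : Tendsto (fun s : ℝ => C * √(Real.pi * (Real.log s⁻¹ * s))) (𝓝[>] 0)
        (𝓝 (C * √(Real.pi * 0))) := ((h1.const_mul _).sqrt).const_mul _
    simpa using h4
  · have hLinf : Tendsto (fun s : ℝ => Real.log s⁻¹) (𝓝[>] 0) atTop :=
      Real.tendsto_log_atTop.comp tendsto_inv_nhdsGT_zero
    refine tendsto_integral_filter_of_dominated_convergence
      (fun y => 2 * ‖levyKernel θ y⁻¹‖) ?_ ?_ ((integrableOn_levyKernel_inv θ).norm.const_mul 2) ?_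
    · refine Eventually.of_forall fun s => Measurable.aestronglyMeasurable ?_
      have h1 : Measurable fun y : ℝ => √(Real.log s⁻¹) / √(Real.log s⁻¹ - Real.log y) := by
        fun_prop
      exact h1.smul ((hmhi s).comp measurable_inv)
    · filter_upwards [hlt] with s hs
      filter_upwards [ae_restrict_mem measurableSet_Ioi] with y hy
      have hy0 : (0 : ℝ) < y := hy
      have hL : 0 < Real.log s⁻¹ := Real.log_pos ((one_lt_inv₀ hs.1).2 hs.2)
      simp only [hhi]
      split_ifs with h
      · rw [norm_smul, Real.norm_of_nonneg (by positivity)]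
        gcongr
        have h1 : Real.log y ≤ 3 / 4 * Real.log s⁻¹ := by
          have := Real.log_le_log (Real.rpow_pos_of_pos hs.1 _) h
          rw [Real.log_rpow hs.1, Real.log_inv] at this
          rw [Real.log_inv]; linarith
        have h2 : 0 < Real.log s⁻¹ - Real.log y := by linarith
        rw [div_le_iff₀ (by positivity)]
        calc √(Real.log s⁻¹) ≤ √(2 ^ 2 * (Real.log s⁻¹ - Real.log y)) :=
              Real.sqrt_le_sqrt (by linarith)
          _ = 2 * √(Real.log s⁻¹ - Real.log y) := by
              rw [Real.sqrt_mul (by norm_num), Real.sqrt_sq (by norm_num)]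
      · simp
    · filter_upwards [ae_restrict_mem measurableSet_Ioi] with y hy
      have hy0 : (0 : ℝ) < y := hy
      have hcut : ∀ᶠ s : ℝ in 𝓝[>] 0, levyKernel θ y⁻¹ = hi s y⁻¹ := by
        have h1 : Tendsto (fun s : ℝ => s ^ (3 / 4 : ℝ)) (𝓝[>] 0) (𝓝 0) := by
          have := (Real.continuousAt_rpow_const 0 (3 / 4 : ℝ) (Or.inr (by norm_num))).tendsto
          rw [Real.zero_rpow (by norm_num)] at this
          exact this.mono_left nhdsWithin_le_nhds
        filter_upwards [h1.eventually (gt_mem_nhds (inv_pos.2 hy0))] with s hs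
        simp only [hhi]
        rw [if_pos hs.le]
      have hrat : Tendsto (fun s : ℝ => √(Real.log s⁻¹) / √(Real.log s⁻¹ - Real.log y))
          (𝓝[>] 0) (𝓝 1) := by
        have h1 : Tendsto (fun L : ℝ => L / (L - Real.log y)) atTop (𝓝 1) := by
          have h2 : Tendsto (fun L : ℝ => 1 + Real.log y / (L - Real.log y)) atTop (𝓝 (1 + 0)) :=
            tendsto_const_nhds.add (tendsto_const_nhds.div_atTop
              (tendsto_atTop_add_const_right _ (-Real.log y) tendsto_id))
          rw [add_zero] at h2
          refine h2.congr' ?_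
          filter_upwards [eventually_gt_atTop (Real.log y)] with L hL
          have : L - Real.log y ≠ 0 := by linarith [sub_pos.2 hL]
          field_simp; ring
        have h3 := (h1.comp hLinf).sqrt
        rw [Real.sqrt_one] at h3
        refine h3.congr' ?_
        filter_upwards [hlt] with s hs
        have hL : 0 < Real.log s⁻¹ := Real.log_pos ((one_lt_inv₀ hs.1).2 hs.2)
        simp only [Function.comp]
        rw [Real.sqrt_div hL.le]
      have := (hrat.smul (tendsto_const_nhds (x := levyKernel θ y⁻¹)))
      rw [one_smul] at this
      refine this.congr' ?_
      filter_upwards [hcut] with s hs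
      rw [← hs]

/-! ### The characteristic function of `s exp (ξ² / 2)` for small `s` -/

/-- The truncated mean of `s exp (ξ² / 2)`. It is explicit because `exp (x² / 2)` cancels the
Gaussian density. -/
lemma integral_truncated_scaled_exp {s : ℝ} (hs : s ∈ Set.Ioo (0 : ℝ) 1) :
    ∫ x, (if s * Real.exp (x ^ 2 / 2) < 1 then s * Real.exp (x ^ 2 / 2) else 0)
      ∂(gaussianReal 0 1) = s * (2 * √(Real.log s⁻¹ / Real.pi)) := by
  have hs0 := hs.1
  have hL : 0 < Real.log s⁻¹ := Real.log_pos ((one_lt_inv₀ hs.1).2 hs.2)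
  set a : ℝ := √(2 * Real.log s⁻¹) with ha
  have hiff : ∀ x : ℝ, s * Real.exp (x ^ 2 / 2) < 1 ↔ x ∈ Set.Ioo (-a) a := by
    intro x
    rw [Set.mem_Ioo, ← abs_lt, ha, Real.lt_sqrt (abs_nonneg x), sq_abs,
      ← lt_inv_mul_iff₀ hs0, mul_one, ← Real.lt_log_iff_exp_lt (inv_pos.2 hs0), div_lt_iff₀ two_pos,
      mul_comm]
  have hpdf : ∀ x, gaussianPDFReal 0 1 x = (√(2 * Real.pi))⁻¹ * Real.exp (-(x ^ 2 / 2)) := by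
    intro x; simp [gaussianPDFReal, neg_div]
  rw [integral_gaussianReal_eq_integral_smul one_ne_zero]
  have h1 : ∀ x : ℝ, gaussianPDFReal 0 1 x •
      (if s * Real.exp (x ^ 2 / 2) < 1 then s * Real.exp (x ^ 2 / 2) else 0)
      = (Set.Ioo (-a) a).indicator (fun _ => (√(2 * Real.pi))⁻¹ * s) x := by
    intro x
    by_cases h : x ∈ Set.Ioo (-a) a
    · rw [if_pos ((hiff x).2 h), Set.indicator_of_mem h, hpdf, smul_eq_mul, Real.exp_neg]
      have := (Real.exp_pos (x ^ 2 / 2)).ne'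
      field_simp
    · rw [if_neg (fun h' => h ((hiff x).1 h')), Set.indicator_of_notMem h, smul_zero]
  simp_rw [h1]
  rw [integral_indicator_const _ measurableSet_Ioo, measureReal_def, Real.volume_Ioo,
    ENNReal.toReal_ofReal (by rw [ha]; linarith [Real.sqrt_nonneg (2 * Real.log s⁻¹)]), ha,
    Real.sqrt_mul (by norm_num), Real.sqrt_mul (by norm_num), Real.sqrt_div hL.le, smul_eq_mul]
  have : √Real.pi ≠ 0 := by positivity
  have : √(2 : ℝ) ≠ 0 := by positivity
  field_simp
  ring

lemma measurable_truncated_scaled_exp (s : ℝ) : Measurable (fun x : ℝ =>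
    if s * Real.exp (x ^ 2 / 2) < 1 then s * Real.exp (x ^ 2 / 2) else 0) :=
  Measurable.ite (measurableSet_lt (by fun_prop) measurable_const) (by fun_prop) measurable_const

lemma integrable_truncated_scaled_exp {s : ℝ} (hs : 0 < s) : Integrable (fun x : ℝ =>
    if s * Real.exp (x ^ 2 / 2) < 1 then s * Real.exp (x ^ 2 / 2) else 0) (gaussianReal 0 1) := by
  refine Integrable.of_bound (measurable_truncated_scaled_exp s).aestronglyMeasurable 1
    (Eventually.of_forall fun x => ?_)
  split_ifs with h
  · rw [Real.norm_of_nonneg (by positivity)]; exact h.le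
  · simp

/-- `E [exp (iθ s exp (ξ² / 2))] - 1` for a standard Gaussian `ξ`. -/
noncomputable def scaledCharSubOne (θ s : ℝ) : ℂ :=
  ∫ x, (Complex.exp (Complex.I * ((θ * (s * Real.exp (x ^ 2 / 2)) : ℝ) : ℂ)) - 1)
    ∂(gaussianReal 0 1)

/-- The normalized compensated part of `scaledCharSubOne`; it tends to `levyExponent θ` as
`s → 0+`. -/
noncomputable def tailCoef (θ s : ℝ) : ℂ :=
  (√(Real.pi * Real.log s⁻¹) / s) •
    ∫ x, levyKernel θ (s * Real.exp (x ^ 2 / 2)) ∂(gaussianReal 0 1)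

lemma scaledCharSubOne_eq (θ : ℝ) {s : ℝ} (hs : s ∈ Set.Ioo (0 : ℝ) 1) :
    scaledCharSubOne θ s = Complex.I * ((θ * (s * (2 * √(Real.log s⁻¹ / Real.pi))) : ℝ) : ℂ)
      + (s / √(Real.pi * Real.log s⁻¹)) • tailCoef θ s := by
  have hs0 := hs.1
  have hL : 0 < Real.log s⁻¹ := Real.log_pos ((one_lt_inv₀ hs.1).2 hs.2)
  have h1 : (s / √(Real.pi * Real.log s⁻¹)) • tailCoef θ s
      = ∫ x, levyKernel θ (s * Real.exp (x ^ 2 / 2)) ∂(gaussianReal 0 1) := by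
    have : s / √(Real.pi * Real.log s⁻¹) * (√(Real.pi * Real.log s⁻¹) / s) = 1 := by
      have : √(Real.pi * Real.log s⁻¹) ≠ 0 := by positivity
      rw [div_mul_div_comm, mul_comm, div_self (by positivity)]
    rw [tailCoef, smul_smul, this, one_smul]
  rw [h1, ← integral_truncated_scaled_exp hs, ← integral_const_mul, ← integral_complex_ofReal,
    ← integral_const_mul, ← integral_add]
  · unfold scaledCharSubOne
    refine integral_congr_ae (Eventually.of_forall fun x => ?_)
    simp only [levyKernel]
    split_ifs <;> simp
  · exact (((integrable_truncated_scaled_exp hs0).const_mul θ).ofReal).const_mul Complex.I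
  · exact integrable_comp_scaled_exp_of_bounded hs0 (measurable_levyKernel θ)
      (norm_levyKernel_le_const θ)

lemma scaledCharSubOne_zero (θ : ℝ) : scaledCharSubOne θ 0 = 0 := by
  simp [scaledCharSubOne]

lemma tendsto_tailCoef (θ : ℝ) :
    Tendsto (tailCoef θ) (𝓝[>] 0) (𝓝 (levyExponent θ)) :=
  tendsto_integral_levyKernel θ

/-- A crude bound, sufficient for the quadratic error of the product formula. -/
lemma exists_norm_scaledCharSubOne_sq_le (θ : ℝ) :
    ∃ C : ℝ, 0 ≤ C ∧ ∃ δ : ℝ, 0 < δ ∧ ∀ s, 0 ≤ s → s < δ →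
      ‖scaledCharSubOne θ s‖ ^ 2 ≤ C * (s * √s) := by
  have h1 := ((tendsto_tailCoef θ).norm).eventually
    (gt_mem_nhds (lt_add_one ‖levyExponent θ‖))
  rw [eventually_nhdsWithin_iff] at h1
  obtain ⟨δ, hδ, hball⟩ := Metric.eventually_nhds_iff.1 h1
  set M := ‖levyExponent θ‖ + 1 with hM
  have hM0 : 0 ≤ M := by positivity
  refine ⟨2 * (8 * θ ^ 2 + M ^ 2), by positivity, min δ (Real.exp (-1)), by positivity, ?_⟩
  intro s hs0 hs
  rcases hs0.eq_or_lt with rfl | hs0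
  · simp [scaledCharSubOne_zero]
  have hsd : s < δ := hs.trans_le (min_le_left _ _)
  have hse : s < Real.exp (-1) := hs.trans_le (min_le_right _ _)
  have hs1 : s < 1 := hse.trans (by rw [Real.exp_lt_one_iff]; norm_num)
  have hL : 1 ≤ Real.log s⁻¹ := by
    rw [Real.log_inv]
    have := (Real.log_lt_iff_lt_exp hs0).2 hse
    linarith
  have ht : ‖tailCoef θ s‖ ≤ M := (hball (by simpa [abs_of_pos hs0] using hsd) hs0).le
  have hpi : (1 : ℝ) ≤ Real.pi := by linarith [Real.pi_gt_three]
  have e1 : ‖scaledCharSubOne θ s‖ ≤ |θ| * (s * (2 * √(Real.log s⁻¹))) + s * M := by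
    rw [scaledCharSubOne_eq θ ⟨hs0, hs1⟩]
    refine (norm_add_le _ _).trans (add_le_add ?_ ?_)
    · rw [norm_mul, Complex.norm_I, one_mul, Complex.norm_real, Real.norm_eq_abs, abs_mul,
        abs_of_nonneg (a := s * _) (by positivity)]
      gcongr
      exact div_le_self (by linarith) hpi
    · rw [norm_smul, Real.norm_of_nonneg (by positivity)]
      gcongr
      refine div_le_self hs0.le (Real.one_le_sqrt.2 ?_)
      nlinarith
  have e2 : Real.log s⁻¹ ≤ 2 * (√s)⁻¹ := by
    have h := Real.log_le_sub_one_of_pos (x := (√s)⁻¹) (by positivity)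
    rw [Real.log_inv, Real.log_sqrt hs0.le] at h
    rw [Real.log_inv]
    linarith
  have hss : √s * √s = s := Real.mul_self_sqrt hs0.le
  have hsp : 0 < √s := Real.sqrt_pos.2 hs0
  have e3 : s ^ 2 * Real.log s⁻¹ ≤ 2 * (s * √s) := by
    have : s ^ 2 * (2 * (√s)⁻¹) = 2 * (s * √s) := by
      rw [← div_eq_mul_inv, ← mul_div_assoc, div_eq_iff hsp.ne']
      linear_combination (-2 * s) * hss
    calc _ ≤ s ^ 2 * (2 * (√s)⁻¹) := by gcongr
      _ = _ := this
  have e4 : s ^ 2 ≤ s * √s := by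
    rw [sq]; gcongr
    rw [← sub_nonneg]
    have h1 : √s ≤ 1 := Real.sqrt_le_one.2 hs1.le
    nlinarith
  calc ‖scaledCharSubOne θ s‖ ^ 2 ≤ (|θ| * (s * (2 * √(Real.log s⁻¹))) + s * M) ^ 2 := by gcongr
    _ ≤ 2 * ((|θ| * (s * (2 * √(Real.log s⁻¹)))) ^ 2 + (s * M) ^ 2) := by
        nlinarith [sq_nonneg (|θ| * (s * (2 * √(Real.log s⁻¹))) - s * M)]
    _ = 2 * (4 * θ ^ 2 * (s ^ 2 * Real.log s⁻¹) + s ^ 2 * M ^ 2) := by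
        rw [mul_pow, mul_pow, mul_pow, mul_pow, sq_abs, Real.sq_sqrt (by linarith)]; ring
    _ ≤ 2 * (4 * θ ^ 2 * (2 * (s * √s)) + (s * √s) * M ^ 2) := by gcongr
    _ = _ := by ring

lemma norm_one_add_scaledCharSubOne_le (θ s : ℝ) : ‖1 + scaledCharSubOne θ s‖ ≤ 1 := by
  have h : 1 + scaledCharSubOne θ s =
      ∫ x, Complex.exp (Complex.I * ((θ * (s * Real.exp (x ^ 2 / 2)) : ℝ) : ℂ))
        ∂(gaussianReal 0 1) := by
    unfold scaledCharSubOne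
    rw [integral_sub]
    · simp
    · refine Integrable.of_bound (by fun_prop) 1 (Eventually.of_forall fun x => ?_)
      rw [Complex.norm_exp_I_mul_ofReal]
    · exact integrable_const _
  rw [h]
  refine (norm_integral_le_of_norm_le_const (C := 1)
    (Eventually.of_forall fun x => ?_)).trans (by simp)
  rw [Complex.norm_exp_I_mul_ofReal]

/-- The tail probability `P (s exp (ξ² / 2) ≥ 1)`. -/
lemma integral_indicator_scaled_exp_le {s : ℝ} (hs : s ∈ Set.Ioo (0 : ℝ) 1) :
    ∫ x, (if 1 ≤ s * Real.exp (x ^ 2 / 2) then (1 : ℝ) else 0) ∂(gaussianReal 0 1)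
      ≤ s / √(Real.pi * Real.log s⁻¹) := by
  have hs0 := hs.1
  have hL : 0 < Real.log s⁻¹ := Real.log_pos ((one_lt_inv₀ hs.1).2 hs.2)
  set g : ℝ → ℂ := fun z => if 1 ≤ z then 1 else 0 with hg
  have hgm : Measurable g := Measurable.ite measurableSet_Ici measurable_const measurable_const
  have hgb : ∀ y, 0 < y → ‖g y‖ ≤ 1 := by intro y _; simp only [hg]; split_ifs <;> simp
  have h1 := integral_gaussian_comp_scaled hs0 g (integrable_comp_scaled_exp_of_bounded hs0 hgm hgb)
  have h2 : ((∫ x, (if 1 ≤ s * Real.exp (x ^ 2 / 2) then (1 : ℝ) else 0) ∂(gaussianReal 0 1) : ℝ)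
      : ℂ) = ∫ x, g (s * Real.exp (x ^ 2 / 2)) ∂(gaussianReal 0 1) := by
    rw [← integral_complex_ofReal]
    refine integral_congr_ae (Eventually.of_forall fun x => ?_)
    simp only [hg]; split_ifs <;> simp
  have hinv : 1 < s⁻¹ := (one_lt_inv₀ hs0).2 hs.2
  have hsub : Set.Ioc (0 : ℝ) 1 ⊆ Set.Ioo 0 s⁻¹ := fun y hy => ⟨hy.1, hy.2.trans_lt hinv⟩
  rw [setIntegral_eq_of_subset_of_forall_sdiff_eq_zero measurableSet_Ioo hsub] at h1
  · have h3 : ‖∫ y in Set.Ioc (0 : ℝ) 1, (s / √(Real.pi * Real.log (s * y)⁻¹)) • g y⁻¹‖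
        ≤ s / √(Real.pi * Real.log s⁻¹) * (volume.real (Set.Ioc (0 : ℝ) 1)) := by
      refine norm_setIntegral_le_of_norm_le_const (by simp) fun y hy => ?_
      have hy0 := hy.1
      rw [norm_smul, Real.norm_of_nonneg (by positivity), ← mul_one (s / √(Real.pi * Real.log s⁻¹))]
      refine mul_le_mul ?_ (hgb _ (inv_pos.2 hy0)) (norm_nonneg _) (by positivity)
      have hsy : s * y ≤ s := by nlinarith [hy.2]
      have hsy0 : 0 < s * y := by positivity
      gcongr
    rw [← h1, ← h2, Complex.norm_real] at h3
    simp only [Real.volume_real_Ioc, sub_zero, zero_le_one, sup_of_le_left, mul_one] at h3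
    exact (le_abs_self _).trans h3
  · intro y hy
    have h1 : ¬ (1 ≤ y⁻¹) := by
      intro h
      exact hy.2 ⟨hy.1.1, by rwa [one_le_inv₀ hy.1.1] at h⟩
    simp only [hg]; rw [if_neg h1, smul_zero]

lemma integral_min_one_scaled_exp_le {s : ℝ} (hs : s ∈ Set.Ioo (0 : ℝ) 1) :
    ∫ x, min 1 (s * Real.exp (x ^ 2 / 2)) ∂(gaussianReal 0 1)
      ≤ s * (2 * √(Real.log s⁻¹ / Real.pi)) + s / √(Real.pi * Real.log s⁻¹) := by
  rw [← integral_truncated_scaled_exp hs]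
  have hi : Integrable (fun x : ℝ => if 1 ≤ s * Real.exp (x ^ 2 / 2) then (1 : ℝ) else 0)
      (gaussianReal 0 1) := by
    refine Integrable.of_bound (Measurable.ite (measurableSet_le measurable_const (by fun_prop))
      measurable_const measurable_const).aestronglyMeasurable 1 (Eventually.of_forall fun x => ?_)
    split_ifs <;> simp
  refine le_trans ?_ (add_le_add le_rfl (integral_indicator_scaled_exp_le hs))
  rw [← integral_add (integrable_truncated_scaled_exp hs.1) hi]
  refine integral_mono_of_nonneg (Eventually.of_forall fun x => ?_)
    ((integrable_truncated_scaled_exp hs.1).add hi) (Eventually.of_forall fun x => ?_)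
  · have := hs.1; simp; positivity
  · simp only
    split_ifs with h1 h2
    · linarith
    · simp
    · simp
    · linarith

/-! ### Riemann sums over the half-line -/

section RiemannSums

variable {E : Type*} [NormedAddCommGroup E] [NormedSpace ℝ E]

lemma natCeil_mul_eq_of_mem_Ioc {n i : ℕ} (hn : 0 < n) {x : ℝ}
    (hx : x ∈ Set.Ioc ((i : ℝ) / n) (((i : ℝ) + 1) / n)) : ⌈(n : ℝ) * x⌉₊ = i + 1 := by
  have hn' : (0 : ℝ) < n := Nat.cast_pos.2 hn
  rw [Nat.ceil_eq_iff (Nat.succ_ne_zero i)]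
  have h1 := (div_lt_iff₀' hn').1 hx.1
  have h2 := (le_div_iff₀' hn').1 hx.2
  rw [Nat.succ_sub_one, Nat.succ_eq_add_one]
  push_cast
  exact ⟨h1, h2⟩

lemma iUnion_Ioc_div_eq_Ioi {n : ℕ} (hn : 0 < n) :
    ⋃ i : ℕ, Set.Ioc ((i : ℝ) / n) (((i : ℝ) + 1) / n) = Set.Ioi 0 := by
  have hn' : (0 : ℝ) < n := Nat.cast_pos.2 hn
  ext x
  simp only [Set.mem_iUnion, Set.mem_Ioc, Set.mem_Ioi]
  constructor
  · rintro ⟨i, hi, _⟩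
    exact lt_of_le_of_lt (by positivity) hi
  · intro hx
    have hpos : 0 < ⌈(n : ℝ) * x⌉₊ := Nat.ceil_pos.2 (by positivity)
    obtain ⟨i, hi⟩ := Nat.exists_eq_succ_of_ne_zero hpos.ne'
    have := (Nat.ceil_eq_iff (Nat.succ_ne_zero i)).1 hi
    simp only [Nat.succ_sub_one, Nat.succ_eq_add_one, Nat.cast_add, Nat.cast_one] at this
    exact ⟨i, (div_lt_iff₀' hn').2 this.1, (le_div_iff₀' hn').2 this.2⟩

lemma pairwise_disjoint_Ioc_div {n : ℕ} (hn : 0 < n) :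
    Pairwise (Function.onFun Disjoint
      fun i : ℕ => Set.Ioc ((i : ℝ) / n) (((i : ℝ) + 1) / n)) := by
  intro i j hij
  refine Set.disjoint_left.2 fun x hx hy => hij ?_
  have := (natCeil_mul_eq_of_mem_Ioc hn hx).symm.trans (natCeil_mul_eq_of_mem_Ioc hn hy)
  omega

lemma volume_real_Ioc_div {n : ℕ} (hn : 0 < n) (i : ℕ) :
    volume.real (Set.Ioc ((i : ℝ) / n) (((i : ℝ) + 1) / n)) = (n : ℝ)⁻¹ := by
  have hn' : (0 : ℝ) < n := Nat.cast_pos.2 hn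
  rw [Real.volume_real_Ioc_of_le (by gcongr; linarith)]
  field_simp; ring

lemma setIntegral_step [CompleteSpace E] {n : ℕ} (hn : 0 < n) (g : ℕ → E) (i : ℕ) :
    ∫ x in Set.Ioc ((i : ℝ) / n) (((i : ℝ) + 1) / n), g ⌈(n : ℝ) * x⌉₊
      = (n : ℝ)⁻¹ • g (i + 1) := by
  rw [setIntegral_congr_fun measurableSet_Ioc (g := fun _ => g (i + 1))
    (fun x hx => by simp only [natCeil_mul_eq_of_mem_Ioc hn hx]), setIntegral_const,
    volume_real_Ioc_div hn]

lemma stronglyMeasurable_step {α : Type*} [TopologicalSpace α] (n : ℕ) (g : ℕ → α) :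
    StronglyMeasurable (fun x : ℝ => g ⌈(n : ℝ) * x⌉₊) :=
  (StronglyMeasurable.of_discrete (f := g)).comp_measurable
    (Nat.measurable_ceil.comp (measurable_const.mul measurable_id))

lemma integrableOn_step_of_summable {g : ℕ → ℝ} (hg : Summable g) (hg0 : ∀ i, 0 ≤ g i) :
    IntegrableOn (fun x : ℝ => g ⌈x⌉₊) (Set.Ioi 0) := by
  have h1 : (fun x : ℝ => g ⌈x⌉₊) = fun x : ℝ => g ⌈((1 : ℕ) : ℝ) * x⌉₊ := by ext x; simp
  rw [h1]
  rw [← iUnion_Ioc_div_eq_Ioi one_pos]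
  refine integrableOn_iUnion_of_summable_integral_norm (fun i => ?_) ?_
  · refine IntegrableOn.congr_fun (f := fun _ => g (i + 1)) ?_
      (fun x hx => by simp only [natCeil_mul_eq_of_mem_Ioc one_pos hx]) measurableSet_Ioc
    exact integrableOn_const (by simp)
  · have h2 : ∀ i : ℕ, ∫ x in Set.Ioc ((i : ℝ) / (1 : ℕ)) (((i : ℝ) + 1) / (1 : ℕ)),
        ‖g ⌈((1 : ℕ) : ℝ) * x⌉₊‖ = g (i + 1) := by
      intro i
      rw [setIntegral_step one_pos (fun j => ‖g j‖) i, Real.norm_of_nonneg (hg0 _)]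
      simp
    simp_rw [h2]
    exact (summable_nat_add_iff 1).2 hg

variable {π : ℝ → ℝ}

/-- The common domination of all the Riemann sums: `π + |π log π|` at the grid point to the right
of `x` is bounded by a summable step function which does not depend on the mesh. -/
lemma IsPriorDensity.exists_step_bound (hπ : IsPriorDensity π) :
    ∃ g : ℕ → ℝ, Summable g ∧ (∀ i, 0 ≤ g i) ∧ ∀ x y : ℝ, 0 < x → x ≤ y → y ≤ x + 1 →
      π y + |Real.negMulLog (π y)| ≤ g ⌈x⌉₊ := by
  obtain ⟨c, hc, hcb⟩ := hπ.riemann.2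
  obtain ⟨d, hd, hdb⟩ := hπ.riemann_entropy.2
  have hmem : ∀ k : ℕ, ((k : ℝ) + 1) ∈ Set.Ioc (k : ℝ) ((k : ℝ) + 1) := fun k => ⟨by simp, le_rfl⟩
  have hc0 : ∀ k, 0 ≤ c k := fun k => (abs_nonneg _).trans (hcb k _ (hmem k))
  have hd0 : ∀ k, 0 ≤ d k := fun k => (abs_nonneg _).trans (hdb k _ (hmem k))
  refine ⟨fun j => (c (j - 1) + d (j - 1)) + (c j + d j), ?_, fun i => ?_, ?_⟩
  · refine Summable.add ?_ (hc.add hd)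
    refine (summable_nat_add_iff 1).1 ?_
    simpa using hc.add hd
  · have := hc0 i; have := hd0 i; have := hc0 (i - 1); have := hd0 (i - 1); positivity
  · intro x y hx hxy hyx
    have hy : 0 < y := hx.trans_le hxy
    obtain ⟨k, hk⟩ := Nat.exists_eq_succ_of_ne_zero (Nat.ceil_pos.2 hy).ne'
    have hky : y ∈ Set.Ioc (k : ℝ) ((k : ℝ) + 1) := by
      have := (Nat.ceil_eq_iff (Nat.succ_ne_zero k)).1 hk
      simpa using this
    have h1 : π y ≤ c k := (le_abs_self _).trans (hcb k y hky)
    have h2 : |Real.negMulLog (π y)| ≤ d k := by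
      have := hdb k y hky
      simp only [one_div, Real.log_inv] at this
      rwa [Real.negMulLog, neg_mul, ← mul_neg]
    have h3 : ⌈x⌉₊ ≤ k + 1 := by rw [← Nat.succ_eq_add_one, ← hk]; exact Nat.ceil_mono hxy
    have h4 : k ≤ ⌈x⌉₊ := by
      have : k + 1 ≤ ⌈x⌉₊ + 1 := by
        rw [← Nat.succ_eq_add_one, ← hk, ← Nat.ceil_add_one hx.le]
        exact Nat.ceil_mono hyx
      omega
    have h5 : k = ⌈x⌉₊ - 1 ∨ k = ⌈x⌉₊ := by omega
    show _ ≤ c (⌈x⌉₊ - 1) + d (⌈x⌉₊ - 1) + (c ⌈x⌉₊ + d ⌈x⌉₊)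
    rcases h5 with h | h
    · rw [← h]; have := hc0 ⌈x⌉₊; have := hd0 ⌈x⌉₊; linarith
    · rw [← h]; have := hc0 (k - 1); have := hd0 (k - 1); linarith

lemma le_natCeil_mul_div {n : ℕ} (hn : 0 < n) (x : ℝ) : x ≤ (⌈(n : ℝ) * x⌉₊ : ℝ) / n :=
  (le_div_iff₀' (Nat.cast_pos.2 hn)).2 (Nat.le_ceil _)

lemma natCeil_mul_div_le {n : ℕ} (hn : 0 < n) {x : ℝ} (hx : 0 < x) :
    (⌈(n : ℝ) * x⌉₊ : ℝ) / n ≤ x + (n : ℝ)⁻¹ := by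
  have hn' : (0 : ℝ) < n := Nat.cast_pos.2 hn
  rw [div_le_iff₀ hn']
  have := (Nat.ceil_lt_add_one (a := (n : ℝ) * x) (by positivity)).le
  have h2 : (n : ℝ)⁻¹ * n = 1 := inv_mul_cancel₀ hn'.ne'
  nlinarith

/-- Riemann sums with a varying integrand. If `F n t` converges to `F₀ t` locally uniformly in
`t` and is dominated by `t + |t log t|`, the Riemann sums of `F n ∘ π` over the half-line
converge to the integral of `F₀ ∘ π`. -/
theorem IsPriorDensity.tendsto_riemannSum [CompleteSpace E] (hπ : IsPriorDensity π) {B C : ℝ}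
    (hB : ∀ x, 0 < x → π x ≤ B) {F : ℕ → ℝ → E} {F₀ : ℝ → E}
    (hFb : ∀ᶠ n in atTop, ∀ t ∈ Set.Icc 0 B, ‖F n t‖ ≤ C * (t + |Real.negMulLog t|))
    (hF : ∀ (u : ℕ → ℝ) (t : ℝ), (∀ᶠ n in atTop, u n ∈ Set.Icc 0 B) → Tendsto u atTop (𝓝 t) →
      Tendsto (fun n => F n (u n)) atTop (𝓝 (F₀ t))) :
    (∀ᶠ n : ℕ in atTop, Summable fun i : ℕ => F n (π (((i : ℝ) + 1) / n))) ∧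
    Tendsto (fun n : ℕ => (n : ℝ)⁻¹ • ∑' i : ℕ, F n (π (((i : ℝ) + 1) / n))) atTop
      (𝓝 (∫ x in Set.Ioi (0 : ℝ), F₀ (π x))) := by
  obtain ⟨g, hg, hg0, hgb⟩ := hπ.exists_step_bound
  set G : ℕ → ℝ → E := fun n x => F n (π ((⌈(n : ℝ) * x⌉₊ : ℝ) / n)) with hG
  have hbd : ∀ᶠ n : ℕ in atTop, 0 < n ∧ ∀ x : ℝ, 0 < x → ‖G n x‖ ≤ |C| * g ⌈x⌉₊ := by
    filter_upwards [hFb, eventually_gt_atTop 0] with n hn hn0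
    refine ⟨hn0, fun x hx => ?_⟩
    have h1 := le_natCeil_mul_div hn0 x
    have h2 := natCeil_mul_div_le hn0 hx
    have hy : 0 < (⌈(n : ℝ) * x⌉₊ : ℝ) / n := hx.trans_le h1
    have h3 : (n : ℝ)⁻¹ ≤ 1 := inv_le_one_of_one_le₀ (by exact_mod_cast hn0)
    have h0 := hπ.nonneg _ hy
    refine (hn _ ⟨h0, hB _ hy⟩).trans ?_
    calc _ ≤ |C| * (π ((⌈(n : ℝ) * x⌉₊ : ℝ) / n)
            + |Real.negMulLog (π ((⌈(n : ℝ) * x⌉₊ : ℝ) / n))|) := by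
          gcongr; exact le_abs_self C
      _ ≤ _ := by gcongr; exact hgb _ _ hx h1 (by linarith)
  have hint : IntegrableOn (fun x : ℝ => |C| * g ⌈x⌉₊) (Set.Ioi 0) :=
    (integrableOn_step_of_summable hg hg0).const_mul _
  have hmeas : ∀ n, AEStronglyMeasurable (G n) (volume.restrict (Set.Ioi 0)) := fun n =>
    (stronglyMeasurable_step n (fun j => F n (π ((j : ℝ) / n)))).aestronglyMeasurable
  have hsum : ∀ᶠ n : ℕ in atTop, HasSum (fun i : ℕ => (n : ℝ)⁻¹ • F n (π (((i : ℝ) + 1) / n)))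
      (∫ x in Set.Ioi (0 : ℝ), G n x) := by
    filter_upwards [hbd] with n ⟨hn0, hn⟩
    have hGi : IntegrableOn (G n) (Set.Ioi 0) := by
      refine Integrable.mono' hint (hmeas n) ?_
      filter_upwards [ae_restrict_mem measurableSet_Ioi] with x hx using hn x hx
    rw [← iUnion_Ioc_div_eq_Ioi hn0] at hGi ⊢
    have h1 := hasSum_integral_iUnion (fun i => measurableSet_Ioc)
      (pairwise_disjoint_Ioc_div hn0) hGi
    convert h1 using 2 with i
    rw [hG, setIntegral_step hn0 (fun j => F n (π ((j : ℝ) / n))) i]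
    push_cast; rfl
  refine ⟨?_, ?_⟩
  · filter_upwards [hsum, eventually_gt_atTop 0] with n hn hn0
    have hn' : (n : ℝ) ≠ 0 := by positivity
    have := hn.summable.const_smul (n : ℝ)
    simpa [smul_smul, hn'] using this
  · have hlim : Tendsto (fun n => ∫ x in Set.Ioi (0 : ℝ), G n x) atTop
        (𝓝 (∫ x in Set.Ioi (0 : ℝ), F₀ (π x))) := by
      refine tendsto_integral_filter_of_dominated_convergence _ (Eventually.of_forall hmeas) ?_
        hint ?_
      · filter_upwards [hbd] with n ⟨_, hn⟩
        filter_upwards [ae_restrict_mem measurableSet_Ioi] with x hx using hn x hx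
      · filter_upwards [ae_restrict_mem measurableSet_Ioi, hπ.riemann.1] with x hx hcont
        have hx0 : (0 : ℝ) < x := hx
        refine hF _ _ ?_ ?_
        · filter_upwards [eventually_gt_atTop 0] with n hn0
          have hy := hx0.trans_le (le_natCeil_mul_div hn0 x)
          exact ⟨hπ.nonneg _ hy, hB _ hy⟩
        · refine hcont.tendsto.comp ?_
          refine tendsto_of_tendsto_of_tendsto_of_le_of_le' tendsto_const_nhds
            (h := fun n : ℕ => x + (n : ℝ)⁻¹) ?_ ?_ ?_
          · simpa using tendsto_const_nhds.add (tendsto_inv_atTop_nhds_zero_nat (𝕜 := ℝ))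
          · filter_upwards [eventually_gt_atTop 0] with n hn0 using le_natCeil_mul_div hn0 x
          · filter_upwards [eventually_gt_atTop 0] with n hn0 using natCeil_mul_div_le hn0 hx0
    refine hlim.congr' ?_
    filter_upwards [hsum, eventually_gt_atTop 0] with n hn hn0
    have hn' : (n : ℝ) ≠ 0 := by positivity
    rw [← hn.tsum_eq, tsum_const_smul'']

end RiemannSums

/-! ### The sequence `b_n` and the weights -/

section Normalization

lemma tendsto_log_natCast : Tendsto (fun n : ℕ => Real.log n) atTop atTop :=
  Real.tendsto_log_atTop.comp tendsto_natCast_atTop_atTop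

/-- `log (π log n) / log n → 0`. -/
lemma tendsto_log_log_div_log :
    Tendsto (fun n : ℕ => Real.log (Real.pi * Real.log n) / Real.log n) atTop (𝓝 0) := by
  have h1 : Tendsto (fun x : ℝ => Real.log (Real.pi * x) / x) atTop (𝓝 0) := by
    have h2 : Tendsto (fun x : ℝ => Real.log Real.pi / x + Real.log x / x) atTop (𝓝 (0 + 0)) :=
      (tendsto_const_nhds.div_atTop tendsto_id).add
        (Real.isLittleO_log_id_atTop.tendsto_div_nhds_zero)
    rw [add_zero] at h2
    refine h2.congr' ?_
    filter_upwards [eventually_gt_atTop 0] with x hx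
    rw [Real.log_mul Real.pi_pos.ne' hx.ne', add_div]
  exact h1.comp tendsto_log_natCast

lemma eventually_two_mul_log_div_sqrt : ∀ᶠ n : ℕ in atTop,
    2 * Real.log ((n : ℝ) / √(Real.pi * Real.log n))
      = 2 * Real.log n - Real.log (Real.pi * Real.log n) := by
  filter_upwards [tendsto_log_natCast.eventually_gt_atTop 0, eventually_gt_atTop 0] with n hn hn0
  have hn' : (0 : ℝ) < n := Nat.cast_pos.2 hn0
  have hp : 0 < Real.pi * Real.log n := mul_pos Real.pi_pos hn
  rw [Real.log_div hn'.ne' (Real.sqrt_pos.2 hp).ne', Real.log_sqrt hp.le]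
  ring

lemma tendsto_two_mul_log_div_log : Tendsto (fun n : ℕ =>
    (2 * Real.log n - Real.log (Real.pi * Real.log n)) / Real.log n) atTop (𝓝 2) := by
  have h : Tendsto (fun n : ℕ => 2 - Real.log (Real.pi * Real.log n) / Real.log n) atTop
      (𝓝 (2 - 0)) := tendsto_const_nhds.sub tendsto_log_log_div_log
  rw [sub_zero] at h
  refine h.congr' ?_
  filter_upwards [tendsto_log_natCast.eventually_gt_atTop 0] with n hn
  rw [sub_div, mul_div_assoc, div_self hn.ne', mul_one]

lemma eventually_bSeq_sq : ∀ᶠ n : ℕ in atTop,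
    bSeq n ^ 2 = 2 * Real.log n - Real.log (Real.pi * Real.log n) := by
  filter_upwards [eventually_two_mul_log_div_sqrt, tendsto_log_natCast.eventually_gt_atTop 0,
    tendsto_two_mul_log_div_log.eventually (lt_mem_nhds (by norm_num : (0 : ℝ) < 2))]
    with n h1 h2 h3
  rw [bSeq, Real.sq_sqrt, h1]
  rw [h1]
  exact ((div_pos_iff_of_pos_right h2).1 h3).le

lemma tendsto_bSeq_sq_div_log :
    Tendsto (fun n : ℕ => bSeq n ^ 2 / Real.log n) atTop (𝓝 2) := by
  refine tendsto_two_mul_log_div_log.congr' ?_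
  filter_upwards [eventually_bSeq_sq] with n hn
  rw [hn]

lemma tendsto_bSeq_sq_atTop : Tendsto (fun n => bSeq n ^ 2) atTop atTop := by
  have h := tendsto_bSeq_sq_div_log.pos_mul_atTop two_pos tendsto_log_natCast
  refine h.congr' ?_
  filter_upwards [tendsto_log_natCast.eventually_gt_atTop 0] with n hn
  rw [div_mul_cancel₀ _ hn.ne']

lemma tendsto_bSeq_atTop : Tendsto bSeq atTop atTop := by
  have h := Real.tendsto_sqrt_atTop.comp tendsto_bSeq_sq_atTop
  refine h.congr fun n => ?_
  exact Real.sqrt_sq (Real.sqrt_nonneg _)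

end Normalization

section Array

variable {π : ℝ → ℝ}

/-- The Riemann sum `(1/n) ∑_{i ≥ 1} π(i/n)`. -/
noncomputable def gridMass (π : ℝ → ℝ) (n : ℕ) : ℝ :=
  (n : ℝ)⁻¹ * ∑' i : ℕ, π (((i : ℝ) + 1) / n)

lemma IsPriorDensity.summable_grid (hπ : IsPriorDensity π) :
    ∀ᶠ n : ℕ in atTop, Summable fun i : ℕ => π (((i : ℝ) + 1) / n) := by
  obtain ⟨B, hB⟩ := hπ.bounded
  refine (hπ.tendsto_riemannSum (C := 1) hB (F := fun _ t => t) (F₀ := fun t => t) ?_ ?_).1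
  · refine Eventually.of_forall fun n t ht => ?_
    rw [Real.norm_of_nonneg ht.1, one_mul]
    exact le_add_of_nonneg_right (abs_nonneg _)
  · exact fun u t _ hu => hu

lemma IsPriorDensity.tendsto_gridMass (hπ : IsPriorDensity π) :
    Tendsto (gridMass π) atTop (𝓝 1) := by
  obtain ⟨B, hB⟩ := hπ.bounded
  have h := (hπ.tendsto_riemannSum (C := 1) hB (F := fun _ t => t) (F₀ := fun t => t) ?_ ?_).2
  · rw [hπ.integral_eq_one] at h
    exact h
  · refine Eventually.of_forall fun n t ht => ?_
    rw [Real.norm_of_nonneg ht.1, one_mul]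
    exact le_add_of_nonneg_right (abs_nonneg _)
  · exact fun u t _ hu => hu

lemma IsPriorDensity.summable_negMulLog_grid (hπ : IsPriorDensity π) :
    ∀ᶠ n : ℕ in atTop, Summable fun i : ℕ => Real.negMulLog (π (((i : ℝ) + 1) / n)) := by
  obtain ⟨B, hB⟩ := hπ.bounded
  refine (hπ.tendsto_riemannSum (C := 1) hB (F := fun _ t => Real.negMulLog t)
    (F₀ := fun t => Real.negMulLog t) ?_ ?_).1
  · refine Eventually.of_forall fun n t ht => ?_
    rw [Real.norm_eq_abs, one_mul]
    exact le_add_of_nonneg_left ht.1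
  · exact fun u t _ hu => (Real.continuous_negMulLog.tendsto t).comp hu

lemma priorWeight_eq {n : ℕ} (hn : 0 < n) (i : ℕ) :
    priorWeight π n i = π (((i : ℝ) + 1) / n) / (n * gridMass π n) := by
  have hn' : (n : ℝ) ≠ 0 := by positivity
  rw [priorWeight, gridMass, mul_inv_cancel_left₀ hn']

lemma IsPriorDensity.hasSum_priorWeight (hπ : IsPriorDensity π) :
    ∀ᶠ n : ℕ in atTop, HasSum (priorWeight π n) 1 := by
  filter_upwards [hπ.summable_grid, hπ.tendsto_gridMass.eventually (lt_mem_nhds one_pos)]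
    with n h1 h2
  have h3 : ∑' i : ℕ, π (((i : ℝ) + 1) / n) ≠ 0 := by
    intro h; rw [gridMass, h, mul_zero] at h2; exact lt_irrefl _ h2
  have := h1.hasSum.div_const (∑' i : ℕ, π (((i : ℝ) + 1) / n))
  rwa [div_self h3] at this

/-- At `n = 0` the grid points are all the junk value `0`, where `π` is unconstrained; the weights
vanish there because a constant series is not summable. -/
lemma IsPriorDensity.priorWeight_nonneg (hπ : IsPriorDensity π) (n i : ℕ) :
    0 ≤ priorWeight π n i := by
  rcases Nat.eq_zero_or_pos n with rfl | hn
  · simp only [priorWeight, Nat.cast_zero, div_zero, tsum_const, Nat.card_eq_zero_of_infinite,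
      zero_smul]
    exact le_rfl
  · have h : ∀ j : ℕ, 0 ≤ π (((j : ℝ) + 1) / n) := fun j =>
      hπ.nonneg _ (div_pos (by positivity) (Nat.cast_pos.2 hn))
    exact div_nonneg (h i) (tsum_nonneg h)

/-- The factor `b_n √(π/2)` by which the statistic is scaled. -/
noncomputable def scaleSeq (n : ℕ) : ℝ := bSeq n * √(Real.pi / 2)

/-- The scale `β_n` with `scaleSeq n * priorWeight π n i = β_n π((i+1)/n)`. -/
noncomputable def gridScale (π : ℝ → ℝ) (n : ℕ) : ℝ := scaleSeq n / (n * gridMass π n)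

lemma scaleSeq_mul_priorWeight {n : ℕ} (hn : 0 < n) (i : ℕ) :
    scaleSeq n * priorWeight π n i = gridScale π n * π (((i : ℝ) + 1) / n) := by
  rw [priorWeight_eq hn, gridScale]; ring

lemma IsPriorDensity.gridScale_pos (hπ : IsPriorDensity π) :
    ∀ᶠ n in atTop, 0 < gridScale π n := by
  filter_upwards [tendsto_bSeq_atTop.eventually_gt_atTop 0, eventually_gt_atTop 0,
    hπ.tendsto_gridMass.eventually (lt_mem_nhds one_pos)] with n h1 h2 h3
  have : (0 : ℝ) < n := Nat.cast_pos.2 h2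
  unfold gridScale scaleSeq
  positivity

/-- `2 log (1/β_n) = b_n² + o(1)`; this is what the correction `√(π log n)` in the definition of
`b_n` achieves. -/
lemma IsPriorDensity.tendsto_two_mul_log_gridScale (hπ : IsPriorDensity π) :
    Tendsto (fun n => 2 * Real.log (gridScale π n)⁻¹ - bSeq n ^ 2) atTop (𝓝 0) := by
  have h1 : Tendsto (fun n => 2 * Real.log (gridMass π n) - Real.log (bSeq n ^ 2 / Real.log n / 2))
      atTop (𝓝 (2 * Real.log 1 - Real.log (2 / 2))) :=
    ((hπ.tendsto_gridMass.log one_ne_zero).const_mul 2).sub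
      ((tendsto_bSeq_sq_div_log.div_const 2).log (by norm_num))
  rw [div_self two_ne_zero, Real.log_one, mul_zero, sub_zero] at h1
  refine h1.congr' ?_
  filter_upwards [tendsto_bSeq_atTop.eventually_gt_atTop 0, eventually_gt_atTop 0,
    hπ.tendsto_gridMass.eventually (lt_mem_nhds one_pos), eventually_bSeq_sq,
    tendsto_log_natCast.eventually_gt_atTop 0] with n hb hn hZ hsq hl
  have hn' : (0 : ℝ) < n := Nat.cast_pos.2 hn
  have hpi := Real.pi_pos
  have e1 : 2 * Real.log (gridScale π n)⁻¹ = 2 * Real.log n + 2 * Real.log (gridMass π n)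
      - Real.log (bSeq n ^ 2) - (Real.log Real.pi - Real.log 2) := by
    rw [gridScale, scaleSeq, inv_div, Real.log_div (by positivity) (by positivity),
      Real.log_mul hn'.ne' hZ.ne', Real.log_mul hb.ne' (by positivity),
      Real.log_sqrt (by positivity), Real.log_div hpi.ne' two_ne_zero, Real.log_pow]
    push_cast; ring
  rw [e1]
  nth_rewrite 3 [hsq]
  rw [Real.log_div (by positivity) two_ne_zero, Real.log_div (by positivity) hl.ne',
    Real.log_mul hpi.ne' hl.ne']
  ring

lemma IsPriorDensity.tendsto_gridScale (hπ : IsPriorDensity π) :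
    Tendsto (gridScale π) atTop (𝓝[>] 0) := by
  have h1 : Tendsto (fun n => Real.log (gridScale π n)⁻¹) atTop atTop := by
    have h2 := (hπ.tendsto_two_mul_log_gridScale.add_atTop tendsto_bSeq_sq_atTop).const_mul_atTop
      (show (0 : ℝ) < 1 / 2 by norm_num)
    refine h2.congr fun n => by ring
  have h3 := tendsto_inv_atTop_nhdsGT_zero.comp (Real.tendsto_exp_atTop.comp h1)
  refine h3.congr' ?_
  filter_upwards [hπ.gridScale_pos] with n hn
  simp only [Function.comp]
  rw [Real.exp_log (inv_pos.2 hn), inv_inv]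

end Array

/-! ### The characteristic exponent of the statistic -/

section Exponent

variable {π : ℝ → ℝ}

/-- The centred and rescaled contribution to the characteristic exponent of a channel at which
the profile takes the value `t`. -/
noncomputable def centredExponent (π : ℝ → ℝ) (θ : ℝ) (n : ℕ) (t : ℝ) : ℂ :=
  (n : ℝ) • scaledCharSubOne θ (gridScale π n * t)
    - Complex.I * ((θ * (bSeq n ^ 2 * (t / gridMass π n)) : ℝ) : ℂ)

/-- The quantity `x` with `2 log (1/(β_n t)) = b_n² + x`. -/
noncomputable def logExcess (π : ℝ → ℝ) (n : ℕ) (t : ℝ) : ℝ :=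
  (2 * Real.log (gridScale π n)⁻¹ - bSeq n ^ 2) - 2 * Real.log t

lemma centredExponent_eq (θ : ℝ) {n : ℕ} {t : ℝ} (hn : 0 < n) (hb : 0 < bSeq n)
    (hZ : 0 < gridMass π n) (ht : 0 < t) (h1 : gridScale π n * t < 1) :
    centredExponent π θ n t =
      Complex.I * ((θ * (t / gridMass π n *
        (bSeq n * √(bSeq n ^ 2 + logExcess π n t) - bSeq n ^ 2)) : ℝ) : ℂ)
      + (t / gridMass π n * (bSeq n / √(bSeq n ^ 2 + logExcess π n t))) •
        tailCoef θ (gridScale π n * t) := by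
  have hn' : (0 : ℝ) < n := Nat.cast_pos.2 hn
  have hpi := Real.pi_pos
  have hβ : 0 < gridScale π n := by unfold gridScale scaleSeq; positivity
  have hs : gridScale π n * t ∈ Set.Ioo (0 : ℝ) 1 := ⟨by positivity, h1⟩
  have hL : 0 < Real.log (gridScale π n * t)⁻¹ :=
    Real.log_pos ((one_lt_inv₀ hs.1).2 hs.2)
  set L := Real.log (gridScale π n * t)⁻¹ with hLdef
  have hx : bSeq n ^ 2 + logExcess π n t = 2 * L := by
    rw [logExcess, hLdef, Real.log_inv, Real.log_inv, Real.log_mul hβ.ne' ht.ne']; ring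
  have hβn : n * gridScale π n = bSeq n * √(Real.pi / 2) / gridMass π n := by
    unfold gridScale scaleSeq; field_simp
  have hsp : √Real.pi ≠ 0 := by positivity
  have hs2 : √(2 : ℝ) ≠ 0 := by positivity
  have hsL : √L ≠ 0 := by positivity
  have h22 : √(2 : ℝ) * √2 = 2 := Real.mul_self_sqrt (by norm_num)
  rw [centredExponent, scaledCharSubOne_eq θ hs, ← hLdef, smul_add, smul_smul, hx]
  have e1 : (n : ℝ) * (gridScale π n * t * (2 * √(L / Real.pi)))
      = t / gridMass π n * (bSeq n * √(2 * L)) := by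
    have e : (n : ℝ) * (gridScale π n * t * (2 * √(L / Real.pi)))
        = n * gridScale π n * t * (2 * √(L / Real.pi)) := by ring
    rw [e, hβn, Real.sqrt_div hpi.le, Real.sqrt_div hL.le, Real.sqrt_mul (by norm_num)]
    field_simp
    linear_combination -h22
  have e2 : (n : ℝ) * (gridScale π n * t / √(Real.pi * L))
      = t / gridMass π n * (bSeq n / √(2 * L)) := by
    rw [← mul_div_assoc, ← mul_assoc, hβn, Real.sqrt_div hpi.le, Real.sqrt_mul hpi.le,
      Real.sqrt_mul (by norm_num)]
    field_simp
  rw [e2]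
  have e3 : (n : ℝ) • (Complex.I * ((θ * (gridScale π n * t * (2 * √(L / Real.pi))) : ℝ) : ℂ))
      = Complex.I * ((θ * (t / gridMass π n * (bSeq n * √(2 * L))) : ℝ) : ℂ) := by
    rw [← e1, Complex.real_smul]; push_cast; ring
  rw [e3]
  push_cast
  ring

lemma centredExponent_zero (θ : ℝ) (n : ℕ) : centredExponent π θ n 0 = 0 := by
  simp [centredExponent, scaledCharSubOne_zero]

lemma abs_mul_sqrt_sub_sq_le {b x : ℝ} (hb : 0 < b) (hx : 0 ≤ b ^ 2 + x) :
    |b * √(b ^ 2 + x) - b ^ 2| ≤ |x| := by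
  have h0 := Real.sqrt_nonneg (b ^ 2 + x)
  have h1 : (√(b ^ 2 + x) - b) * (√(b ^ 2 + x) + b) = x := by
    have := Real.mul_self_sqrt hx; nlinarith
  have h2 : |√(b ^ 2 + x) - b| * (√(b ^ 2 + x) + b) = |x| := by
    rw [← abs_of_nonneg (a := √(b ^ 2 + x) + b) (by positivity), ← abs_mul, h1]
  have h3 : b * √(b ^ 2 + x) - b ^ 2 = b * (√(b ^ 2 + x) - b) := by ring
  rw [h3, abs_mul, abs_of_pos hb, ← h2]
  nlinarith [abs_nonneg (√(b ^ 2 + x) - b)]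

lemma tendsto_div_sqrt_sq_add {ι : Type*} {l : Filter ι} {b x : ι → ℝ} {x₀ : ℝ}
    (hb : Tendsto b l atTop) (hx : Tendsto x l (𝓝 x₀)) :
    Tendsto (fun n => √(b n ^ 2 + x n) / b n) l (𝓝 1) := by
  have hb2 : Tendsto (fun n => b n ^ 2) l atTop := (tendsto_pow_atTop two_ne_zero).comp hb
  have h1 : Tendsto (fun n => √(1 + x n / b n ^ 2)) l (𝓝 √(1 + 0)) :=
    (tendsto_const_nhds.add (hx.div_atTop hb2)).sqrt
  rw [add_zero, Real.sqrt_one] at h1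
  refine h1.congr' ?_
  filter_upwards [hb.eventually_gt_atTop 0] with n hn
  have : b n ^ 2 + x n = b n ^ 2 * (1 + x n / b n ^ 2) := by field_simp
  rw [this, Real.sqrt_mul (by positivity), Real.sqrt_sq hn.le]
  field_simp

lemma tendsto_mul_sqrt_sub_sq {ι : Type*} {l : Filter ι} {b x : ι → ℝ} {x₀ : ℝ}
    (hb : Tendsto b l atTop) (hx : Tendsto x l (𝓝 x₀)) :
    Tendsto (fun n => b n * √(b n ^ 2 + x n) - b n ^ 2) l (𝓝 (x₀ / 2)) := by
  have hb2 : Tendsto (fun n => b n ^ 2) l atTop := (tendsto_pow_atTop two_ne_zero).comp hb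
  have h1 : Tendsto (fun n => x n / (√(b n ^ 2 + x n) / b n + 1)) l (𝓝 (x₀ / (1 + 1))) :=
    hx.div ((tendsto_div_sqrt_sq_add hb hx).add_const 1) (by norm_num)
  rw [one_add_one_eq_two] at h1
  refine h1.congr' ?_
  filter_upwards [hb.eventually_gt_atTop 0,
    (hb2.atTop_add hx).eventually_gt_atTop 0] with n hn hp
  have h0 := Real.mul_self_sqrt hp.le
  have : √(b n ^ 2 + x n) / b n + 1 ≠ 0 := by positivity
  rw [div_eq_iff this]
  field_simp
  nlinarith

lemma IsPriorDensity.centredExponent_bound (hπ : IsPriorDensity π) (θ : ℝ) {B : ℝ}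
    (hB : 0 < B) : ∃ C : ℝ, ∀ᶠ n in atTop, ∀ t ∈ Set.Icc 0 B,
      ‖centredExponent π θ n t‖ ≤ C * (t + |Real.negMulLog t|) := by
  have h1 := ((tendsto_tailCoef θ).norm).eventually (gt_mem_nhds (lt_add_one ‖levyExponent θ‖))
  rw [eventually_nhdsWithin_iff] at h1
  obtain ⟨δ, hδ, hball⟩ := Metric.eventually_nhds_iff.1 h1
  set M := ‖levyExponent θ‖ + 1 with hM
  have hM0 : 0 ≤ M := by positivity
  refine ⟨4 * |θ| + 4 * M, ?_⟩
  have hβ0 : Tendsto (gridScale π) atTop (𝓝 0) :=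
    hπ.tendsto_gridScale.mono_right nhdsWithin_le_nhds
  filter_upwards [tendsto_bSeq_atTop.eventually_gt_atTop 0, eventually_gt_atTop 0,
    hπ.tendsto_gridMass.eventually (lt_mem_nhds (show (1 / 2 : ℝ) < 1 by norm_num)),
    hπ.gridScale_pos, hβ0.eventually (gt_mem_nhds (show 0 < min 1 δ / B by positivity)),
    hπ.tendsto_two_mul_log_gridScale.abs.eventually
      (gt_mem_nhds (show |(0 : ℝ)| < 1 by simp)),
    tendsto_bSeq_sq_atTop.eventually_gt_atTop (4 * (1 + 2 * Real.log B))]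
    with n hb hn hZ hβ hβB hε hbB t ht
  rcases ht.1.eq_or_lt with rfl | ht0
  · simp [centredExponent_zero]
  have hβt : gridScale π n * t < min 1 δ :=
    (mul_le_mul_of_nonneg_left ht.2 hβ.le).trans_lt ((lt_div_iff₀ hB).1 hβB)
  have hβt0 : 0 < gridScale π n * t := by positivity
  have hZ0 : 0 < gridMass π n := lt_trans (by norm_num) hZ
  have hlogt : Real.log t ≤ Real.log B := Real.log_le_log ht0 ht.2
  have hxlow : -1 - 2 * Real.log B ≤ logExcess π n t := by
    rw [logExcess]; linarith [(abs_lt.1 hε).1]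
  have hxabs : |logExcess π n t| ≤ 1 + 2 * |Real.log t| := by
    rw [logExcess]
    refine (abs_sub _ _).trans ?_
    rw [abs_mul, abs_two]; linarith
  have hx4 : bSeq n ^ 2 ≤ 2 ^ 2 * (bSeq n ^ 2 + logExcess π n t) := by
    nlinarith [sq_nonneg (bSeq n)]
  have hx0 : 0 < bSeq n ^ 2 + logExcess π n t := by
    have : 0 < bSeq n ^ 2 := by positivity
    linarith
  have hT : ‖tailCoef θ (gridScale π n * t)‖ ≤ M := by
    refine (hball ?_ hβt0).le
    rw [Real.dist_eq, sub_zero, abs_of_pos hβt0]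
    exact hβt.trans_le (min_le_right _ _)
  have hrat : bSeq n / √(bSeq n ^ 2 + logExcess π n t) ≤ 2 := by
    rw [div_le_iff₀ (Real.sqrt_pos.2 hx0)]
    have := Real.sqrt_le_sqrt hx4
    rwa [Real.sqrt_sq hb.le, Real.sqrt_mul (by norm_num), Real.sqrt_sq (by norm_num)] at this
  have htZ : t / gridMass π n ≤ 2 * t := by
    rw [div_le_iff₀ hZ0]; nlinarith
  have hnml : |Real.negMulLog t| = t * |Real.log t| := by
    rw [Real.negMulLog, abs_mul, abs_neg, abs_of_pos ht0]
  rw [centredExponent_eq θ hn hb hZ0 ht0 (hβt.trans_le (min_le_left _ _)), hnml]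
  have ha := abs_nonneg (Real.log t)
  have hlog : 0 ≤ t * |Real.log t| := by positivity
  calc _ ≤ |θ| * (2 * t * (1 + 2 * |Real.log t|)) + (2 * t * 2) * M := by
        refine (norm_add_le _ _).trans (add_le_add ?_ ?_)
        · rw [norm_mul, Complex.norm_I, one_mul, Complex.norm_real, Real.norm_eq_abs, abs_mul,
            abs_mul, abs_of_pos (a := t / gridMass π n) (by positivity)]
          gcongr
          exact (abs_mul_sqrt_sub_sq_le hb hx0.le).trans hxabs
        · rw [norm_smul, Real.norm_of_nonneg (by positivity)]
          gcongr
    _ ≤ (4 * |θ| + 4 * M) * (t + t * |Real.log t|) := by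
        nlinarith [abs_nonneg θ, mul_nonneg (abs_nonneg θ) ht0.le, mul_nonneg hM0 hlog]

/-- The limit of `centredExponent`: the first summand produces the entropy, the second the
characteristic exponent of `ζ°`. -/
lemma IsPriorDensity.tendsto_centredExponent (hπ : IsPriorDensity π) (θ : ℝ) {B : ℝ}
    (hB : 0 < B) (u : ℕ → ℝ) (t : ℝ) (hu : ∀ᶠ n in atTop, u n ∈ Set.Icc 0 B)
    (hut : Tendsto u atTop (𝓝 t)) :
    Tendsto (fun n => centredExponent π θ n (u n)) atTop
      (𝓝 (Complex.I * ((θ * Real.negMulLog t : ℝ) : ℂ) + t • levyExponent θ)) := by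
  have ht0 : 0 ≤ t := ge_of_tendsto hut (hu.mono fun n hn => hn.1)
  rcases ht0.eq_or_lt with rfl | ht
  · obtain ⟨C, hC⟩ := hπ.centredExponent_bound θ hB
    simp only [Real.negMulLog_zero, mul_zero, Complex.ofReal_zero, zero_smul, add_zero]
    have h1 : Tendsto (fun n => C * (u n + |Real.negMulLog (u n)|)) atTop
        (𝓝 (C * (0 + |Real.negMulLog 0|))) :=
      (hut.add ((Real.continuous_negMulLog.tendsto 0).comp hut).abs).const_mul C
    simp only [Real.negMulLog_zero, abs_zero, add_zero, mul_zero] at h1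
    refine squeeze_zero_norm' ?_ h1
    filter_upwards [hC, hu] with n hn hun using hn _ hun
  · have hupos : ∀ᶠ n in atTop, 0 < u n := hut.eventually (lt_mem_nhds ht)
    have hβu : Tendsto (fun n => gridScale π n * u n) atTop (𝓝[>] 0) := by
      refine tendsto_nhdsWithin_iff.2 ⟨?_, ?_⟩
      · have := (hπ.tendsto_gridScale.mono_right nhdsWithin_le_nhds).mul hut
        rwa [zero_mul] at this
      · filter_upwards [hπ.gridScale_pos, hupos] with n h1 h2 using mul_pos h1 h2
    have hx : Tendsto (fun n => logExcess π n (u n)) atTop (𝓝 (0 - 2 * Real.log t)) :=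
      hπ.tendsto_two_mul_log_gridScale.sub ((hut.log ht.ne').const_mul 2)
    have hA := tendsto_mul_sqrt_sub_sq tendsto_bSeq_atTop hx
    have hR := (tendsto_div_sqrt_sq_add tendsto_bSeq_atTop hx).inv₀ one_ne_zero
    have hZ : Tendsto (fun n => u n / gridMass π n) atTop (𝓝 (t / 1)) :=
      hut.div hπ.tendsto_gridMass one_ne_zero
    rw [div_one] at hZ
    have hT := (tendsto_tailCoef θ).comp hβu
    have h1 : Tendsto (fun n => Complex.I * ((θ * (u n / gridMass π n *
        (bSeq n * √(bSeq n ^ 2 + logExcess π n (u n)) - bSeq n ^ 2)) : ℝ) : ℂ)) atTop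
        (𝓝 (Complex.I * ((θ * (t * ((0 - 2 * Real.log t) / 2)) : ℝ) : ℂ))) :=
      ((Complex.continuous_ofReal.tendsto _).comp ((hZ.mul hA).const_mul θ)).const_mul _
    have h2 := (hZ.mul hR).smul hT
    have h3 := h1.add h2
    have e1 : t * ((0 - 2 * Real.log t) / 2) = Real.negMulLog t := by
      rw [Real.negMulLog]; ring
    rw [e1, inv_one, mul_one] at h3
    refine h3.congr' ?_
    filter_upwards [tendsto_bSeq_atTop.eventually_gt_atTop 0, eventually_gt_atTop 0,
      hπ.tendsto_gridMass.eventually (lt_mem_nhds one_pos), hupos,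
      (hβu.mono_right nhdsWithin_le_nhds).eventually (gt_mem_nhds one_pos)]
      with n hb hn hZ0 hun hlt
    rw [centredExponent_eq θ hn hb hZ0 hun hlt]
    simp only [Function.comp, inv_div]

lemma IsPriorDensity.integrableOn (hπ : IsPriorDensity π) : IntegrableOn π (Set.Ioi 0) := by
  by_contra h
  have := integral_undef h
  rw [hπ.integral_eq_one] at this
  exact one_ne_zero this

lemma IsPriorDensity.integrableOn_negMulLog (hπ : IsPriorDensity π) :
    IntegrableOn (fun x => Real.negMulLog (π x)) (Set.Ioi 0) := by
  obtain ⟨g, hg, hg0, hgb⟩ := hπ.exists_step_bound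
  refine Integrable.mono' (integrableOn_step_of_summable hg hg0)
    (Real.continuous_negMulLog.comp_aestronglyMeasurable hπ.integrableOn.aestronglyMeasurable) ?_
  filter_upwards [ae_restrict_mem measurableSet_Ioi] with x hx
  have hx0 : (0 : ℝ) < x := hx
  have := hgb x x hx0 le_rfl (by linarith)
  have := hπ.nonneg x hx0
  rw [Real.norm_eq_abs]; linarith

lemma integral_negMulLog_eq_entropy :
    ∫ x in Set.Ioi (0 : ℝ), Real.negMulLog (π x) = entropy π := by
  unfold entropy
  refine integral_congr_ae (Eventually.of_forall fun x => ?_)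
  simp only [Real.negMulLog, one_div, Real.log_inv]; ring

/-- Convergence of the characteristic exponent of the scaled and centred statistic. -/
theorem IsPriorDensity.tendsto_sum_scaledCharSubOne (hπ : IsPriorDensity π) (θ : ℝ) :
    (∀ᶠ n in atTop, Summable fun i => scaledCharSubOne θ (scaleSeq n * priorWeight π n i)) ∧
    Tendsto (fun n => ∑' i, scaledCharSubOne θ (scaleSeq n * priorWeight π n i)
        - Complex.I * ((θ * bSeq n ^ 2 : ℝ) : ℂ)) atTop
      (𝓝 (Complex.I * ((θ * entropy π : ℝ) : ℂ) + levyExponent θ)) := by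
  obtain ⟨B₀, hB₀⟩ := hπ.bounded
  set B := max B₀ 1
  have hBpos : 0 < B := lt_max_of_lt_right one_pos
  have hB : ∀ x, 0 < x → π x ≤ B := fun x hx => (hB₀ x hx).trans (le_max_left _ _)
  obtain ⟨C, hC⟩ := hπ.centredExponent_bound θ hBpos
  obtain ⟨hs, hl⟩ := hπ.tendsto_riemannSum hB hC
    (F₀ := fun t => Complex.I * ((θ * Real.negMulLog t : ℝ) : ℂ) + t • levyExponent θ)
    (fun u t hu hut => hπ.tendsto_centredExponent θ hBpos u t hu hut)
  have hI : ∫ x in Set.Ioi (0 : ℝ),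
      (Complex.I * ((θ * Real.negMulLog (π x) : ℝ) : ℂ) + π x • levyExponent θ)
      = Complex.I * ((θ * entropy π : ℝ) : ℂ) + levyExponent θ := by
    rw [integral_add, integral_const_mul, integral_complex_ofReal, integral_const_mul,
      integral_negMulLog_eq_entropy, integral_smul_const, hπ.integral_eq_one, one_smul]
    · exact ((hπ.integrableOn_negMulLog.const_mul θ).ofReal).const_mul Complex.I
    · exact hπ.integrableOn.smul_const _
  rw [hI] at hl
  have key : ∀ᶠ n : ℕ in atTop,
      HasSum (fun i => scaledCharSubOne θ (scaleSeq n * priorWeight π n i))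
        ((n : ℝ)⁻¹ • ∑' i : ℕ, centredExponent π θ n (π (((i : ℝ) + 1) / n))
          + Complex.I * ((θ * bSeq n ^ 2 : ℝ) : ℂ)) := by
    filter_upwards [hs, hπ.hasSum_priorWeight, eventually_gt_atTop 0,
      hπ.tendsto_gridMass.eventually (lt_mem_nhds one_pos)] with n h1 h2 hn hZ
    have hn' : (n : ℝ) ≠ 0 := by positivity
    have h3 : HasSum (fun i => Complex.I * ((θ * bSeq n ^ 2 * priorWeight π n i : ℝ) : ℂ))
        (Complex.I * ((θ * bSeq n ^ 2 * 1 : ℝ) : ℂ)) :=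
      (Complex.hasSum_ofReal.2 (h2.mul_left (θ * bSeq n ^ 2))).mul_left Complex.I
    rw [mul_one] at h3
    have h4 := (h1.hasSum.const_smul ((n : ℝ)⁻¹)).add h3
    refine h4.congr_fun fun i => ?_
    rw [scaleSeq_mul_priorWeight hn, priorWeight_eq hn, centredExponent, smul_sub, smul_smul,
      inv_mul_cancel₀ hn', one_smul, Complex.real_smul]
    have : (n : ℂ) ≠ 0 := by exact_mod_cast hn'
    have : ((gridMass π n : ℝ) : ℂ) ≠ 0 := by exact_mod_cast hZ.ne'
    push_cast
    field_simp
    ring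
  refine ⟨key.mono fun n hn => hn.summable, hl.congr' ?_⟩
  filter_upwards [key] with n hn
  rw [hn.tsum_eq]; ring

/-- The quadratic error of replacing the product of the characteristic functions by the
exponential of the sum. -/
theorem IsPriorDensity.tendsto_sum_norm_sq (hπ : IsPriorDensity π) (θ : ℝ) :
    (∀ᶠ n in atTop, Summable fun i =>
      ‖scaledCharSubOne θ (scaleSeq n * priorWeight π n i)‖ ^ 2) ∧
    Tendsto (fun n => ∑' i, ‖scaledCharSubOne θ (scaleSeq n * priorWeight π n i)‖ ^ 2)
      atTop (𝓝 0) := by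
  obtain ⟨B₀, hB₀⟩ := hπ.bounded
  set B := max B₀ 1
  have hBpos : 0 < B := lt_max_of_lt_right one_pos
  have hB : ∀ x, 0 < x → π x ≤ B := fun x hx => (hB₀ x hx).trans (le_max_left _ _)
  obtain ⟨C, hC0, δ, hδ, hC⟩ := exists_norm_scaledCharSubOne_sq_le θ
  have hβ0 : Tendsto (gridScale π) atTop (𝓝 0) :=
    hπ.tendsto_gridScale.mono_right nhdsWithin_le_nhds
  have key : ∀ᶠ n in atTop, ∀ i, ‖scaledCharSubOne θ (scaleSeq n * priorWeight π n i)‖ ^ 2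
      ≤ C * √(gridScale π n * B) * scaleSeq n * priorWeight π n i := by
    filter_upwards [hπ.gridScale_pos, eventually_gt_atTop 0,
      hβ0.eventually (gt_mem_nhds (show 0 < δ / B by positivity))] with n hβ hn hβδ i
    have hy : 0 < ((i : ℝ) + 1) / n := div_pos (by positivity) (Nat.cast_pos.2 hn)
    have h0 := hπ.nonneg _ hy
    have h1 : gridScale π n * π (((i : ℝ) + 1) / n) ≤ gridScale π n * B := by
      gcongr; exact hB _ hy
    have h2 : gridScale π n * B < δ := (lt_div_iff₀ hBpos).1 hβδ
    rw [mul_assoc, scaleSeq_mul_priorWeight hn]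
    refine (hC _ (by positivity) (h1.trans_lt h2)).trans ?_
    rw [mul_assoc C √_]
    refine mul_le_mul_of_nonneg_left ?_ hC0
    rw [mul_comm]
    gcongr
  have hlim : Tendsto (fun n => C * √(gridScale π n * B) * scaleSeq n) atTop (𝓝 0) := by
    -- `√β_n ≤ exp (-b_n² / 8)` for large `n`, while `scaleSeq` is linear in `b_n`
    have h1 : Tendsto (fun n => bSeq n * Real.exp (-(1 / 8) * bSeq n)) atTop (𝓝 0) := by
      have := Real.tendsto_pow_mul_exp_neg_atTop_nhds_zero 1
      have h2 := (this.comp (tendsto_bSeq_atTop.const_mul_atTop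
        (show (0 : ℝ) < 1 / 8 by norm_num))).const_mul 8
      simp only [mul_zero] at h2
      refine h2.congr fun n => ?_
      simp only [Function.comp, pow_one]
      rw [neg_mul]; ring
    have h3 := (h1.const_mul (C * √B * √(Real.pi / 2)))
    rw [mul_zero] at h3
    refine squeeze_zero' ?_ ?_ h3
    · filter_upwards [tendsto_bSeq_atTop.eventually_gt_atTop 0] with n hn
      unfold scaleSeq; positivity
    · filter_upwards [hπ.gridScale_pos, tendsto_bSeq_atTop.eventually_gt_atTop 8,
        hπ.tendsto_two_mul_log_gridScale.eventually (lt_mem_nhds (show (-1 : ℝ) < 0 by norm_num))]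
        with n hβ hb hε
      have h5 : gridScale π n ≤ Real.exp (-(1 / 8) * bSeq n) ^ 2 := by
        rw [← Real.exp_nat_mul, ← Real.log_le_iff_le_exp hβ]
        rw [Real.log_inv] at hε
        push_cast
        nlinarith
      have h6 : √(gridScale π n) ≤ Real.exp (-(1 / 8) * bSeq n) :=
        (Real.sqrt_le_left (Real.exp_pos _).le).2 h5
      rw [Real.sqrt_mul hβ.le, scaleSeq]
      calc _ = C * √B * √(Real.pi / 2) * (bSeq n * √(gridScale π n)) := by ring
        _ ≤ _ := by gcongr
  have hS : ∀ᶠ n in atTop, Summable (fun i =>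
      ‖scaledCharSubOne θ (scaleSeq n * priorWeight π n i)‖ ^ 2) := by
    filter_upwards [key, hπ.hasSum_priorWeight] with n h1 h2
    exact Summable.of_nonneg_of_le (fun i => by positivity) h1 (h2.summable.mul_left _)
  refine ⟨hS, squeeze_zero' (Eventually.of_forall fun n => tsum_nonneg fun i => by positivity)
    ?_ hlim⟩
  filter_upwards [key, hS, hπ.hasSum_priorWeight] with n h1 h2 h3
  have h4 := h3.mul_left (C * √(gridScale π n * B) * scaleSeq n)
  rw [mul_one] at h4
  exact (h2.tsum_le_tsum h1 h4.summable).trans_eq h4.tsum_eq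

end Exponent

/-! ### The statistic: convergence and characteristic function -/

section Product

/-- A product of complex numbers `1 + a i` in the unit disc is compared with the exponential of
the sum of the `a i`. -/
lemma norm_prod_one_add_sub_exp_sum_le (a : ℕ → ℂ) (ha : ∀ i, ‖1 + a i‖ ≤ 1) (N : ℕ) :
    ‖∏ i ∈ Finset.range N, (1 + a i) - Complex.exp (∑ i ∈ Finset.range N, a i)‖
      ≤ 2 * ∑ i ∈ Finset.range N, ‖a i‖ ^ 2 := by
  have hexp : ∀ i, ‖Complex.exp (a i)‖ ≤ 1 := by
    intro i
    rw [Complex.norm_exp, Real.exp_le_one_iff]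
    have h := (Complex.re_le_norm (1 + a i)).trans (ha i)
    rw [Complex.add_re, Complex.one_re] at h
    linarith
  have hone : ∀ i, ‖1 + a i - Complex.exp (a i)‖ ≤ 2 * ‖a i‖ ^ 2 := by
    intro i
    by_cases h : ‖a i‖ ≤ 1
    · have := Complex.norm_exp_sub_one_sub_id_le h
      have h2 : 1 + a i - Complex.exp (a i) = -(Complex.exp (a i) - 1 - a i) := by ring
      rw [h2, norm_neg]
      nlinarith [sq_nonneg ‖a i‖]
    · push Not at h
      refine (norm_sub_le _ _).trans ?_
      have := ha i; have := hexp i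
      nlinarith
  induction N with
  | zero => simp
  | succ N ih =>
    rw [Finset.prod_range_succ, Finset.sum_range_succ, Finset.sum_range_succ, Complex.exp_add]
    set P := ∏ i ∈ Finset.range N, (1 + a i)
    set Q := Complex.exp (∑ i ∈ Finset.range N, a i) with hQ
    have hQ1 : ‖Q‖ ≤ 1 := by
      rw [hQ, Complex.exp_sum, norm_prod]
      exact Finset.prod_le_one (fun i _ => norm_nonneg _) (fun i _ => hexp i)
    have h1 : P * (1 + a N) - Q * Complex.exp (a N)
        = (P - Q) * (1 + a N) + Q * (1 + a N - Complex.exp (a N)) := by ring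
    rw [h1]
    refine (norm_add_le _ _).trans ?_
    rw [norm_mul, norm_mul]
    have h2 : ‖P - Q‖ * ‖1 + a N‖ ≤ ‖P - Q‖ := mul_le_of_le_one_right (norm_nonneg _) (ha N)
    have h3 : ‖Q‖ * ‖1 + a N - Complex.exp (a N)‖ ≤ ‖1 + a N - Complex.exp (a N)‖ :=
      mul_le_of_le_one_left (norm_nonneg _) hQ1
    linarith [hone N]

end Product

section Statistic

variable {Ω : Type*} [MeasurableSpace Ω] {P : Measure Ω} {ξ : ℕ → Ω → ℝ}

lemma integral_min_one_mul_exp_le {s : ℝ} (hs0 : 0 ≤ s) (hs : s < Real.exp (-1)) :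
    ∫ x, min 1 (s * Real.exp (x ^ 2 / 2)) ∂(gaussianReal 0 1) ≤ 2 * Real.negMulLog s + s := by
  rcases hs0.eq_or_lt with rfl | hs0
  · simp
  have hs1 : s < 1 := hs.trans (by rw [Real.exp_lt_one_iff]; norm_num)
  have hL : 1 ≤ Real.log s⁻¹ := by
    rw [Real.log_inv]
    linarith [(Real.log_lt_iff_lt_exp hs0).2 hs]
  have hpi : (1 : ℝ) ≤ Real.pi := by linarith [Real.pi_gt_three]
  refine (integral_min_one_scaled_exp_le ⟨hs0, hs1⟩).trans (add_le_add ?_ ?_)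
  · have h1 : √(Real.log s⁻¹ / Real.pi) ≤ Real.log s⁻¹ := by
      refine (Real.sqrt_le_left (by linarith)).2 ?_
      refine (div_le_self (by linarith) hpi).trans ?_
      nlinarith
    have h2 : 2 * Real.negMulLog s = s * (2 * Real.log s⁻¹) := by
      rw [Real.negMulLog, Real.log_inv]; ring
    rw [h2]
    gcongr
  · refine div_le_self hs0.le (Real.one_le_sqrt.2 ?_)
    nlinarith

/-- Almost sure convergence of a weighted series of `exp (ξ_i² / 2)`, whose terms have infinite
mean: the series of the truncated terms `min 1 (w_i exp (ξ_i² / 2))` has a finite mean, and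
its convergence forces the truncation to be inactive for all but finitely many indices. -/
lemma ae_summable_mul_exp [IsProbabilityMeasure P] (hξ : ∀ i, HasLaw (ξ i) (gaussianReal 0 1) P)
    {w : ℕ → ℝ} (hw0 : ∀ i, 0 ≤ w i) (hw : Summable w)
    (hwl : Summable fun i => Real.negMulLog (w i)) :
    ∀ᵐ ω ∂P, Summable fun i => w i * Real.exp (ξ i ω ^ 2 / 2) := by
  have hm : ∀ i, Measurable fun x : ℝ => min 1 (w i * Real.exp (x ^ 2 / 2)) := fun i => by fun_prop
  have h0 : ∀ i (x : ℝ), 0 ≤ min 1 (w i * Real.exp (x ^ 2 / 2)) := fun i x =>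
    le_min zero_le_one (mul_nonneg (hw0 i) (Real.exp_pos _).le)
  have hbound : ∀ᶠ i in cofinite, ‖∫ x, min 1 (w i * Real.exp (x ^ 2 / 2)) ∂(gaussianReal 0 1)‖
      ≤ 2 * Real.negMulLog (w i) + w i := by
    filter_upwards [hw.tendsto_cofinite_zero.eventually (gt_mem_nhds (Real.exp_pos (-1)))]
      with i hi
    rw [Real.norm_of_nonneg (integral_nonneg (h0 i))]
    exact integral_min_one_mul_exp_le (hw0 i) hi
  have hsum : Summable fun i => ∫ x, min 1 (w i * Real.exp (x ^ 2 / 2)) ∂(gaussianReal 0 1) :=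
    Summable.of_norm_bounded_eventually ((hwl.mul_left 2).add hw) hbound
  have hint : ∀ i, Integrable (fun x : ℝ => min 1 (w i * Real.exp (x ^ 2 / 2)))
      (gaussianReal 0 1) := fun i =>
    Integrable.of_bound (hm i).aestronglyMeasurable 1 (Eventually.of_forall fun x => by
      rw [Real.norm_of_nonneg (h0 i x)]; exact min_le_left _ _)
  have hl : ∀ i, ∫⁻ ω, ENNReal.ofReal (min 1 (w i * Real.exp (ξ i ω ^ 2 / 2))) ∂P
      = ENNReal.ofReal (∫ x, min 1 (w i * Real.exp (x ^ 2 / 2)) ∂(gaussianReal 0 1)) := by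
    intro i
    rw [ofReal_integral_eq_lintegral_ofReal (hint i) (Eventually.of_forall (h0 i))]
    exact (hξ i).lintegral_comp (f := fun x => ENNReal.ofReal (min 1 (w i * Real.exp (x ^ 2 / 2))))
      (by fun_prop)
  have hma : ∀ i, AEMeasurable (fun ω => ENNReal.ofReal (min 1 (w i * Real.exp (ξ i ω ^ 2 / 2)))) P
    := fun i => (hm i).ennreal_ofReal.comp_aemeasurable (hξ i).aemeasurable
  have hfin : ∫⁻ ω, ∑' i, ENNReal.ofReal (min 1 (w i * Real.exp (ξ i ω ^ 2 / 2))) ∂P ≠ ⊤ := by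
    rw [lintegral_tsum hma]
    simp_rw [hl]
    exact hsum.tsum_ofReal_ne_top
  filter_upwards [ae_lt_top' (AEMeasurable.tsum hma) hfin] with ω hω
  have h1 : Summable fun i => min 1 (w i * Real.exp (ξ i ω ^ 2 / 2)) := by
    have := ENNReal.summable_toReal hω.ne
    simpa only [ENNReal.toReal_ofReal (h0 _ _)] using this
  refine h1.congr_cofinite ?_
  filter_upwards [h1.tendsto_cofinite_zero.eventually (gt_mem_nhds one_pos)] with i hi
  rcases min_lt_iff.1 hi with h | h
  · exact absurd h (lt_irrefl _)
  · exact min_eq_right h.le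

lemma IsPriorDensity.ae_summable_bayesStat {π : ℝ → ℝ} (hπ : IsPriorDensity π)
    [IsProbabilityMeasure P] (hξ : ∀ i, HasLaw (ξ i) (gaussianReal 0 1) P) :
    ∀ᶠ n in atTop, ∀ᵐ ω ∂P, Summable fun i => priorWeight π n i * Real.exp (ξ i ω ^ 2 / 2) := by
  filter_upwards [hπ.hasSum_priorWeight, hπ.summable_negMulLog_grid, hπ.summable_grid,
    eventually_gt_atTop 0] with n h1 h2 h3 hn
  refine ae_summable_mul_exp hξ (hπ.priorWeight_nonneg n) h1.summable ?_
  have h4 : ∀ i, Real.negMulLog (priorWeight π n i)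
      = (n * gridMass π n)⁻¹ * Real.negMulLog (π (((i : ℝ) + 1) / n))
        + π (((i : ℝ) + 1) / n) * Real.negMulLog (n * gridMass π n)⁻¹ := by
    intro i
    rw [priorWeight_eq hn, div_eq_mul_inv, Real.negMulLog_mul]
  simp_rw [h4]
  exact (h2.mul_left _).add (h3.mul_right _)

lemma measurable_bayesStat_eval (π : ℝ → ℝ) (n : ℕ) :
    Measurable (bayesStat π (fun i (x : ℕ → ℝ) => x i) n) := by
  unfold bayesStat
  exact Measurable.tsum fun i => by fun_prop

lemma aemeasurable_bayesStat (hξ : ∀ i, AEMeasurable (ξ i) P) (π : ℝ → ℝ) (n : ℕ) :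
    AEMeasurable (bayesStat π ξ n) P :=
  (measurable_bayesStat_eval π n).comp_aemeasurable (aemeasurable_pi_iff.2 hξ)

lemma charFun_map_mul_exp (hξ : ∀ i, HasLaw (ξ i) (gaussianReal 0 1) P) (θ s : ℝ) (i : ℕ) :
    charFun (P.map fun ω => s * Real.exp (ξ i ω ^ 2 / 2)) θ = 1 + scaledCharSubOne θ s := by
  have hm : AEMeasurable (fun ω => s * Real.exp (ξ i ω ^ 2 / 2)) P :=
    (measurable_scaled_exp s).comp_aemeasurable (hξ i).aemeasurable
  rw [charFun_apply_real, integral_map hm (by fun_prop), scaledCharSubOne, integral_sub]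
  · rw [integral_const, probReal_univ, one_smul, add_sub_cancel]
    rw [← (hξ i).integral_comp (f := fun x : ℝ =>
      Complex.exp (Complex.I * ((θ * (s * Real.exp (x ^ 2 / 2)) : ℝ) : ℂ))) (by fun_prop)]
    refine integral_congr_ae (Eventually.of_forall fun ω => ?_)
    simp only [Function.comp]
    congr 1; push_cast; ring
  · refine Integrable.of_bound (by fun_prop) 1 (Eventually.of_forall fun x => ?_)
    rw [Complex.norm_exp_I_mul_ofReal]
  · exact integrable_const _

lemma norm_charFun_tsum_sub_exp_le [IsProbabilityMeasure P]
    (hξ : ∀ i, HasLaw (ξ i) (gaussianReal 0 1) P) (hind : iIndepFun ξ P) (θ : ℝ) {s : ℕ → ℝ}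
    (hs : ∀ᵐ ω ∂P, Summable fun i => s i * Real.exp (ξ i ω ^ 2 / 2))
    (ha : Summable fun i => scaledCharSubOne θ (s i))
    (ha2 : Summable fun i => ‖scaledCharSubOne θ (s i)‖ ^ 2) :
    ‖charFun (P.map fun ω => ∑' i, s i * Real.exp (ξ i ω ^ 2 / 2)) θ
        - Complex.exp (∑' i, scaledCharSubOne θ (s i))‖
      ≤ 2 * ∑' i, ‖scaledCharSubOne θ (s i)‖ ^ 2 := by
  have hY : ∀ i, AEMeasurable (fun ω => s i * Real.exp (ξ i ω ^ 2 / 2)) P := fun i =>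
    (measurable_scaled_exp (s i)).comp_aemeasurable (hξ i).aemeasurable
  have hindY : iIndepFun (fun i ω => s i * Real.exp (ξ i ω ^ 2 / 2)) P :=
    hind.comp (fun i x => s i * Real.exp (x ^ 2 / 2)) (fun i => measurable_scaled_exp (s i))
  have hSN : ∀ N, AEMeasurable (fun ω => ∑ i ∈ Finset.range N, s i * Real.exp (ξ i ω ^ 2 / 2)) P :=
    fun N => Finset.aemeasurable_fun_sum _ fun i _ => hY i
  have hS : AEMeasurable (fun ω => ∑' i, s i * Real.exp (ξ i ω ^ 2 / 2)) P := by
    have hmc : Measurable fun x : ℕ → ℝ => ∑' i, s i * Real.exp (x i ^ 2 / 2) :=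
      Measurable.tsum fun i => by fun_prop
    exact hmc.comp_aemeasurable (aemeasurable_pi_iff.2 fun i => (hξ i).aemeasurable)
  have hprod : ∀ N, charFun (P.map fun ω => ∑ i ∈ Finset.range N, s i * Real.exp (ξ i ω ^ 2 / 2)) θ
      = ∏ i ∈ Finset.range N, (1 + scaledCharSubOne θ (s i)) := by
    intro N
    rw [iIndepFun.charFun_map_fun_finsetSum_eq_prod (fun i _ => hY i)
      (hindY.precomp (g := ((↑) : Finset.range N → ℕ)) Subtype.val_injective), Finset.prod_apply]
    exact Finset.prod_congr rfl fun i _ => charFun_map_mul_exp hξ θ (s i) i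
  have hlim : Tendsto (fun N => charFun
      (P.map fun ω => ∑ i ∈ Finset.range N, s i * Real.exp (ξ i ω ^ 2 / 2)) θ) atTop
      (𝓝 (charFun (P.map fun ω => ∑' i, s i * Real.exp (ξ i ω ^ 2 / 2)) θ)) := by
    simp_rw [charFun_apply_real]
    rw [integral_map hS (by fun_prop)]
    simp_rw [fun N => integral_map (hSN N) (f := fun x : ℝ => Complex.exp (θ * x * Complex.I))
      (by fun_prop)]
    refine tendsto_integral_of_dominated_convergence (fun _ => 1) (fun N => ?_)
      (integrable_const _) (fun N => Eventually.of_forall fun ω => ?_) ?_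
    · exact ((by fun_prop : Measurable fun x : ℝ =>
        Complex.exp (θ * x * Complex.I)).comp_aemeasurable (hSN N)).aestronglyMeasurable
    · rw [← Complex.ofReal_mul, Complex.norm_exp_ofReal_mul_I]
    · filter_upwards [hs] with ω hω
      have hc : Continuous fun x : ℝ => Complex.exp (θ * x * Complex.I) := by fun_prop
      exact (hc.tendsto _).comp hω.hasSum.tendsto_sum_nat
  have hexp : Tendsto (fun N => Complex.exp (∑ i ∈ Finset.range N, scaledCharSubOne θ (s i))) atTop
      (𝓝 (Complex.exp (∑' i, scaledCharSubOne θ (s i)))) :=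
    (Complex.continuous_exp.tendsto _).comp ha.hasSum.tendsto_sum_nat
  refine le_of_tendsto_of_tendsto' (hlim.sub hexp).norm
    (ha2.hasSum.tendsto_sum_nat.const_mul 2) fun N => ?_
  rw [hprod]
  exact norm_prod_one_add_sub_exp_sum_le _ (fun i => norm_one_add_scaledCharSubOne_le θ (s i)) N

/-- The scaled and centred statistic, which converges in law to `ζ°`. -/
noncomputable def centredStat {Ω : Type*} (π : ℝ → ℝ) (ξ : ℕ → Ω → ℝ) (n : ℕ) (ω : Ω) : ℝ :=
  scaleSeq n * bayesStat π ξ n ω - (bSeq n ^ 2 + entropy π)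

theorem IsPriorDensity.tendsto_charFun_centredStat {π : ℝ → ℝ} (hπ : IsPriorDensity π)
    [IsProbabilityMeasure P] (hξ : ∀ i, HasLaw (ξ i) (gaussianReal 0 1) P)
    (hind : iIndepFun ξ P) (θ : ℝ) :
    Tendsto (fun n => charFun (P.map (centredStat π ξ n)) θ) atTop
      (𝓝 (Complex.exp (levyExponent θ))) := by
  obtain ⟨hs1, hl1⟩ := hπ.tendsto_sum_scaledCharSubOne θ
  obtain ⟨hs2, hl2⟩ := hπ.tendsto_sum_norm_sq θ
  have hmain : Tendsto (fun n => charFun (P.map fun ω => ∑' i,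
      scaleSeq n * priorWeight π n i * Real.exp (ξ i ω ^ 2 / 2)) θ
      - Complex.exp (∑' i, scaledCharSubOne θ (scaleSeq n * priorWeight π n i))) atTop (𝓝 0) := by
    have h0 := hl2.const_mul 2
    rw [mul_zero] at h0
    refine squeeze_zero_norm' ?_ h0
    filter_upwards [hs1, hs2, hπ.ae_summable_bayesStat hξ] with n h1 h2 h3
    refine norm_charFun_tsum_sub_exp_le hξ hind θ ?_ h1 h2
    filter_upwards [h3] with ω hω
    simpa only [mul_assoc] using hω.mul_left (scaleSeq n)
  have hphase : ∀ n, ‖Complex.exp (-(Complex.I * ((θ * (bSeq n ^ 2 + entropy π) : ℝ) : ℂ)))‖ = 1 := by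
    intro n
    rw [← mul_neg, ← Complex.ofReal_neg, Complex.norm_exp_I_mul_ofReal]
  have hmain2 : Tendsto (fun n =>
      Complex.exp (-(Complex.I * ((θ * (bSeq n ^ 2 + entropy π) : ℝ) : ℂ))) *
      (charFun (P.map fun ω => ∑' i,
      scaleSeq n * priorWeight π n i * Real.exp (ξ i ω ^ 2 / 2)) θ
      - Complex.exp (∑' i, scaledCharSubOne θ (scaleSeq n * priorWeight π n i)))) atTop (𝓝 0) := by
    refine squeeze_zero_norm (fun n => ?_) (tendsto_zero_iff_norm_tendsto_zero.1 hmain)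
    rw [norm_mul, hphase, one_mul]
  have hexp : Tendsto (fun n => Complex.exp (∑' i, scaledCharSubOne θ (scaleSeq n * priorWeight π n i)
        - Complex.I * ((θ * bSeq n ^ 2 : ℝ) : ℂ) - Complex.I * ((θ * entropy π : ℝ) : ℂ))) atTop
      (𝓝 (Complex.exp (levyExponent θ))) := by
    have := (Complex.continuous_exp.tendsto _).comp
      (hl1.sub_const (Complex.I * ((θ * entropy π : ℝ) : ℂ)))
    rwa [add_sub_cancel_left] at this
  have hsum := hmain2.add hexp
  rw [zero_add] at hsum
  refine hsum.congr fun n => ?_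
  have hS : AEMeasurable (bayesStat π ξ n) P :=
    aemeasurable_bayesStat (fun i => (hξ i).aemeasurable) π n
  have e1 : (fun ω => ∑' i, scaleSeq n * priorWeight π n i * Real.exp (ξ i ω ^ 2 / 2))
      = fun ω => scaleSeq n * bayesStat π ξ n ω := by
    ext ω
    rw [bayesStat, ← tsum_mul_left]
    simp only [mul_assoc]
  have hcS : AEMeasurable (fun ω => scaleSeq n * bayesStat π ξ n ω) P := hS.const_mul _
  have hcent : AEMeasurable (centredStat π ξ n) P := hcS.sub_const _
  rw [e1, mul_sub, ← Complex.exp_add, charFun_apply_real, charFun_apply_real,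
    integral_map hcS (by fun_prop), integral_map hcent (by fun_prop), ← integral_const_mul]
  have e2 : -(Complex.I * ((θ * (bSeq n ^ 2 + entropy π) : ℝ) : ℂ))
      + ∑' i, scaledCharSubOne θ (scaleSeq n * priorWeight π n i)
      = ∑' i, scaledCharSubOne θ (scaleSeq n * priorWeight π n i)
        - Complex.I * ((θ * bSeq n ^ 2 : ℝ) : ℂ) - Complex.I * ((θ * entropy π : ℝ) : ℂ) := by
    push_cast; ring
  rw [e2, sub_add_cancel]
  refine integral_congr_ae (Eventually.of_forall fun ω => ?_)
  simp only [← Complex.exp_add, centredStat]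
  congr 1
  push_cast
  ring

end Statistic

/-! ### Sums of independent exponential variables -/

section ExponentialLaw

instance isProbabilityMeasure_expMeasure_one : IsProbabilityMeasure (expMeasure 1) :=
  isProbabilityMeasure_expMeasure one_pos

lemma expMeasure_one_eq : expMeasure 1 = volume.withDensity (exponentialPDF 1) := rfl

lemma measurable_exponentialPDF_one : Measurable (exponentialPDF 1) :=
  (measurable_exponentialPDFReal 1).ennreal_ofReal

lemma integral_expMeasure_one {E : Type*} [NormedAddCommGroup E] [NormedSpace ℝ E] (f : ℝ → E) :
    ∫ x, f x ∂(expMeasure 1) = ∫ x in Set.Ioi (0 : ℝ), Real.exp (-x) • f x := by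
  rw [expMeasure_one_eq, integral_withDensity_eq_integral_toReal_smul measurable_exponentialPDF_one
    (Eventually.of_forall fun x => ENNReal.ofReal_lt_top), ← integral_Ici_eq_integral_Ioi,
    ← integral_indicator measurableSet_Ici]
  refine integral_congr_ae (Eventually.of_forall fun x => ?_)
  simp only [exponentialPDF_eq, one_mul]
  by_cases hx : 0 ≤ x
  · rw [if_pos hx, ENNReal.toReal_ofReal (Real.exp_pos _).le, Set.indicator_of_mem (Set.mem_Ici.2 hx)]
  · rw [if_neg hx, Set.indicator_of_notMem (by simpa using hx)]; simp

lemma expMeasure_one_apply_eq_zero_iff {s : Set ℝ} :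
    expMeasure 1 s = 0 ↔ volume (Set.Ici 0 ∩ s) = 0 := by
  rw [expMeasure_one_eq, withDensity_apply_eq_zero measurable_exponentialPDF_one]
  have : {x | exponentialPDF 1 x ≠ 0} = Set.Ici 0 := by
    ext x
    simp only [exponentialPDF_eq, one_mul, Set.mem_Ici, ne_eq]
    by_cases hx : 0 ≤ x
    · simp [hx, Real.exp_pos]
    · simp [hx]
  rw [this]

lemma ae_pos_expMeasure_one : ∀ᵐ x ∂(expMeasure 1), 0 < x := by
  rw [ae_iff, expMeasure_one_apply_eq_zero_iff]
  have : Set.Ici (0 : ℝ) ∩ {a | ¬ 0 < a} = {0} := by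
    ext x; simp only [Set.mem_inter_iff, Set.mem_Ici, not_lt,
      Set.mem_singleton_iff]; exact ⟨fun h => le_antisymm h.2 h.1, fun h => by simp [h]⟩
  rw [this]; simp

lemma integral_id_expMeasure_one : ∫ x, x ∂(expMeasure 1) = 1 := by
  rw [integral_expMeasure_one]
  have h := Real.Gamma_eq_integral (s := 2) two_pos
  rw [Real.Gamma_two] at h
  rw [h]
  norm_num

lemma memLp_id_expMeasure_one : MemLp (fun x : ℝ => x) 2 (expMeasure 1) := by
  rw [memLp_two_iff_integrable_sq (by fun_prop), expMeasure_one_eq,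
    integrable_withDensity_iff_integrable_smul' measurable_exponentialPDF_one
      (Eventually.of_forall fun x => ENNReal.ofReal_lt_top)]
  have h := Real.GammaIntegral_convergent (s := 3) (by norm_num)
  rw [← integrableOn_Ici_iff_integrableOn_Ioi, ← integrable_indicator_iff measurableSet_Ici] at h
  refine h.congr (Eventually.of_forall fun x => ?_)
  simp only [exponentialPDF_eq, one_mul]
  by_cases hx : 0 ≤ x
  · rw [if_pos hx, ENNReal.toReal_ofReal (Real.exp_pos _).le, Set.indicator_of_mem (Set.mem_Ici.2 hx)]
    norm_num
  · rw [if_neg hx, Set.indicator_of_notMem (by simpa using hx)]; simp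

end ExponentialLaw

section PoissonPoints

variable {Ω : Type*} [MeasurableSpace Ω] {P : Measure Ω} {e : ℕ → Ω → ℝ}

lemma ae_pos_of_hasLaw_exp (he : ∀ s, HasLaw (e s) (expMeasure 1) P) :
    ∀ᵐ ω ∂P, ∀ s, 0 < e s ω :=
  ae_all_iff.2 fun s => ((he s).ae_iff (p := fun x => 0 < x)
    (measurableSet_setOfPred.1 measurableSet_Ioi)).2 ae_pos_expMeasure_one

lemma memLp_of_hasLaw_exp (he : ∀ s, HasLaw (e s) (expMeasure 1) P) (s : ℕ) :
    MemLp (e s) 2 P := by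
  have h := memLp_id_expMeasure_one
  rw [← (he s).map_eq] at h
  exact (memLp_map_measure_iff (by fun_prop) (he s).aemeasurable).1 h

lemma integral_of_hasLaw_exp (he : ∀ s, HasLaw (e s) (expMeasure 1) P) (s : ℕ) :
    ∫ ω, e s ω ∂P = 1 := by
  rw [(he s).integral_eq, integral_id_expMeasure_one]

lemma ae_tendsto_sum_div (he : ∀ s, HasLaw (e s) (expMeasure 1) P) (hind : iIndepFun e P) :
    ∀ᵐ ω ∂P, Tendsto (fun n : ℕ => (∑ i ∈ Finset.range n, e i ω) / n) atTop (𝓝 1) := by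
  have := hind.isProbabilityMeasure
  have h := strong_law_ae_real e ((memLp_of_hasLaw_exp he 0).integrable (by norm_num))
    (fun i j hij => hind.indepFun hij)
    (fun i => ⟨(he i).aemeasurable, (he 0).aemeasurable, by rw [(he i).map_eq, (he 0).map_eq]⟩)
  rwa [integral_of_hasLaw_exp he 0] at h

lemma integral_sq_sum_sub (he : ∀ s, HasLaw (e s) (expMeasure 1) P) (hind : iIndepFun e P)
    (n : ℕ) : ∫ ω, (∑ i ∈ Finset.range n, e i ω - n) ^ 2 ∂P = n * Var[e 0; P] := by
  have := hind.isProbabilityMeasure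
  have h1 := IndepFun.variance_sum (s := Finset.range n) (X := e) (μ := P)
    (fun i _ => memLp_of_hasLaw_exp he i) (fun i _ j _ hij => hind.indepFun hij)
  have h2 : ∀ i, Var[e i; P] = Var[e 0; P] := fun i => by
    rw [(he i).variance_eq, (he 0).variance_eq]
  rw [Finset.sum_congr rfl (fun i _ => h2 i), Finset.sum_const, Finset.card_range, nsmul_eq_mul,
    variance_eq_integral (Finset.aemeasurable_sum _ fun i _ => (he i).aemeasurable)] at h1
  rw [← h1]
  have h3 : ∫ ω, (∑ i ∈ Finset.range n, e i) ω ∂P = n := by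
    simp only [Finset.sum_apply]
    rw [integral_finsetSum _ fun i _ => (memLp_of_hasLaw_exp he i).integrable (by norm_num)]
    simp [integral_of_hasLaw_exp he]
  rw [h3]
  simp

/-- The fluctuations of the Poisson points are small enough for the series of `zetaCirc`. -/
lemma ae_summable_abs_sum_sub_div (he : ∀ s, HasLaw (e s) (expMeasure 1) P)
    (hind : iIndepFun e P) :
    ∀ᵐ ω ∂P, Summable fun n : ℕ => |∑ i ∈ Finset.range n, e i ω - n| / (n : ℝ) ^ 2 := by
  have := hind.isProbabilityMeasure
  set V := Var[e 0; P]
  have hm : ∀ n : ℕ, AEMeasurable (fun ω => (∑ i ∈ Finset.range n, e i ω - n) ^ 2) P := fun n =>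
    ((Finset.aemeasurable_fun_sum _ fun i _ => (he i).aemeasurable).sub_const _).pow_const 2
  have hint : ∀ n : ℕ, Integrable (fun ω => (∑ i ∈ Finset.range n, e i ω - n) ^ 2) P := fun n => by
    have : MemLp (fun ω => ∑ i ∈ Finset.range n, e i ω - n) 2 P :=
      (memLp_finsetSum _ fun i _ => memLp_of_hasLaw_exp he i).sub (memLp_const _)
    exact this.integrable_sq
  -- the weight `n^{-5/2}` makes the sum of the mean squares `n V` converge
  have hsum : Summable fun n : ℕ => V * (1 / (n : ℝ) ^ (3 / 2 : ℝ)) :=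
    (Real.summable_one_div_nat_rpow.2 (by norm_num)).mul_left V
  have hpow : ∀ n : ℕ, (n : ℝ) / (n : ℝ) ^ (5 / 2 : ℝ) = 1 / (n : ℝ) ^ (3 / 2 : ℝ) := by
    intro n
    rcases Nat.eq_zero_or_pos n with rfl | hn
    · norm_num
    · have hn' : (0 : ℝ) < n := Nat.cast_pos.2 hn
      have : (n : ℝ) ^ (5 / 2 : ℝ) = n * (n : ℝ) ^ (3 / 2 : ℝ) := by
        rw [← Real.rpow_one_add' hn'.le (by norm_num)]; norm_num
      rw [this]; field_simp
  have hl : ∀ n : ℕ, ∫⁻ ω, ENNReal.ofReal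
      ((∑ i ∈ Finset.range n, e i ω - n) ^ 2 / (n : ℝ) ^ (5 / 2 : ℝ)) ∂P
      = ENNReal.ofReal (V * (1 / (n : ℝ) ^ (3 / 2 : ℝ))) := by
    intro n
    rw [← ofReal_integral_eq_lintegral_ofReal ((hint n).div_const _)
      (Eventually.of_forall fun ω => by positivity), integral_div, integral_sq_sum_sub he hind,
      ← hpow]
    congr 1; ring
  have hfin : ∫⁻ ω, ∑' n : ℕ, ENNReal.ofReal
      ((∑ i ∈ Finset.range n, e i ω - n) ^ 2 / (n : ℝ) ^ (5 / 2 : ℝ)) ∂P ≠ ⊤ := by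
    rw [lintegral_tsum fun n => ((hm n).div_const _).ennreal_ofReal]
    simp_rw [hl]
    exact hsum.tsum_ofReal_ne_top
  filter_upwards [ae_lt_top' (AEMeasurable.tsum fun n => ((hm n).div_const _).ennreal_ofReal)
    hfin] with ω hω
  have h1 : Summable fun n : ℕ =>
      (∑ i ∈ Finset.range n, e i ω - n) ^ 2 / (n : ℝ) ^ (5 / 2 : ℝ) := by
    have := ENNReal.summable_toReal hω.ne
    refine this.congr fun n => ?_
    rw [ENNReal.toReal_ofReal (by positivity)]
  have h2 : Summable fun n : ℕ => 1 / (n : ℝ) ^ (3 / 2 : ℝ) :=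
    Real.summable_one_div_nat_rpow.2 (by norm_num)
  refine Summable.of_nonneg_of_le (fun n => by positivity) (fun n => ?_) (h1.add h2)
  rcases Nat.eq_zero_or_pos n with rfl | hn
  · norm_num
  · have hn' : (0 : ℝ) < n := Nat.cast_pos.2 hn
    set d := ∑ i ∈ Finset.range n, e i ω - n
    set a := (n : ℝ) ^ (1 / 2 : ℝ) with ha
    have ha0 : 0 < a := by positivity
    have haa : a ^ 2 = n := by
      rw [ha, ← Real.rpow_natCast, ← Real.rpow_mul hn'.le]; norm_num
    have e1 : (n : ℝ) ^ (5 / 2 : ℝ) = a ^ 5 := by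
      rw [ha, ← Real.rpow_natCast, ← Real.rpow_mul hn'.le]; norm_num
    have e2 : (n : ℝ) ^ (3 / 2 : ℝ) = a ^ 3 := by
      rw [ha, ← Real.rpow_natCast, ← Real.rpow_mul hn'.le]; norm_num
    rw [e1, e2, ← haa]
    have h3 : d ^ 2 / a ^ 5 + 1 / a ^ 3 - |d| / (a ^ 2) ^ 2 = (|d| ^ 2 + a ^ 2 - |d| * a) / a ^ 5 := by
      rw [← sq_abs d]; field_simp
    have h4 : 0 ≤ (|d| ^ 2 + a ^ 2 - |d| * a) / a ^ 5 :=
      div_nonneg (by nlinarith [sq_nonneg (|d| - a), abs_nonneg d]) (by positivity)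
    linarith

theorem ae_summable_zetaTerm (he : ∀ s, HasLaw (e s) (expMeasure 1) P) (hind : iIndepFun e P) :
    ∀ᵐ ω ∂P, Summable fun k => zetaTerm e k ω := by
  filter_upwards [ae_tendsto_sum_div he hind, ae_summable_abs_sum_sub_div he hind] with ω h1 h2
  have h3 : Summable fun k : ℕ =>
      2 * (|∑ i ∈ Finset.range (k + 1), e i ω - (k + 1 : ℕ)| / ((k + 1 : ℕ) : ℝ) ^ 2) :=
    ((summable_nat_add_iff 1).2 h2).mul_left 2
  refine Summable.of_norm_bounded_eventually_nat h3 ?_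
  have h4 := (h1.comp (tendsto_add_atTop_nat 1)).eventually
    (lt_mem_nhds (show (1 / 2 : ℝ) < 1 by norm_num))
  filter_upwards [h4] with k hk
  simp only [Function.comp] at hk
  have hk0 : (0 : ℝ) < ((k + 1 : ℕ) : ℝ) := by positivity
  set G := ∑ i ∈ Finset.range (k + 1), e i ω with hG
  rw [lt_div_iff₀ hk0] at hk
  have hG0 : 0 < G := by nlinarith
  have e1 : zetaTerm e k ω = -(G - (k + 1 : ℕ)) / (G * (k + 1 : ℕ)) := by
    rw [zetaTerm, ← hG]; push_cast; field_simp; ring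
  rw [e1, Real.norm_eq_abs, abs_div, abs_neg, abs_of_pos (a := G * _) (by positivity),
    ← mul_div_assoc, div_le_div_iff₀ (by positivity) (by positivity)]
  have h5 : ((k + 1 : ℕ) : ℝ) ^ 2 ≤ 2 * (G * (k + 1 : ℕ)) := by nlinarith
  nlinarith [abs_nonneg (G - (k + 1 : ℕ))]

end PoissonPoints

section IndependenceSplit

/-- In an independent sequence, one member is independent of the sequence obtained by erasing it. -/
lemma indepFun_update {Ω : Type*} [MeasurableSpace Ω] {P : Measure Ω} {X : ℕ → Ω → ℝ}
    (hm : ∀ i, Measurable (X i)) (hind : iIndepFun X P) (j : ℕ) :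
    IndepFun (fun ω => Function.update (fun i => X i ω) j 0) (X j) P := by
  have h := indep_iSup_of_disjoint (fun i => (hm i).comap_le) hind.iIndep
    (S := {j}ᶜ) (T := {j}) disjoint_compl_left
  rw [IndepFun_iff_Indep]
  refine indep_of_indep_of_le_left (indep_of_indep_of_le_right h ?_) ?_
  · exact le_iSup₂_of_le j rfl le_rfl
  · rw [← measurable_iff_comap_le]
    refine @measurable_pi_lambda Ω ℕ (fun _ => ℝ) (_) _ _ fun i => ?_
    by_cases hi : i = j
    · subst hi
      simp only [Function.update_self]
      exact measurable_const
    · simp only [Function.update_of_ne hi]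
      rw [measurable_iff_comap_le]
      exact le_iSup₂_of_le (f := fun i (_ : i ∈ ({j}ᶜ : Set ℕ)) =>
        MeasurableSpace.comap (X i) inferInstance) i hi le_rfl

end IndependenceSplit

/-! ### The characteristic function of `ζ°` -/

section Transform

/-- `e^{iθ/y} - 1`. -/
noncomputable def expInvSubOne (θ y : ℝ) : ℂ :=
  Complex.exp (Complex.I * ((θ * y⁻¹ : ℝ) : ℂ)) - 1

lemma measurable_expInvSubOne (θ : ℝ) : Measurable (expInvSubOne θ) := by
  unfold expInvSubOne; fun_prop

lemma norm_expInvSubOne_le (θ y : ℝ) : ‖expInvSubOne θ y‖ ≤ 2 :=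
  (norm_sub_le _ _).trans (by rw [Complex.norm_exp_I_mul_ofReal]; norm_num)

lemma intervalIntegrable_expInvSubOne (θ a b : ℝ) :
    IntervalIntegrable (expInvSubOne θ) volume a b :=
  (intervalIntegrable_const (c := (2 : ℝ))).mono_fun
    (measurable_expInvSubOne θ).aestronglyMeasurable
    (Eventually.of_forall fun y => by simpa using norm_expInvSubOne_le θ y)

/-- The function `V` with `V(x) = E [e^{iθ/(x+e)} V(x+e)]` for a standard exponential `e`. It is the
conditional expectation of the compensated functional of the Poisson points
beyond `x`, given that `x` is one of the points. -/
noncomputable def poissonTransform (θ x : ℝ) : ℂ :=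
  Complex.exp (levyExponent θ - ∫ y in (0 : ℝ)..x, expInvSubOne θ y)

lemma poissonTransform_zero (θ : ℝ) : poissonTransform θ 0 = Complex.exp (levyExponent θ) := by
  simp [poissonTransform]

lemma continuous_poissonTransform (θ : ℝ) : Continuous (poissonTransform θ) :=
  Complex.continuous_exp.comp (continuous_const.sub
    (intervalIntegral.continuous_primitive (intervalIntegrable_expInvSubOne θ) 0))

lemma hasDerivAt_poissonTransform (θ : ℝ) {x : ℝ} (hx : 0 < x) :
    HasDerivAt (poissonTransform θ) (-(expInvSubOne θ x * poissonTransform θ x)) x := by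
  have hc : ContinuousAt (expInvSubOne θ) x := by
    unfold expInvSubOne
    have : ContinuousAt (fun y : ℝ => θ * y⁻¹) x := (continuousAt_inv₀ hx.ne').const_mul θ
    exact (Complex.continuous_exp.continuousAt.comp
      ((Complex.continuous_ofReal.continuousAt.comp this).const_mul Complex.I)).sub_const 1
  have h := intervalIntegral.integral_hasDerivAt_right (intervalIntegrable_expInvSubOne θ 0 x)
    (measurable_expInvSubOne θ).stronglyMeasurable.stronglyMeasurableAtFilter hc
  have h2 := (h.const_sub (levyExponent θ)).cexp
  exact h2.congr_deriv (by rw [poissonTransform]; ring)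

lemma integral_expInvSubOne_eq (θ : ℝ) {x : ℝ} (hx : 1 ≤ x) :
    ∫ y in (0 : ℝ)..x, expInvSubOne θ y
      = (∫ y in (0 : ℝ)..x, levyKernel θ y⁻¹) + Complex.I * ((θ * Real.log x : ℝ) : ℂ) := by
  have hx0 : 0 < x := lt_of_lt_of_le one_pos hx
  have hL : ∀ a b : ℝ, 0 ≤ a → a ≤ b → IntervalIntegrable (fun y => levyKernel θ y⁻¹) volume a b :=
    fun a b ha hab => (intervalIntegrable_iff_integrableOn_Ioc_of_le hab).2
      ((integrableOn_levyKernel_inv θ).mono_set fun y hy => ha.trans_lt hy.1)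
  rw [← intervalIntegral.integral_add_adjacent_intervals
      (intervalIntegrable_expInvSubOne θ 0 1) (intervalIntegrable_expInvSubOne θ 1 x),
    ← intervalIntegral.integral_add_adjacent_intervals (hL 0 1 le_rfl zero_le_one)
      (hL 1 x zero_le_one hx), add_assoc]
  congr 1
  · refine intervalIntegral.integral_congr_ae (Eventually.of_forall fun y hy => ?_)
    rw [Set.uIoc_of_le zero_le_one] at hy
    have : ¬ y⁻¹ < 1 := not_lt.2 ((one_le_inv₀ hy.1).2 hy.2)
    rw [levyKernel, if_neg this, sub_zero, expInvSubOne]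
  · have h1 : ∫ y in (1 : ℝ)..x, Complex.I * ((θ * y⁻¹ : ℝ) : ℂ)
        = Complex.I * ((θ * Real.log x : ℝ) : ℂ) := by
      rw [intervalIntegral.integral_const_mul, intervalIntegral.integral_ofReal,
        intervalIntegral.integral_const_mul, integral_inv_of_pos one_pos hx0, div_one]
    have hinv : IntervalIntegrable (fun y : ℝ => Complex.I * ((θ * y⁻¹ : ℝ) : ℂ)) volume 1 x := by
      refine ContinuousOn.intervalIntegrable ?_
      rw [Set.uIcc_of_le hx]
      refine continuousOn_const.mul (Complex.continuous_ofReal.comp_continuousOn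
        (continuousOn_const.mul (continuousOn_inv₀.mono fun y hy => ?_)))
      exact (lt_of_lt_of_le one_pos hy.1).ne'
    rw [← h1, ← intervalIntegral.integral_add (hL 1 x zero_le_one hx) hinv]
    refine intervalIntegral.integral_congr_ae (Eventually.of_forall fun y hy => ?_)
    rw [Set.uIoc_of_le hx] at hy
    have hlt : y⁻¹ < 1 := inv_lt_one_of_one_lt₀ hy.1
    rw [levyKernel, if_pos hlt, expInvSubOne]
    ring

lemma poissonTransform_mul_eq (θ : ℝ) {x : ℝ} (hx : 1 ≤ x) :
    poissonTransform θ x * Complex.exp (Complex.I * ((θ * Real.log x : ℝ) : ℂ))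
      = Complex.exp (levyExponent θ - ∫ y in (0 : ℝ)..x, levyKernel θ y⁻¹) := by
  rw [poissonTransform, integral_expInvSubOne_eq θ hx, ← Complex.exp_add]
  congr 1; ring

lemma tendsto_poissonTransform_mul (θ : ℝ) :
    Tendsto (fun x : ℝ => poissonTransform θ x *
      Complex.exp (Complex.I * ((θ * Real.log x : ℝ) : ℂ))) atTop (𝓝 1) := by
  have h1 := intervalIntegral_tendsto_integral_Ioi (0 : ℝ) (integrableOn_levyKernel_inv θ)
    (tendsto_id (α := ℝ) (x := atTop))
  have h2 := (Complex.continuous_exp.tendsto _).comp (h1.const_sub (levyExponent θ))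
  rw [levyExponent, sub_self, Complex.exp_zero] at h2
  refine h2.congr' ?_
  filter_upwards [eventually_ge_atTop 1] with x hx
  rw [poissonTransform_mul_eq θ hx]
  rfl

lemma exists_norm_poissonTransform_le (θ : ℝ) :
    ∃ M : ℝ, ∀ x, 0 ≤ x → ‖poissonTransform θ x‖ ≤ M := by
  have h1 := ((tendsto_poissonTransform_mul θ).norm).eventually
    (gt_mem_nhds (show ‖(1 : ℂ)‖ < 2 by simp))
  obtain ⟨A, hA⟩ := eventually_atTop.1 h1
  obtain ⟨M, hM⟩ := (isCompact_Icc (a := (0 : ℝ)) (b := A)).exists_bound_of_continuousOn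
    (continuous_poissonTransform θ).continuousOn
  refine ⟨max M 2, fun x hx => ?_⟩
  rcases le_total x A with h | h
  · exact (hM x ⟨hx, h⟩).trans (le_max_left _ _)
  · have := (hA x h).le
    rw [norm_mul, Complex.norm_exp_I_mul_ofReal, mul_one] at this
    exact this.trans (le_max_right _ _)

/-- The renewal identity of `poissonTransform`. The integrand is the derivative of
`-e^{-y} V(y)` because `V' = -(e^{iθ/y} - 1) V`. -/
lemma integral_exp_mul_poissonTransform (θ : ℝ) {x : ℝ} (hx : 0 ≤ x) :
    ∫ u, Complex.exp (Complex.I * ((θ * (x + u)⁻¹ : ℝ) : ℂ)) * poissonTransform θ (x + u)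
      ∂(expMeasure 1) = poissonTransform θ x := by
  obtain ⟨M, hM⟩ := exists_norm_poissonTransform_le θ
  have hM0 : 0 ≤ M := (norm_nonneg _).trans (hM 0 le_rfl)
  set f : ℝ → ℂ := fun y =>
    Complex.exp (Complex.I * ((θ * y⁻¹ : ℝ) : ℂ)) * poissonTransform θ y with hf
  have hfm : Measurable f := by
    have := (continuous_poissonTransform θ).measurable
    fun_prop
  have hfb : ∀ y, 0 ≤ y → ‖f y‖ ≤ M := fun y hy => by
    rw [hf, norm_mul, Complex.norm_exp_I_mul_ofReal, one_mul]; exact hM y hy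
  rw [integral_expMeasure_one]
  set G : ℝ → ℂ := fun y => -(Real.exp (-(y - x)) • poissonTransform θ y) with hG
  have hGc : Continuous G := by
    have := continuous_poissonTransform θ
    fun_prop
  have hGd : ∀ y ∈ Set.Ioi x, HasDerivAt G (Real.exp (-(y - x)) • f y) y := by
    intro y hy
    have hy0 : 0 < y := hx.trans_lt hy
    have h1 : HasDerivAt (fun y : ℝ => Real.exp (-(y - x))) (Real.exp (-(y - x)) * (-1)) y :=
      ((hasDerivAt_id y).sub_const x).fun_neg.exp
    have h2 := (h1.smul (hasDerivAt_poissonTransform θ hy0)).fun_neg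
    refine h2.congr_deriv ?_
    simp only [hf, expInvSubOne, Complex.real_smul]
    push_cast; ring
  have hexpi : IntegrableOn (fun y : ℝ => Real.exp (-(y - x)) * M) (Set.Ioi x) := by
    have h1 : IntegrableOn (fun y : ℝ => Real.exp (-y)) (Set.Ioi x) := integrableOn_exp_neg_Ioi x
    have h2 := (h1.mul_const (Real.exp x * M))
    refine h2.congr (Eventually.of_forall fun y => ?_)
    simp only
    rw [neg_sub, sub_eq_add_neg, Real.exp_add]; ring
  have hGi : IntegrableOn (fun y => Real.exp (-(y - x)) • f y) (Set.Ioi x) := by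
    refine Integrable.mono' hexpi ?_ ?_
    · have hexpm : Measurable fun y : ℝ => Real.exp (-(y - x)) := by fun_prop
      exact (hexpm.smul hfm).aestronglyMeasurable
    · filter_upwards [ae_restrict_mem measurableSet_Ioi] with y hy
      rw [norm_smul, Real.norm_of_nonneg (Real.exp_pos _).le]
      gcongr
      exact hfb y (hx.trans (le_of_lt hy))
  have hGl : Tendsto G atTop (𝓝 0) := by
    have h1 : Tendsto (fun y : ℝ => Real.exp (-(y - x)) * M) atTop (𝓝 (0 * M)) := by
      refine Tendsto.mul_const M (Real.tendsto_exp_neg_atTop_nhds_zero.comp ?_)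
      exact tendsto_atTop_add_const_right _ (-x) tendsto_id
    rw [zero_mul] at h1
    refine squeeze_zero_norm' ?_ h1
    filter_upwards [eventually_ge_atTop 0] with y hy
    rw [hG, norm_neg, norm_smul, Real.norm_of_nonneg (Real.exp_pos _).le]
    gcongr
    exact hM y hy
  have hFTC := integral_Ioi_of_hasDerivAt_of_tendsto hGc.continuousWithinAt hGd hGi hGl
  have hshift : ∫ u in Set.Ioi (0 : ℝ), Real.exp (-u) • f (x + u)
      = ∫ y in Set.Ioi x, Real.exp (-(y - x)) • f y := by
    have h := (measurePreserving_add_left volume x).setIntegral_preimage_emb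
      (measurableEmbedding_addLeft x) (fun y => Real.exp (-(y - x)) • f y) (Set.Ioi x)
    have hpre : (fun u => x + u) ⁻¹' Set.Ioi x = Set.Ioi 0 := by ext u; simp
    rw [hpre] at h
    rw [← h]
    simp only [add_sub_cancel_left]
  rw [hshift, hFTC, hG]
  simp

end Transform

section Martingale

variable {Ω : Type*} [MeasurableSpace Ω] {P : Measure Ω} {e : ℕ → Ω → ℝ}

/-- The `k`-th Poisson point, as a function of the sequence of spacings. -/
noncomputable def pointSum (k : ℕ) (x : ℕ → ℝ) : ℝ := ∑ s ∈ Finset.range k, x s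

/-- The sum of the reciprocals of the first `k` Poisson points. -/
noncomputable def invPointSum (k : ℕ) (x : ℕ → ℝ) : ℝ :=
  ∑ j ∈ Finset.range k, (pointSum (j + 1) x)⁻¹

@[fun_prop]
lemma measurable_pointSum (k : ℕ) : Measurable (pointSum k) := by
  unfold pointSum; fun_prop

@[fun_prop]
lemma measurable_invPointSum (k : ℕ) : Measurable (invPointSum k) := by
  unfold invPointSum; fun_prop

lemma pointSum_update (k : ℕ) (x : ℕ → ℝ) : pointSum k (Function.update x k 0) = pointSum k x :=
  Finset.sum_congr rfl fun _ hs => Function.update_of_ne (Finset.mem_range.1 hs).ne _ _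

lemma invPointSum_update (k : ℕ) (x : ℕ → ℝ) :
    invPointSum k (Function.update x k 0) = invPointSum k x := by
  refine Finset.sum_congr rfl fun j hj => congrArg _ (Finset.sum_congr rfl fun s hs => ?_)
  have h1 := Finset.mem_range.1 hj
  have h2 := Finset.mem_range.1 hs
  exact Function.update_of_ne (by omega) _ _

/-- The martingale `exp (iθ ∑_{j ≤ k} 1/Γ_j) V(Γ_k)`. -/
noncomputable def pointMartingale (θ : ℝ) (k : ℕ) (x : ℕ → ℝ) : ℂ :=
  Complex.exp (Complex.I * ((θ * invPointSum k x : ℝ) : ℂ)) * poissonTransform θ (pointSum k x)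

lemma measurable_pointMartingale (θ : ℝ) (k : ℕ) : Measurable (pointMartingale θ k) := by
  have := (continuous_poissonTransform θ).measurable
  unfold pointMartingale
  fun_prop

lemma integral_pointMartingale_succ (hm : ∀ s, Measurable (e s))
    (he : ∀ s, HasLaw (e s) (expMeasure 1) P) (hind : iIndepFun e P) (θ : ℝ) (k : ℕ) :
    ∫ ω, pointMartingale θ (k + 1) (fun s => e s ω) ∂P
      = ∫ ω, pointMartingale θ k (fun s => e s ω) ∂P := by
  have := hind.isProbabilityMeasure
  obtain ⟨M, hM⟩ := exists_norm_poissonTransform_le θ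
  set U : Ω → ℕ → ℝ := fun ω => Function.update (fun s => e s ω) k 0 with hU
  have hUm : Measurable U := by
    refine measurable_pi_lambda _ fun i => ?_
    by_cases hi : i = k
    · subst hi; simp only [hU, Function.update_self]; exact measurable_const
    · simp only [hU, Function.update_of_ne hi]; exact hm i
  have hlaw : P.map (fun ω => (U ω, e k ω)) = (P.map U).prod (expMeasure 1) := by
    rw [← (he k).map_eq]
    exact (indepFun_iff_map_prod_eq_prod_map_map hUm.aemeasurable (hm k).aemeasurable).1
      (indepFun_update hm hind k)
  set Φ : (ℕ → ℝ) × ℝ → ℂ := fun z =>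
    Complex.exp (Complex.I * ((θ * invPointSum k z.1 : ℝ) : ℂ)) *
      (Complex.exp (Complex.I * ((θ * (pointSum k z.1 + z.2)⁻¹ : ℝ) : ℂ)) *
        poissonTransform θ (pointSum k z.1 + z.2)) with hΦ
  have hΦm : Measurable Φ := by
    have := (continuous_poissonTransform θ).measurable
    fun_prop
  have h1 : ∀ ω, pointMartingale θ (k + 1) (fun s => e s ω) = Φ (U ω, e k ω) := by
    intro ω
    simp only [hΦ, hU, pointSum_update, invPointSum_update, pointMartingale]
    have e1 : pointSum (k + 1) (fun s => e s ω) = pointSum k (fun s => e s ω) + e k ω := by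
      rw [pointSum, Finset.sum_range_succ]; rfl
    have e2 : invPointSum (k + 1) (fun s => e s ω)
        = invPointSum k (fun s => e s ω) + (pointSum k (fun s => e s ω) + e k ω)⁻¹ := by
      rw [invPointSum, Finset.sum_range_succ, ← e1]; rfl
    rw [e1, e2, ← mul_assoc, ← Complex.exp_add]
    congr 2; push_cast; ring
  have hpos : ∀ᵐ x ∂(P.map U), 0 ≤ pointSum k x := by
    rw [ae_map_iff hUm.aemeasurable (measurableSet_le measurable_const (by fun_prop))]
    filter_upwards [ae_pos_of_hasLaw_exp he] with ω hω
    simp only [hU, pointSum_update]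
    exact Finset.sum_nonneg fun s _ => (hω s).le
  have hprob : IsProbabilityMeasure (P.map U) := Measure.isProbabilityMeasure_map hUm.aemeasurable
  have hΦi : Integrable Φ ((P.map U).prod (expMeasure 1)) := by
    refine Integrable.of_bound hΦm.aestronglyMeasurable M ?_
    rw [Measure.ae_prod_iff_ae_ae (measurableSet_le hΦm.norm measurable_const)]
    filter_upwards [hpos] with x hx
    filter_upwards [ae_pos_expMeasure_one] with u hu
    simp only [hΦ]
    rw [norm_mul, norm_mul, Complex.norm_exp_I_mul_ofReal, Complex.norm_exp_I_mul_ofReal, one_mul,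
      one_mul]
    exact hM _ (by positivity)
  simp_rw [h1]
  rw [← integral_map (φ := fun ω => (U ω, e k ω)) (f := Φ) (hUm.prodMk (hm k)).aemeasurable
    hΦm.aestronglyMeasurable, hlaw, integral_prod _ hΦi]
  have h2 : ∀ᵐ x ∂(P.map U), ∫ u, Φ (x, u) ∂(expMeasure 1) = pointMartingale θ k x := by
    filter_upwards [hpos] with x hx
    simp only [hΦ]
    rw [integral_const_mul, integral_exp_mul_poissonTransform θ hx, pointMartingale]
  rw [integral_congr_ae h2, integral_map hUm.aemeasurable
    (measurable_pointMartingale θ k).aestronglyMeasurable]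
  refine integral_congr_ae (Eventually.of_forall fun ω => ?_)
  simp only [hU, pointMartingale, pointSum_update, invPointSum_update]

lemma integral_pointMartingale (hm : ∀ s, Measurable (e s))
    (he : ∀ s, HasLaw (e s) (expMeasure 1) P) (hind : iIndepFun e P) (θ : ℝ) (k : ℕ) :
    ∫ ω, pointMartingale θ k (fun s => e s ω) ∂P = Complex.exp (levyExponent θ) := by
  have := hind.isProbabilityMeasure
  induction k with
  | zero => simp [pointMartingale, invPointSum, pointSum, poissonTransform_zero]
  | succ k ih => rw [integral_pointMartingale_succ hm he hind, ih]

lemma measurable_zetaCirc (hm : ∀ s, Measurable (e s)) : Measurable (zetaCirc e) := by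
  unfold zetaCirc zetaTerm
  exact (Measurable.tsum fun k => by fun_prop).add_const _

/-- The characteristic function of `ζ°`, as the limit of the constant means of the martingale. -/
theorem charFun_zetaCirc (hm : ∀ s, Measurable (e s))
    (he : ∀ s, HasLaw (e s) (expMeasure 1) P) (hind : iIndepFun e P) (θ : ℝ) :
    charFun (P.map (zetaCirc e)) θ = Complex.exp (levyExponent θ) := by
  have := hind.isProbabilityMeasure
  obtain ⟨M, hM⟩ := exists_norm_poissonTransform_le θ
  have hlim : Tendsto (fun k => ∫ ω, pointMartingale θ k (fun s => e s ω) ∂P) atTop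
      (𝓝 (∫ ω, Complex.exp (Complex.I * ((θ * zetaCirc e ω : ℝ) : ℂ)) ∂P)) := by
    refine tendsto_integral_of_dominated_convergence (fun _ => M) (fun k => ?_)
      (integrable_const _) (fun k => ?_) ?_
    · exact ((measurable_pointMartingale θ k).comp
        (measurable_pi_lambda _ hm)).aestronglyMeasurable
    · filter_upwards [ae_pos_of_hasLaw_exp he] with ω hω
      rw [pointMartingale, norm_mul, Complex.norm_exp_I_mul_ofReal, one_mul]
      exact hM _ (Finset.sum_nonneg fun s _ => (hω s).le)
    · filter_upwards [ae_tendsto_sum_div he hind, ae_summable_zetaTerm he hind] with ω h1 h2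
      set Γ : ℕ → ℝ := fun k => pointSum k (fun s => e s ω) with hΓ
      have hΓdiv : Tendsto (fun k : ℕ => Γ k / k) atTop (𝓝 1) := h1
      have hΓinf : Tendsto Γ atTop atTop := by
        have := hΓdiv.pos_mul_atTop one_pos (tendsto_natCast_atTop_atTop (R := ℝ))
        refine this.congr' ?_
        filter_upwards [eventually_gt_atTop 0] with k hk
        have : (k : ℝ) ≠ 0 := by positivity
        rw [div_mul_cancel₀ _ this]
      have hV := (tendsto_poissonTransform_mul θ).comp hΓinf
      have hlog : Tendsto (fun k : ℕ => Real.log (Γ k / k)) atTop (𝓝 0) := by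
        have := hΓdiv.log one_ne_zero
        rwa [Real.log_one] at this
      have hz : Tendsto (fun k => invPointSum k (fun s => e s ω) - Real.log (Γ k)) atTop
          (𝓝 (zetaCirc e ω)) := by
        have h3 := (h2.hasSum.tendsto_sum_nat.add Real.tendsto_harmonic_sub_log).sub hlog
        rw [sub_zero] at h3
        refine h3.congr' ?_
        filter_upwards [eventually_gt_atTop 0, hΓinf.eventually_gt_atTop 0] with k hk hΓk
        have hk' : (k : ℝ) ≠ 0 := by positivity
        rw [Real.log_div hΓk.ne' hk', harmonic]
        simp only [zetaTerm, Finset.sum_sub_distrib, invPointSum, pointSum, one_div]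
        push_cast
        ring
      have hc : Continuous fun z : ℝ => Complex.exp (Complex.I * ((θ * z : ℝ) : ℂ)) := by fun_prop
      have h4 := ((hc.tendsto _).comp hz).mul hV
      rw [mul_one] at h4
      refine h4.congr fun k => ?_
      simp only [Function.comp, pointMartingale]
      rw [mul_comm (poissonTransform θ (Γ k)), ← mul_assoc, ← Complex.exp_add]
      congr 2; push_cast; ring
  simp_rw [integral_pointMartingale hm he hind] at hlim
  rw [tendsto_nhds_unique tendsto_const_nhds hlim, charFun_apply_real,
    integral_map (measurable_zetaCirc hm).aemeasurable (by fun_prop)]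
  refine integral_congr_ae (Eventually.of_forall fun ω => ?_)
  simp only
  congr 1; push_cast; ring

end Martingale

/-! ### Regularity of the laws -/

section ShiftedSeries

variable {R : ℕ → ℝ}

/-- The series `∑_k [1/(x + R_k) - 1/(k+1)]`: the limit variable `ζ° - γ` as a function of its first
spacing `x`, with the later spacings fixed. -/
noncomputable def shiftedSeries (R : ℕ → ℝ) (x : ℝ) : ℝ :=
  ∑' k : ℕ, ((x + R k)⁻¹ - 1 / ((k : ℝ) + 1))

lemma shiftedSeries_sub (hS : ∀ x, 0 < x → Summable fun k : ℕ => (x + R k)⁻¹ - 1 / ((k : ℝ) + 1))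
    {x y : ℝ} (hx : 0 < x) (hy : 0 < y) :
    HasSum (fun k => (x + R k)⁻¹ - (y + R k)⁻¹) (shiftedSeries R x - shiftedSeries R y) := by
  refine ((hS x hx).hasSum.sub (hS y hy).hasSum).congr_fun fun k => ?_
  ring

lemma strictAntiOn_shiftedSeries (hR : ∀ k, 0 ≤ R k)
    (hS : ∀ x, 0 < x → Summable fun k : ℕ => (x + R k)⁻¹ - 1 / ((k : ℝ) + 1)) :
    StrictAntiOn (shiftedSeries R) (Set.Ioi 0) := by
  intro x hx y hy hxy
  have hx : (0 : ℝ) < x := hx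
  have hle : ∀ k, (y + R k)⁻¹ < (x + R k)⁻¹ := fun k => by
    have := hR k
    gcongr
  exact Summable.tsum_lt_tsum (i := 0) (fun k => sub_le_sub_right (hle k).le _)
    (sub_lt_sub_right (hle 0) _) (hS y hy) (hS x hx)

lemma continuousOn_shiftedSeries (hR : ∀ k, 0 ≤ R k)
    (hS : ∀ x, 0 < x → Summable fun k : ℕ => (x + R k)⁻¹ - 1 / ((k : ℝ) + 1)) :
    ContinuousOn (shiftedSeries R) (Set.Ioi 0) := by
  intro x₀ hx₀
  have hx₀ : (0 : ℝ) < x₀ := hx₀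
  set a := x₀ / 2 with ha
  have ha0 : 0 < a := by positivity
  have hsq : Summable fun k => ((a + R k) ^ 2)⁻¹ := by
    have h1 := ((shiftedSeries_sub hS ha0 (show 0 < 2 * a by positivity)).summable).mul_left (2 / a)
    refine Summable.of_nonneg_of_le (fun k => by positivity) (fun k => ?_) h1
    have := hR k
    have e1 : 2 / a * ((a + R k)⁻¹ - (2 * a + R k)⁻¹) = 2 / ((a + R k) * (2 * a + R k)) := by
      field_simp; ring
    rw [e1, inv_eq_one_div, div_le_div_iff₀ (by positivity) (by positivity)]
    nlinarith
  set C := ∑' k, ((a + R k) ^ 2)⁻¹ with hC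
  have hlip : ∀ x, a ≤ x → |shiftedSeries R x - shiftedSeries R x₀| ≤ |x - x₀| * C := by
    intro x hx
    have hx0 : 0 < x := ha0.trans_le hx
    have h1 := shiftedSeries_sub hS hx0 hx₀
    have h2 : ∀ k, ‖(x + R k)⁻¹ - (x₀ + R k)⁻¹‖ ≤ |x - x₀| * ((a + R k) ^ 2)⁻¹ := by
      intro k
      have := hR k
      have e1 : (x + R k)⁻¹ - (x₀ + R k)⁻¹ = -(x - x₀) * ((x + R k) * (x₀ + R k))⁻¹ := by
        field_simp; ring
      rw [e1, norm_mul, norm_neg, Real.norm_eq_abs, Real.norm_of_nonneg (by positivity), sq]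
      gcongr
      linarith
    rw [← h1.tsum_eq, hC, ← tsum_mul_left]
    exact tsum_of_norm_bounded (hsq.mul_left _).hasSum h2
  refine ContinuousAt.continuousWithinAt ?_
  rw [ContinuousAt, tendsto_iff_norm_sub_tendsto_zero]
  have hlim : Tendsto (fun x => |x - x₀| * C) (𝓝 x₀) (𝓝 (|x₀ - x₀| * C)) := by
    have : Continuous fun x => |x - x₀| * C := by fun_prop
    exact this.tendsto x₀
  rw [sub_self, abs_zero, zero_mul] at hlim
  refine squeeze_zero' (Eventually.of_forall fun x => norm_nonneg _) ?_ hlim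
  filter_upwards [lt_mem_nhds (show a < x₀ by linarith)] with x hx using hlip x hx.le

/-- The function `shiftedSeries R` is onto: it is unbounded above near `0` because of the
term with `R_0 = 0`, and unbounded below because the harmonic series diverges. -/
lemma exists_shiftedSeries_eq (hR0 : R 0 = 0) (hR : ∀ k, 0 ≤ R k)
    (hS : ∀ x, 0 < x → Summable fun k : ℕ => (x + R k)⁻¹ - 1 / ((k : ℝ) + 1)) (m : ℝ) :
    ∃ x, 0 < x ∧ shiftedSeries R x = m := by
  have hup : ∃ x ∈ Set.Ioi (0 : ℝ), m ≤ shiftedSeries R x := by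
    set c := |m - shiftedSeries R 1| + 1 with hc
    have hc1 : 1 ≤ c := by rw [hc]; linarith [abs_nonneg (m - shiftedSeries R 1)]
    have hle : (1 + c)⁻¹ ≤ 1 := inv_le_one_of_one_le₀ (by linarith)
    have hp : 0 < (1 + c)⁻¹ := inv_pos.2 (by linarith)
    refine ⟨(1 + c)⁻¹, hp, ?_⟩
    have h1 := shiftedSeries_sub hS hp one_pos
    have h2 := le_hasSum h1 0 fun k _ => by
      have := hR k
      rw [sub_nonneg]
      gcongr
    rw [hR0, add_zero, inv_inv, add_zero, inv_one] at h2
    have := le_abs_self (m - shiftedSeries R 1)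
    linarith
  have hdown : ∃ x ∈ Set.Ioi (0 : ℝ), shiftedSeries R x ≤ m := by
    by_contra! hcon
    have hbound : ∀ N : ℕ, ∑ k ∈ Finset.range N, (1 + R k)⁻¹ ≤ shiftedSeries R 1 - m := by
      intro N
      have hlim : Tendsto (fun x : ℝ => ∑ k ∈ Finset.range N, ((1 + R k)⁻¹ - (x + R k)⁻¹)) atTop
          (𝓝 (∑ k ∈ Finset.range N, ((1 + R k)⁻¹ - 0))) :=
        tendsto_finsetSum _ fun k _ => tendsto_const_nhds.sub
          (tendsto_inv_atTop_zero.comp (tendsto_atTop_add_const_right _ _ tendsto_id))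
      simp only [sub_zero] at hlim
      refine le_of_tendsto hlim ?_
      filter_upwards [eventually_ge_atTop 1] with x hx
      have hx0 : 0 < x := one_pos.trans_le hx
      have h1 := shiftedSeries_sub hS one_pos hx0
      have h2 := sum_le_hasSum (Finset.range N) (fun k _ => by
        have := hR k
        rw [sub_nonneg]
        gcongr) h1
      linarith [hcon x hx0]
    have h1 : Summable fun k => (1 + R k)⁻¹ :=
      summable_of_sum_range_le (fun k => by have := hR k; positivity) hbound
    have h2 : Summable fun k : ℕ => 1 / ((k : ℝ) + 1) :=
      (h1.sub (hS 1 one_pos)).congr fun k => by ring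
    have h3 := (summable_nat_add_iff (f := fun k : ℕ => 1 / (k : ℝ)) 1).1 (by simpa using h2)
    exact Real.not_summable_one_div_natCast h3
  obtain ⟨x, hx, hxm⟩ := hup
  obtain ⟨y, hy, hym⟩ := hdown
  obtain ⟨z, hz, hzm⟩ := isPreconnected_Ioi.intermediate_value hy hx
    (continuousOn_shiftedSeries hR hS) ⟨hym, hxm⟩
  exact ⟨z, hz, hzm⟩

lemma summable_shifted_of_summable {x₀ : ℝ} (hx₀ : 0 < x₀) (hR : ∀ k, 0 ≤ R k)
    (hgrow : ∀ᶠ k : ℕ in atTop, ((k : ℝ) + 1) / 2 ≤ R k)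
    (hS : Summable fun k : ℕ => (x₀ + R k)⁻¹ - 1 / ((k : ℝ) + 1)) {x : ℝ} (hx : 0 < x) :
    Summable fun k : ℕ => (x + R k)⁻¹ - 1 / ((k : ℝ) + 1) := by
  have h1 : Summable fun k : ℕ => (x + R k)⁻¹ - (x₀ + R k)⁻¹ := by
    have h2 : Summable fun k : ℕ => 4 * |x - x₀| * (1 / ((k : ℝ) + 1) ^ 2) := by
      refine Summable.mul_left _ ?_
      have := (summable_nat_add_iff 1).2 (Real.summable_one_div_nat_pow.2 one_lt_two)
      simpa using this
    refine Summable.of_norm_bounded_eventually_nat h2 ?_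
    filter_upwards [hgrow] with k hk
    have := hR k
    have hk0 : (0 : ℝ) < (k : ℝ) + 1 := by positivity
    have e1 : (x + R k)⁻¹ - (x₀ + R k)⁻¹ = -(x - x₀) * ((x + R k) * (x₀ + R k))⁻¹ := by
      field_simp; ring
    have e2 : ((k : ℝ) + 1) / 2 * (((k : ℝ) + 1) / 2) ≤ (x + R k) * (x₀ + R k) := by
      gcongr <;> linarith
    rw [e1, norm_mul, norm_neg, Real.norm_eq_abs, Real.norm_of_nonneg (by positivity)]
    calc |x - x₀| * ((x + R k) * (x₀ + R k))⁻¹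
        ≤ |x - x₀| * (((k : ℝ) + 1) / 2 * (((k : ℝ) + 1) / 2))⁻¹ := by gcongr
      _ = _ := by field_simp; norm_num
  exact (h1.add hS).congr fun k => by ring

end ShiftedSeries

section LimitLaw

variable {Ω : Type*} [MeasurableSpace Ω] {P : Measure Ω} {e : ℕ → Ω → ℝ}

/-- The values `Γ_{k+1} - e_0` determined by the spacings after the first one. -/
noncomputable def tailPoints (r : ℕ → ℝ) (k : ℕ) : ℝ := pointSum (k + 1) r

lemma tailPoints_update (x : ℕ → ℝ) (k : ℕ) :
    x 0 + tailPoints (Function.update x 0 0) k = pointSum (k + 1) x := by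
  simp only [tailPoints, pointSum, Finset.sum_range_succ', Function.update_self, add_zero]
  rw [add_comm]
  simp

lemma zetaCirc_eq_shiftedSeries {Ω : Type*} {e : ℕ → Ω → ℝ} (ω : Ω) :
    zetaCirc e ω = shiftedSeries (tailPoints (Function.update (fun s => e s ω) 0 0)) (e 0 ω)
      + Real.eulerMascheroniConstant := by
  unfold zetaCirc shiftedSeries zetaTerm
  congr 2
  ext k
  rw [tailPoints_update (fun s => e s ω) k, pointSum]

lemma ae_tailPoints (he : ∀ s, HasLaw (e s) (expMeasure 1) P) (hind : iIndepFun e P) :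
    ∀ᵐ ω ∂P, (∀ k, 0 ≤ tailPoints (Function.update (fun s => e s ω) 0 0) k) ∧
      ∀ x, 0 < x → Summable fun k : ℕ =>
        (x + tailPoints (Function.update (fun s => e s ω) 0 0) k)⁻¹ - 1 / ((k : ℝ) + 1) := by
  filter_upwards [ae_pos_of_hasLaw_exp he, ae_tendsto_sum_div he hind,
    ae_summable_zetaTerm he hind] with ω h1 h2 h3
  have hR : ∀ k, 0 ≤ tailPoints (Function.update (fun s => e s ω) 0 0) k := fun k => by
    unfold tailPoints pointSum
    refine Finset.sum_nonneg fun s _ => ?_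
    by_cases hs : s = 0
    · subst hs; simp
    · rw [Function.update_of_ne hs]; exact (h1 s).le
  refine ⟨hR, fun x hx => summable_shifted_of_summable (h1 0) hR ?_ ?_ hx⟩
  · have h4 : Tendsto (fun k : ℕ => (∑ i ∈ Finset.range (k + 1), e i ω) / ((k + 1 : ℕ) : ℝ)
        - e 0 ω / ((k + 1 : ℕ) : ℝ)) atTop (𝓝 (1 - 0)) :=
      ((h2.comp (tendsto_add_atTop_nat 1))).sub
        (tendsto_const_nhds.div_atTop
          (tendsto_natCast_atTop_atTop.comp (tendsto_add_atTop_nat 1)))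
    filter_upwards [h4.eventually (lt_mem_nhds (show (1 / 2 : ℝ) < 1 - 0 by norm_num))] with k hk
    have hk0 : (0 : ℝ) < ((k + 1 : ℕ) : ℝ) := by positivity
    have h5 := tailPoints_update (fun s => e s ω) k
    rw [pointSum] at h5
    rw [← sub_div, lt_div_iff₀ hk0] at hk
    push_cast at hk
    linarith
  · refine h3.congr fun k => ?_
    rw [tailPoints_update (fun s => e s ω) k, pointSum, zetaTerm]

lemma measurable_update_sequence {X : ℕ → Ω → ℝ} (hm : ∀ s, Measurable (X s)) (j : ℕ) :
    Measurable fun ω => Function.update (fun s => X s ω) j (0 : ℝ) := by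
  refine measurable_pi_lambda _ fun i => ?_
  by_cases hi : i = j
  · subst hi; simp only [Function.update_self]; exact measurable_const
  · simp only [Function.update_of_ne hi]; exact hm i

/-- Conditioning on all the members of an independent sequence but one: an event is null if and
only if almost all its sections are. -/
lemma measure_eq_zero_iff_sections {X : ℕ → Ω → ℝ} {μ : Measure ℝ} [IsProbabilityMeasure μ]
    (hm : ∀ s, Measurable (X s)) (hind : iIndepFun X P) (j : ℕ) (hX : HasLaw (X j) μ P)
    {A : Set ((ℕ → ℝ) × ℝ)} (hA : MeasurableSet A) :
    P {ω | (Function.update (fun s => X s ω) j 0, X j ω) ∈ A} = 0 ↔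
      ∀ᵐ ω ∂P, μ {x | (Function.update (fun s => X s ω) j 0, x) ∈ A} = 0 := by
  have := hind.isProbabilityMeasure
  have hUm := measurable_update_sequence hm j
  have hlaw := (indepFun_iff_map_prod_eq_prod_map_map hUm.aemeasurable (hm j).aemeasurable).1
    (indepFun_update hm hind j)
  rw [hX.map_eq] at hlaw
  have h1 : P {ω | (Function.update (fun s => X s ω) j 0, X j ω) ∈ A}
      = ((P.map fun ω => Function.update (fun s => X s ω) j 0).prod μ) A := by
    rw [← hlaw, Measure.map_apply (hUm.prodMk (hm j)) hA]
    rfl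
  rw [h1, Measure.measure_prod_null hA, EventuallyEq, ae_map_iff hUm.aemeasurable]
  · rfl
  · exact measurable_measure_prodMk_left hA (measurableSet_singleton 0)

lemma measurable_shiftedSeries_tailPoints : Measurable fun z : (ℕ → ℝ) × ℝ =>
    shiftedSeries (tailPoints z.1) z.2 + Real.eulerMascheroniConstant := by
  unfold shiftedSeries tailPoints
  refine (Measurable.tsum fun k => ?_).add_const _
  fun_prop

/-- The law of `ζ°` has no atoms. -/
theorem measure_zetaCirc_eq (hm : ∀ s, Measurable (e s))
    (he : ∀ s, HasLaw (e s) (expMeasure 1) P) (hind : iIndepFun e P) (a : ℝ) :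
    P {ω | zetaCirc e ω = a} = 0 := by
  have hA : MeasurableSet {z : (ℕ → ℝ) × ℝ |
      shiftedSeries (tailPoints z.1) z.2 + Real.eulerMascheroniConstant = a} :=
    measurable_shiftedSeries_tailPoints (measurableSet_singleton a)
  have h := measure_eq_zero_iff_sections hm hind 0 (he 0) hA
  simp only [Set.mem_ofPred_eq, ← zetaCirc_eq_shiftedSeries] at h
  rw [h]
  filter_upwards [ae_tailPoints he hind] with ω hω
  rw [expMeasure_one_apply_eq_zero_iff]
  refine Set.Countable.measure_zero ?_ _
  have hsub : Set.Ici (0 : ℝ) ∩ {x | shiftedSeries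
      (tailPoints (Function.update (fun s => e s ω) 0 0)) x + Real.eulerMascheroniConstant = a}
      ⊆ insert 0 (Set.Ioi (0 : ℝ) ∩ {x | shiftedSeries
      (tailPoints (Function.update (fun s => e s ω) 0 0)) x + Real.eulerMascheroniConstant = a}) := by
    rintro x ⟨hx, hxa⟩
    rcases (show (0 : ℝ) ≤ x from hx).eq_or_lt with h0 | h0
    · exact Or.inl h0.symm
    · exact Or.inr ⟨h0, hxa⟩
  refine Set.Countable.mono hsub (Set.Countable.insert _ (Set.Subsingleton.countable ?_))
  rintro x ⟨hx, hxa⟩ y ⟨hy, hya⟩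
  refine (strictAntiOn_shiftedSeries hω.1 hω.2).injOn hx hy ?_
  have hxa : _ + _ = a := hxa
  have hya : _ + _ = a := hya
  linarith

/-- The law of `ζ°` charges every interval. -/
theorem measure_zetaCirc_mem_Ioo_pos (hm : ∀ s, Measurable (e s))
    (he : ∀ s, HasLaw (e s) (expMeasure 1) P) (hind : iIndepFun e P) {a b : ℝ} (hab : a < b) :
    0 < P {ω | zetaCirc e ω ∈ Set.Ioo a b} := by
  have := hind.isProbabilityMeasure
  have hA : MeasurableSet {z : (ℕ → ℝ) × ℝ |
      shiftedSeries (tailPoints z.1) z.2 + Real.eulerMascheroniConstant ∈ Set.Ioo a b} :=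
    measurable_shiftedSeries_tailPoints measurableSet_Ioo
  have h := measure_eq_zero_iff_sections hm hind 0 (he 0) hA
  simp only [Set.mem_ofPred_eq, ← zetaCirc_eq_shiftedSeries] at h
  rw [pos_iff_ne_zero]
  intro hzero
  have hcon : ∀ᵐ ω ∂P, False := by
    filter_upwards [h.1 hzero, ae_tailPoints he hind] with ω h0 hω
    set R := tailPoints (Function.update (fun s => e s ω) 0 0) with hRdef
    rw [expMeasure_one_apply_eq_zero_iff] at h0
    have hR0 : R 0 = 0 := by simp [hRdef, tailPoints, pointSum]
    obtain ⟨x, hx, hxm⟩ := exists_shiftedSeries_eq hR0 hω.1 hω.2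
      ((a + b) / 2 - Real.eulerMascheroniConstant)
    have hopen : IsOpen (Set.Ioi (0 : ℝ) ∩ (fun x => shiftedSeries R x
        + Real.eulerMascheroniConstant) ⁻¹' Set.Ioo a b) :=
      ((continuousOn_shiftedSeries hω.1 hω.2).add continuousOn_const).isOpen_inter_preimage
        isOpen_Ioi isOpen_Ioo
    have hne : (Set.Ioi (0 : ℝ) ∩ (fun x => shiftedSeries R x
        + Real.eulerMascheroniConstant) ⁻¹' Set.Ioo a b).Nonempty := by
      refine ⟨x, hx, ?_⟩
      simp only [Set.mem_preimage, hxm, sub_add_cancel]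
      constructor <;> linarith
    have hpos := hopen.measure_pos volume hne
    refine hpos.ne' (measure_mono_null ?_ h0)
    exact fun y hy => ⟨Set.mem_Ici.2 (le_of_lt (Set.mem_Ioi.1 hy.1)), hy.2⟩
  simp at hcon
  exact IsProbabilityMeasure.ne_zero P hcon

end LimitLaw

section StatisticAtoms

variable {Ω : Type*} [MeasurableSpace Ω] {P : Measure Ω} {ξ : ℕ → Ω → ℝ}

/-- The statistic has no atoms as soon as one weight is positive. -/
lemma measure_tsum_mul_exp_eq (hm : ∀ i, Measurable (ξ i))
    (hξ : ∀ i, HasLaw (ξ i) (gaussianReal 0 1) P) (hind : iIndepFun ξ P) {w : ℕ → ℝ} {j : ℕ}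
    (hj : 0 < w j) (hs : ∀ᵐ ω ∂P, Summable fun i => w i * Real.exp (ξ i ω ^ 2 / 2)) (a : ℝ) :
    P {ω | ∑' i, w i * Real.exp (ξ i ω ^ 2 / 2) = a} = 0 := by
  set g : (ℕ → ℝ) × ℝ → ℝ := fun z => w j * Real.exp (z.2 ^ 2 / 2)
    + ∑' i, if i = j then 0 else w i * Real.exp (z.1 i ^ 2 / 2) with hg
  have hgm : Measurable g := by
    refine Measurable.add (by fun_prop) (Measurable.tsum fun i => ?_)
    by_cases h : i = j
    · simp only [h, if_true]; exact measurable_const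
    · simp only [h, if_false]; fun_prop
  have h := measure_eq_zero_iff_sections hm hind j (hξ j) (hgm (measurableSet_singleton a))
  have hzero : P {ω | (Function.update (fun s => ξ s ω) j 0, ξ j ω) ∈ g ⁻¹' {a}} = 0 := by
    rw [h]
    refine Eventually.of_forall fun ω => ?_
    set c := ∑' i, if i = j then 0 else
      w i * Real.exp (Function.update (fun s => ξ s ω) j 0 i ^ 2 / 2) with hc
    have hna := nullSingletonClass_gaussianReal (μ := 0) (v := 1) one_ne_zero
    refine Set.Countable.measure_zero ?_ _
    refine Set.Countable.mono (s₂ := {√(2 * Real.log ((a - c) / w j)),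
      -√(2 * Real.log ((a - c) / w j))}) ?_ (by simp)
    intro x hx
    have hx : w j * Real.exp (x ^ 2 / 2) + c = a := hx
    have h1 : Real.exp (x ^ 2 / 2) = (a - c) / w j := by
      rw [eq_div_iff hj.ne']; linarith
    have h2 : x ^ 2 = 2 * Real.log ((a - c) / w j) := by
      rw [← h1, Real.log_exp]; ring
    rw [← h2, Real.sqrt_sq_eq_abs]
    rcases abs_choice x with h3 | h3 <;> simp [h3]
  have hsub : ∀ᵐ ω ∂P, ω ∈ {ω | ∑' i, w i * Real.exp (ξ i ω ^ 2 / 2) = a} →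
      ω ∈ {ω | (Function.update (fun s => ξ s ω) j 0, ξ j ω) ∈ g ⁻¹' {a}} := by
    filter_upwards [hs] with ω hω hωa
    have hωa : _ = a := hωa
    show g _ = a
    rw [← hωa, hω.tsum_eq_add_tsum_ite j, hg]
    simp only
    congr 1
    refine tsum_congr fun i => ?_
    by_cases hi : i = j
    · simp [hi]
    · simp [hi]
  exact measure_mono_null_ae hsub hzero

end StatisticAtoms

/-! ### Quantiles, coupling and critical values -/

section Quantiles

/-- The quantile function of a probability measure on `ℝ`, characterized by the Galois connection
with the distribution function. -/
lemma exists_quantile (μ : Measure ℝ) :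
    ∃ q : ℝ → ℝ, ∀ u ∈ Set.Ioo (0 : ℝ) 1, ∀ x, q u ≤ x ↔ u ≤ cdf μ x := by
  refine ⟨fun u => sInf {x | u ≤ cdf μ x}, fun u hu x => ?_⟩
  have hne : {x | u ≤ cdf μ x}.Nonempty := by
    obtain ⟨x, hx⟩ := ((tendsto_cdf_atTop μ).eventually (lt_mem_nhds hu.2)).exists
    exact ⟨x, hx.le⟩
  have hbdd : BddBelow {x | u ≤ cdf μ x} := by
    obtain ⟨y, hy⟩ := ((tendsto_cdf_atBot μ).eventually (gt_mem_nhds hu.1)).exists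
    refine ⟨y, fun x hx => ?_⟩
    by_contra h
    exact absurd (hx.trans (monotone_cdf μ (not_le.1 h).le)) (not_le.2 hy)
  refine ⟨fun h => ?_, fun h => csInf_le hbdd h⟩
  have hright : Tendsto (cdf μ) (𝓝[>] x) (𝓝 (cdf μ x)) :=
    ((cdf μ).right_continuous x).mono_left (nhdsWithin_mono x Set.Ioi_subset_Ici_self)
  refine ge_of_tendsto hright ?_
  filter_upwards [self_mem_nhdsWithin] with y hy
  obtain ⟨z, hz, hzy⟩ := exists_lt_of_csInf_lt hne (lt_of_le_of_lt h hy)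
  exact le_trans hz (monotone_cdf μ hzy.le)

variable {μ : Measure ℝ} [IsProbabilityMeasure μ]

lemma continuous_cdf_of_atomless (h0 : ∀ a, μ {a} = 0) : Continuous (cdf μ) := by
  refine continuous_iff_continuousAt.2 fun a => ?_
  rw [(monotone_cdf μ).continuousAt_iff_leftLim_eq_rightLim, StieltjesFunction.rightLim_eq]
  have h1 := (cdf μ).measure_singleton a
  rw [measure_cdf, h0 a] at h1
  have h2 := ENNReal.ofReal_eq_zero.1 h1.symm
  exact le_antisymm ((monotone_cdf μ).leftLim_le le_rfl) (by linarith)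

lemma strictMono_cdf_of_pos (hpos : ∀ a b, a < b → 0 < μ (Set.Ioo a b)) : StrictMono (cdf μ) := by
  intro a b hab
  have h1 := (cdf μ).measure_Ioc a b
  rw [measure_cdf] at h1
  have h2 : 0 < μ (Set.Ioc a b) := (hpos a b hab).trans_le (measure_mono Set.Ioo_subset_Ioc_self)
  rw [h1, ENNReal.ofReal_pos] at h2
  linarith

lemma cdf_mem_Ioo (hpos : ∀ a b, a < b → 0 < μ (Set.Ioo a b)) (z : ℝ) :
    cdf μ z ∈ Set.Ioo (0 : ℝ) 1 := by
  have hs := strictMono_cdf_of_pos hpos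
  exact ⟨(cdf_nonneg μ (z - 1)).trans_lt (hs (by linarith)),
    (hs (show z < z + 1 by linarith)).trans_le (cdf_le_one μ _)⟩

lemma exists_cdf_eq (h0 : ∀ a, μ {a} = 0) {v : ℝ} (hv : v ∈ Set.Ioo (0 : ℝ) 1) :
    ∃ z, cdf μ z = v := by
  obtain ⟨x, hx⟩ := ((tendsto_cdf_atBot μ).eventually (gt_mem_nhds hv.1)).exists
  obtain ⟨y, hy⟩ := ((tendsto_cdf_atTop μ).eventually (lt_mem_nhds hv.2)).exists
  exact mem_range_of_exists_le_of_exists_ge (continuous_cdf_of_atomless h0) ⟨x, hx.le⟩ ⟨y, hy.le⟩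

/-- The probability integral transform: the distribution function of an atomless law of full
support maps it to the uniform law. -/
lemma measure_cdf_le (h0 : ∀ a, μ {a} = 0) (hpos : ∀ a b, a < b → 0 < μ (Set.Ioo a b))
    {v : ℝ} (hv0 : 0 ≤ v) (hv1 : v ≤ 1) : μ {z | cdf μ z ≤ v} = ENNReal.ofReal v := by
  have hmem := cdf_mem_Ioo hpos
  rcases hv0.eq_or_lt with rfl | hv0
  · have : {z | cdf μ z ≤ 0} = ∅ := by
      ext z; simpa using (hmem z).1
    simp [this]
  rcases hv1.eq_or_lt with rfl | hv1
  · have : {z | cdf μ z ≤ 1} = Set.univ := by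
      ext z; simpa using (hmem z).2.le
    simp [this]
  obtain ⟨z₀, rfl⟩ := exists_cdf_eq h0 ⟨hv0, hv1⟩
  have : {z | cdf μ z ≤ cdf μ z₀} = Set.Iic z₀ := by
    ext z; exact (strictMono_cdf_of_pos hpos).le_iff_le
  rw [this, ofReal_cdf]

lemma isCriticalValue_iff {Ω : Type*} [MeasurableSpace Ω] {P : Measure Ω} [IsProbabilityMeasure P]
    {X : Ω → ℝ} (hX : AEMeasurable X P) (h0 : ∀ a, P.map X {a} = 0) {α : ℝ} (hα : 0 < α) (t : ℝ) :
    IsCriticalValue P X α t ↔ cdf (P.map X) t = 1 - α := by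
  have := Measure.isProbabilityMeasure_map hX
  have h1 : P {ω | t ≤ X ω} = P.map X (Set.Ici t) := by
    rw [Measure.map_apply_of_aemeasurable hX measurableSet_Ici]; rfl
  have h2 : P.map X (Set.Ici t) = ENNReal.ofReal (1 - cdf (P.map X) t) := by
    have h3 : P.map X (Set.Ici t) = P.map X (Set.Ioi t) := by
      rw [← Set.Ioi_insert, Set.insert_eq]
      refine le_antisymm ((measure_union_le _ _).trans (by rw [h0, zero_add])) ?_
      exact measure_mono Set.subset_union_right
    rw [h3, ← Set.compl_Iic, prob_compl_eq_one_sub measurableSet_Iic, ← ofReal_cdf,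
      ENNReal.ofReal_sub _ (cdf_nonneg _ _), ENNReal.ofReal_one]
  rw [IsCriticalValue, h1, h2, ENNReal.ofReal_eq_ofReal_iff (by linarith [cdf_le_one (P.map X) t])
    hα.le]
  constructor <;> intro h <;> linarith

end Quantiles

section Laws

variable {Ω : Type*} [MeasurableSpace Ω] {P : Measure Ω}

/-- Transfer of the law of a functional of an independent sequence to the product space, where the
coordinates are measurable and not merely almost everywhere measurable. -/
lemma hasLaw_infinitePi_of_iIndepFun {X : ℕ → Ω → ℝ} {μ : Measure ℝ} [IsProbabilityMeasure μ]
    (hX : ∀ i, HasLaw (X i) μ P) (hind : iIndepFun X P) :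
    HasLaw (fun ω i => X i ω) (Measure.infinitePi fun _ : ℕ => μ) P :=
  hind.hasLaw_infinitePi hX (aemeasurable_pi_iff.2 fun i => (hX i).aemeasurable)

lemma hasLaw_eval_infinitePi (μ : Measure ℝ) [IsProbabilityMeasure μ] (i : ℕ) :
    HasLaw (fun x : ℕ → ℝ => x i) μ (Measure.infinitePi fun _ : ℕ => μ) :=
  (measurePreserving_eval_infinitePi (fun _ : ℕ => μ) i).hasLaw

lemma iIndepFun_eval_infinitePi (μ : Measure ℝ) [IsProbabilityMeasure μ] :
    iIndepFun (fun (i : ℕ) (x : ℕ → ℝ) => x i) (Measure.infinitePi fun _ : ℕ => μ) :=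
  iIndepFun_infinitePi (X := fun _ x => x) fun _ => measurable_id

lemma map_comp_eq {X : ℕ → Ω → ℝ} {ν : Measure (ℕ → ℝ)} (hX : HasLaw (fun ω i => X i ω) ν P)
    {f : (ℕ → ℝ) → ℝ} (hf : Measurable f) : P.map (fun ω => f fun i => X i ω) = ν.map f := by
  rw [← hX.map_eq, AEMeasurable.map_map_of_aemeasurable hf.aemeasurable hX.aemeasurable]
  rfl

variable {e ξ : ℕ → Ω → ℝ}

lemma measurable_zetaCirc_eval : Measurable (zetaCirc fun s (x : ℕ → ℝ) => x s) :=
  measurable_zetaCirc fun s => measurable_pi_apply s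

lemma aemeasurable_zetaCirc (he : ∀ s, HasLaw (e s) (expMeasure 1) P) :
    AEMeasurable (zetaCirc e) P :=
  measurable_zetaCirc_eval.comp_aemeasurable
    (aemeasurable_pi_iff.2 fun i => (he i).aemeasurable)

lemma map_zetaCirc_eq (he : ∀ s, HasLaw (e s) (expMeasure 1) P) (hind : iIndepFun e P) :
    P.map (zetaCirc e) = (Measure.infinitePi fun _ : ℕ => expMeasure 1).map
      (zetaCirc fun s (x : ℕ → ℝ) => x s) :=
  map_comp_eq (hasLaw_infinitePi_of_iIndepFun he hind) measurable_zetaCirc_eval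

lemma map_zetaCirc_singleton (he : ∀ s, HasLaw (e s) (expMeasure 1) P) (hind : iIndepFun e P)
    (a : ℝ) : P.map (zetaCirc e) {a} = 0 := by
  rw [map_zetaCirc_eq he hind, Measure.map_apply measurable_zetaCirc_eval
    (measurableSet_singleton a)]
  exact measure_zetaCirc_eq (fun s => measurable_pi_apply s)
    (hasLaw_eval_infinitePi (expMeasure 1)) (iIndepFun_eval_infinitePi (expMeasure 1)) a

lemma map_zetaCirc_Ioo_pos (he : ∀ s, HasLaw (e s) (expMeasure 1) P) (hind : iIndepFun e P)
    (a b : ℝ) (hab : a < b) : 0 < P.map (zetaCirc e) (Set.Ioo a b) := by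
  rw [map_zetaCirc_eq he hind, Measure.map_apply measurable_zetaCirc_eval measurableSet_Ioo]
  exact measure_zetaCirc_mem_Ioo_pos (fun s => measurable_pi_apply s)
    (hasLaw_eval_infinitePi (expMeasure 1)) (iIndepFun_eval_infinitePi (expMeasure 1)) hab

lemma charFun_map_zetaCirc (he : ∀ s, HasLaw (e s) (expMeasure 1) P) (hind : iIndepFun e P)
    (θ : ℝ) : charFun (P.map (zetaCirc e)) θ = Complex.exp (levyExponent θ) := by
  rw [map_zetaCirc_eq he hind]
  exact charFun_zetaCirc (fun s => measurable_pi_apply s)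
    (hasLaw_eval_infinitePi (expMeasure 1)) (iIndepFun_eval_infinitePi (expMeasure 1)) θ

lemma map_bayesStat_singleton {π : ℝ → ℝ} (hπ : IsPriorDensity π)
    (hξ : ∀ i, HasLaw (ξ i) (gaussianReal 0 1) P) (hind : iIndepFun ξ P) :
    ∀ᶠ n in atTop, ∀ a, P.map (bayesStat π ξ n) {a} = 0 := by
  filter_upwards [hπ.hasSum_priorWeight,
    hπ.ae_summable_bayesStat (hasLaw_eval_infinitePi (gaussianReal 0 1))] with n h1 h2 a
  obtain ⟨j, hj⟩ : ∃ j, 0 < priorWeight π n j := by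
    by_contra! h
    have h3 : priorWeight π n = fun _ => 0 := by
      ext j; exact le_antisymm (h j) (hπ.priorWeight_nonneg n j)
    rw [h3] at h1
    exact one_ne_zero (h1.unique hasSum_zero)
  have h3 : P.map (bayesStat π ξ n) = (Measure.infinitePi fun _ : ℕ => gaussianReal 0 1).map
      (bayesStat π (fun i (x : ℕ → ℝ) => x i) n) :=
    map_comp_eq (hasLaw_infinitePi_of_iIndepFun hξ hind) (measurable_bayesStat_eval π n)
  rw [h3, Measure.map_apply (measurable_bayesStat_eval π n) (measurableSet_singleton a)]
  exact measure_tsum_mul_exp_eq (fun s => measurable_pi_apply s)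
    (hasLaw_eval_infinitePi (gaussianReal 0 1)) (iIndepFun_eval_infinitePi (gaussianReal 0 1))
    hj h2 a

end Laws

section Convergence

variable {Ω₁ Ω₂ : Type*} [MeasurableSpace Ω₁] [MeasurableSpace Ω₂]
  {P₁ : Measure Ω₁} [IsProbabilityMeasure P₁] {P₂ : Measure Ω₂} [IsProbabilityMeasure P₂]
  {ξ : ℕ → Ω₁ → ℝ} {e : ℕ → Ω₂ → ℝ} {π : ℝ → ℝ}

lemma centredStat_le_iff {Ω : Type*} {ξ : ℕ → Ω → ℝ} {n : ℕ} (hb : 0 < bSeq n) (ω : Ω) (z : ℝ) :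
    centredStat π ξ n ω ≤ z ↔ bayesStat π ξ n ω ≤ bayesExpansion z (entropy π) n := by
  have hpi := Real.pi_pos
  have hs : 0 < scaleSeq n := by unfold scaleSeq; positivity
  have h1 : scaleSeq n * bayesExpansion z (entropy π) n = bSeq n ^ 2 + entropy π + z := by
    have h2 : √(Real.pi / 2) * √(2 / Real.pi) = 1 := by
      rw [← Real.sqrt_mul (by positivity)]
      have : Real.pi / 2 * (2 / Real.pi) = 1 := by field_simp
      rw [this, Real.sqrt_one]
    have h3 : bSeq n * (bSeq n + (z + entropy π) / bSeq n) = bSeq n ^ 2 + entropy π + z := by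
      field_simp; ring
    rw [scaleSeq, bayesExpansion]
    linear_combination (bSeq n * (bSeq n + (z + entropy π) / bSeq n)) * h2 + h3
  rw [centredStat, ← mul_le_mul_iff_right₀ hs (b := bayesStat π ξ n ω), h1]
  constructor <;> intro h <;> linarith

/-- Convergence in law of the statistic, in terms of distribution functions. -/
theorem IsPriorDensity.tendsto_cdf_bayesStat (hπ : IsPriorDensity π)
    (hξ : ∀ i, HasLaw (ξ i) (gaussianReal 0 1) P₁) (hξi : iIndepFun ξ P₁)
    (he : ∀ s, HasLaw (e s) (expMeasure 1) P₂) (hei : iIndepFun e P₂) (z : ℝ) :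
    Tendsto (fun n => cdf (P₁.map (bayesStat π ξ n)) (bayesExpansion z (entropy π) n)) atTop
      (𝓝 (cdf (P₂.map (zetaCirc e)) z)) := by
  have hS : ∀ n, AEMeasurable (bayesStat π ξ n) P₁ :=
    aemeasurable_bayesStat (fun i => (hξ i).aemeasurable) π
  have hC : ∀ n, AEMeasurable (centredStat π ξ n) P₁ := fun n =>
    ((hS n).const_mul _).sub_const _
  have hζ := aemeasurable_zetaCirc he
  let μ : ℕ → ProbabilityMeasure ℝ := fun n =>
    ⟨P₁.map (centredStat π ξ n), Measure.isProbabilityMeasure_map (hC n)⟩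
  let μ₀ : ProbabilityMeasure ℝ := ⟨P₂.map (zetaCirc e), Measure.isProbabilityMeasure_map hζ⟩
  have hlim : Tendsto μ atTop (𝓝 μ₀) := by
    refine ProbabilityMeasure.tendsto_of_tendsto_charFun fun θ => ?_
    show Tendsto (fun n => charFun (P₁.map (centredStat π ξ n)) θ) atTop
      (𝓝 (charFun (P₂.map (zetaCirc e)) θ))
    rw [charFun_map_zetaCirc he hei]
    exact hπ.tendsto_charFun_centredStat hξ hξi θ
  have hfr : μ₀ (frontier (Set.Iic z)) = 0 := by
    rw [frontier_Iic]
    have := map_zetaCirc_singleton he hei z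
    simp only [μ₀, ProbabilityMeasure.mk_apply, this, ENNReal.toNNReal_zero]
  have h1 := ProbabilityMeasure.tendsto_measure_of_null_frontier_of_tendsto hlim hfr
  have h2 := (NNReal.continuous_coe.tendsto _).comp h1
  have hp0 : IsProbabilityMeasure (P₂.map (zetaCirc e)) := Measure.isProbabilityMeasure_map hζ
  rw [cdf_eq_real]
  refine h2.congr' ?_
  filter_upwards [tendsto_bSeq_atTop.eventually_gt_atTop 0] with n hb
  have hpn : IsProbabilityMeasure (P₁.map (bayesStat π ξ n)) :=
    Measure.isProbabilityMeasure_map (hS n)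
  rw [cdf_eq_real, map_measureReal_apply_of_aemeasurable (hS n) measurableSet_Iic]
  show ((P₁.map (centredStat π ξ n)).real (Set.Iic z)) = _
  rw [map_measureReal_apply_of_aemeasurable (hC n) measurableSet_Iic]
  congr 1
  ext ω
  exact centredStat_le_iff hb ω z

/-- A sequence squeezed between the expansions at `z - ε` and `z + ε` for every `ε` agrees with the
expansion at `z` up to `o(1/√(log n))`. -/
lemma tendsto_sub_bayesExpansion_div {x : ℕ → ℝ} {z h : ℝ}
    (hx : ∀ ε, 0 < ε → ∀ᶠ n in atTop, bayesExpansion (z - ε) h n ≤ x n ∧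
      x n ≤ bayesExpansion (z + ε) h n) :
    Tendsto (fun n : ℕ => (x n - bayesExpansion z h n) / (1 / √(Real.log n))) atTop (𝓝 0) := by
  rw [Metric.tendsto_nhds]
  intro ε hε
  filter_upwards [hx (ε / 2) (by positivity), tendsto_bSeq_atTop.eventually_gt_atTop 0,
    tendsto_bSeq_sq_div_log.eventually (lt_mem_nhds (show (1 : ℝ) < 2 by norm_num)),
    tendsto_log_natCast.eventually_gt_atTop 0] with n h1 hb h2 hl
  rw [lt_div_iff₀ hl, one_mul] at h2
  have h3 : √(Real.log n) ≤ bSeq n := (Real.sqrt_le_left hb.le).2 h2.le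
  have h4 : √(2 / Real.pi) ≤ 1 := by
    rw [Real.sqrt_le_one, div_le_one Real.pi_pos]
    linarith [Real.pi_gt_three]
  have h5 : ∀ δ, bayesExpansion (z + δ) h n
      = bayesExpansion z h n + √(2 / Real.pi) * (δ / bSeq n) := by
    intro δ; unfold bayesExpansion; ring
  have h6 : |x n - bayesExpansion z h n| ≤ ε / 2 / bSeq n := by
    have h7 : √(2 / Real.pi) * (ε / 2 / bSeq n) ≤ ε / 2 / bSeq n :=
      mul_le_of_le_one_left (by positivity) h4
    have h8 := h1.1
    have h9 := h1.2
    rw [sub_eq_add_neg, h5, neg_div, mul_neg] at h8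
    rw [h5] at h9
    rw [abs_le]
    constructor <;> linarith
  rw [Real.dist_eq, sub_zero, div_div_eq_mul_div, div_one, abs_mul, abs_of_nonneg
    (Real.sqrt_nonneg _)]
  calc |x n - bayesExpansion z h n| * √(Real.log n) ≤ ε / 2 / bSeq n * bSeq n := by gcongr
    _ = ε / 2 := by field_simp
    _ < ε := by linarith

end Convergence

theorem theorem5
    {Ω₁ Ω₂ : Type*} [MeasurableSpace Ω₁] [MeasurableSpace Ω₂]
    (P₁ : Measure Ω₁) [IsProbabilityMeasure P₁] (P₂ : Measure Ω₂) [IsProbabilityMeasure P₂]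
    (ξ : ℕ → Ω₁ → ℝ) (hξ : ∀ i, HasLaw (ξ i) (gaussianReal 0 1) P₁) (hξ_indep : iIndepFun ξ P₁)
    (e : ℕ → Ω₂ → ℝ) (he : ∀ s, HasLaw (e s) (expMeasure 1) P₂) (he_indep : iIndepFun e P₂)
    (π : ℝ → ℝ) (hπ : IsPriorDensity π) :
    -- all the series involved converge
    (∀ᶠ n : ℕ in atTop, HasSum (priorWeight π n) 1 ∧
      ∀ᵐ ω ∂P₁, Summable (fun i => priorWeight π n i * Real.exp (ξ i ω ^ 2 / 2))) ∧
    (∀ᵐ ω ∂P₂, Summable (fun k => zetaTerm e k ω)) ∧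
    -- the expansion of the Bayes statistic
    EqInProbUpTo P₁ P₂ (bayesStat π ξ)
      (fun n ω => bayesExpansion (zetaCirc e ω) (entropy π) n)
      (fun n => 1 / √(Real.log n)) ∧
    -- the expansion of the Bayes critical value
    (∀ α : ℝ, 0 < α → α < 1 →
      (∃ τ, IsCriticalValue P₂ (zetaCirc e) α τ) ∧
      (∀ᶠ n : ℕ in atTop, ∃ t, IsCriticalValue P₁ (bayesStat π ξ n) α t) ∧
      ∀ (τ : ℝ) (t : ℕ → ℝ), IsCriticalValue P₂ (zetaCirc e) α τ →
        (∀ᶠ n : ℕ in atTop, IsCriticalValue P₁ (bayesStat π ξ n) α (t n)) →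
        (fun n : ℕ => t n - bayesExpansion τ (entropy π) n)
          =o[atTop] (fun n : ℕ => 1 / √(Real.log n))) := by
  have hS : ∀ n, AEMeasurable (bayesStat π ξ n) P₁ :=
    aemeasurable_bayesStat (fun i => (hξ i).aemeasurable) π
  have hζ := aemeasurable_zetaCirc he
  set μ := P₂.map (zetaCirc e) with hμ
  have hμp : IsProbabilityMeasure μ := Measure.isProbabilityMeasure_map hζ
  have hSp : ∀ n, IsProbabilityMeasure (P₁.map (bayesStat π ξ n)) := fun n =>
    Measure.isProbabilityMeasure_map (hS n)
  have hμ0 : ∀ a, μ {a} = 0 := map_zetaCirc_singleton he he_indep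
  have hμpos : ∀ a b, a < b → 0 < μ (Set.Ioo a b) := map_zetaCirc_Ioo_pos he he_indep
  have hmono := strictMono_cdf_of_pos hμpos
  have hconv : ∀ z, Tendsto (fun n => cdf (P₁.map (bayesStat π ξ n))
      (bayesExpansion z (entropy π) n)) atTop (𝓝 (cdf μ z)) :=
    hπ.tendsto_cdf_bayesStat hξ hξ_indep he he_indep
  refine ⟨hπ.hasSum_priorWeight.and (hπ.ae_summable_bayesStat hξ),
    ae_summable_zetaTerm he he_indep, ?_, ?_⟩
  · -- the quantile coupling on the real line with the law of `ζ°`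
    choose q hq using fun n => exists_quantile (P₁.map (bayesStat π ξ n))
    have hKle : ∀ n z x, q n (cdf μ z) ≤ x ↔ cdf μ z ≤ cdf (P₁.map (bayesStat π ξ n)) x :=
      fun n z x => hq n _ (cdf_mem_Ioo hμpos z) x
    have hKm : ∀ n, Measurable fun z => q n (cdf μ z) := by
      intro n
      refine measurable_of_Iic fun x => ?_
      have : (fun z => q n (cdf μ z)) ⁻¹' Set.Iic x
          = {z | cdf μ z ≤ cdf (P₁.map (bayesStat π ξ n)) x} := by
        ext z; exact hKle n z x
      rw [this]
      exact measurableSet_le (monotone_cdf μ).measurable measurable_const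
    refine ⟨ℝ, inferInstance, μ, hμp, fun n z => q n (cdf μ z),
      fun n z => bayesExpansion z (entropy π) n, fun n => ?_, ?_, fun ε hε => ?_⟩
    · refine ⟨(hKm n).aemeasurable, hS n, ?_⟩
      have := Measure.isProbabilityMeasure_map (μ := μ) (hKm n).aemeasurable
      refine Measure.eq_of_cdf _ _ ?_
      ext x
      rw [cdf_eq_real, map_measureReal_apply (hKm n) measurableSet_Iic, measureReal_def]
      have h1 : (fun z => q n (cdf μ z)) ⁻¹' Set.Iic x
          = {z | cdf μ z ≤ cdf (P₁.map (bayesStat π ξ n)) x} := by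
        ext z; exact hKle n z x
      rw [h1, measure_cdf_le hμ0 hμpos (cdf_nonneg _ _) (cdf_le_one _ _),
        ENNReal.toReal_ofReal (cdf_nonneg _ _)]
    · have h1 : IdentDistrib (fun z : ℝ => z) (zetaCirc e) μ P₂ :=
        ⟨aemeasurable_id', hζ, by rw [Measure.map_id', hμ]⟩
      refine h1.comp (u := fun z n => bayesExpansion z (entropy π) n) ?_
      refine measurable_pi_lambda _ fun n => ?_
      unfold bayesExpansion
      fun_prop
    · have hpt : ∀ z, Tendsto (fun n : ℕ =>
          (q n (cdf μ z) - bayesExpansion z (entropy π) n) / (1 / √(Real.log n))) atTop (𝓝 0) := by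
        intro z
        refine tendsto_sub_bayesExpansion_div fun δ hδ => ?_
        filter_upwards [(hconv (z - δ)).eventually (gt_mem_nhds (hmono (show z - δ < z by linarith))),
          (hconv (z + δ)).eventually (lt_mem_nhds (hmono (show z < z + δ by linarith)))]
          with n h1 h2
        refine ⟨?_, (hKle n z _).2 h2.le⟩
        by_contra h
        exact absurd ((hKle n z _).1 (not_le.1 h).le) (not_le.2 h1)
      have hmeas : ∀ n : ℕ, Measurable fun z =>
          (q n (cdf μ z) - bayesExpansion z (entropy π) n) / (1 / √(Real.log n)) := by
        intro n
        have hexp : Measurable fun z => bayesExpansion z (entropy π) n := by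
          unfold bayesExpansion
          fun_prop
        exact ((hKm n).sub hexp).div_const _
      have htm := tendstoInMeasure_of_tendsto_ae (μ := μ)
        (fun n => (hmeas n).aestronglyMeasurable) (Eventually.of_forall hpt)
      rw [tendstoInMeasure_iff_norm] at htm
      refine (htm ε hε).congr fun n => ?_
      congr 1
      ext z
      simp only [sub_zero, Real.norm_eq_abs, abs_div,
        abs_of_nonneg (show (0 : ℝ) ≤ 1 / √(Real.log n) by positivity)]
  · intro α hα0 hα1
    have hcritζ := isCriticalValue_iff hζ hμ0 hα0
    have hatoms := map_bayesStat_singleton hπ hξ hξ_indep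
    refine ⟨?_, ?_, fun τ t hτ ht => ?_⟩
    · obtain ⟨τ, hτ⟩ := exists_cdf_eq hμ0 (v := 1 - α) ⟨by linarith, by linarith⟩
      exact ⟨τ, (hcritζ τ).2 hτ⟩
    · filter_upwards [hatoms] with n hn
      obtain ⟨t, ht⟩ := exists_cdf_eq hn (v := 1 - α) ⟨by linarith, by linarith⟩
      exact ⟨t, (isCriticalValue_iff (hS n) hn hα0 t).2 ht⟩
    · have hτ' := (hcritζ τ).1 hτ
      have hlim : Tendsto (fun n : ℕ =>
          (t n - bayesExpansion τ (entropy π) n) / (1 / √(Real.log n))) atTop (𝓝 0) := by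
        refine tendsto_sub_bayesExpansion_div fun δ hδ => ?_
        filter_upwards [(hconv (τ - δ)).eventually (gt_mem_nhds (hmono (show τ - δ < τ by linarith))),
          (hconv (τ + δ)).eventually (lt_mem_nhds (hmono (show τ < τ + δ by linarith))), hatoms, ht]
          with n h1 h2 hn htn
        have htn' := (isCriticalValue_iff (hS n) hn hα0 (t n)).1 htn
        rw [hτ', ← htn'] at h1 h2
        exact ⟨((monotone_cdf _).reflect_lt h1).le, ((monotone_cdf _).reflect_lt h2).le⟩
      refine (isLittleO_iff_tendsto' ?_).2 hlim
      filter_upwards [tendsto_log_natCast.eventually_gt_atTop 0] with n hn h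
      have : 0 < 1 / √(Real.log n) := by positivity
      exact absurd h this.ne'
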